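/- **Model.** All graphs are finite, simple, connected and 3-regular, with edges labelled $0,1,2$ so that the three edges at each vertex have distinct labels. A set $\mathcal A$ of $k$ cooperative $s$-state agents consists of $k$ deterministic finite automata with $s$ states, starting states and halting states, moving synchronously: in every step each agent sees its state, the label of the edge through which it entered its vertex (if it has moved), and the states of the agents at the same vertex; it then changes its state and stays or moves along an edge with a chosen label. The process ends when all agents are in halting states. **Barriers.** Let $B$ be a graph with two distinct distinguished edges $\{u,v\},\{u',v'\}$ labelled $0$. A graph $G$ is *joined* to $B$ by deleting these two edges and two edges labelled $0$ of $G$, and matching the four resulting degree-2 vertices of $B$ with those of $G$ (in any way) by edges labelled $0$. For $1\le r\le k$, $B$ is an *$r$-barrier* for $\mathcal A$ if for every $G$ joined to $B$ and every run with all agents starting in their starting states at vertices of $G$: (i) for every set $\mathcal A'$ of at most $r$ agents, no agent of $\mathcal A'$ walks inside $B$ from $\{u,v\}$ to $\{u',v'\}$ or vice versa during a period in which only agents of $\mathcal A'$ are in $B$; (ii) no set $\mathcal A'$ of $r+1$ agents splits up in $B$: there is no period in which all agents of $\mathcal A'$, and no others, visit $B$, such that some agent of $\mathcal A'$ is at one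 side ($\{u,v\}$ or $\{u',v'\}$) of $B$ at the beginning and leaves $B$ only via the other side, another agent of $\mathcal A'$ leaves $B$ only via the first side, and both are outside $B$ at the end. **The graph $H(B)$.** Let $H$ be a graph with a chosen direction of every edge. Replace every edge from $a$ to $b$ with label $l$ by a gadget: new vertices $a_0,a^0,a^1,a^2$, edges $\{a,a_0\}$ labelled $l$, $\{a_0,a^x\}$ labelled $x$ for $x\ne l$, $\{a^0,a^1\}$ labelled $2$, $\{a^0,a^2\}$ labelled $1$; likewise $b_0,b^0,b^1,b^2$ at $b$; and a copy of $B$ without its distinguished edges, with edges $\{a^1,u\},\{a^2,v\},\{b^1,u'\},\{b^2,v'\}$ labelled $0$. Take two copies of the resulting graph and join every vertex of degree 2 to its counterpart by an edge with the missing label. This is $H(B)$; the vertices of $H$ (each with two copies) are its *macro vertices*. As a graph with distinguished edges, $H(B)$ is taken with the edges labelled $0$ at the macro vertices $p$ and $q$ in the first copy, for two chosen vertices $p\ne q$ of $H$. **The number $\alpha_B$.** For a set $\mathcal S$ of $r$ agents all located at a macro vertex $w$ or in the three gadgets around it (in either copy), its configuration with respect to $w$ records the state, the label of the edge to the previous vertex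 and the location relative to $w$ of every agent of $\mathcal S$. Consider all runs of $\mathcal A$ on all graphs obtained by joining a graph $G$ to some $H(B)$, where all agents start in their starting states anywhere outside the copies of $B$. $\mathcal S$ *arrives* at a macro vertex $v$ at time $t$ if an agent of $\mathcal S$ is at $v$ at time $t$ and all of $\mathcal S$ are at $v$ or in the gadgets around it, some agent of $\mathcal S$ was at a macro vertex $w\neq v$ at an earlier time $t'$, all agents of $\mathcal S$ were at $w$ or in the gadgets around it from $t'$ until just before $t$, and from $t'$ to $t$ no other agent was at $w$, $v$ or in the gadgets around them. Then $\alpha_B$ is the maximum over all $\mathcal S$ with $|\mathcal S|=r$ of the number of possible configurations of $\mathcal S$ at its arrivals, counting also the initial configuration in which all agents of $\mathcal S$ are at the same macro vertex in their starting states. **Theorem.** There is an absolute constant $C$ such that the following holds for all $2\le r\le k$ and $s$. Let $B$ be an $(r-1)$-barrier with $n$ vertices for a set $\mathcal A$ of $k$ agents with $s$ states each. Then there is an $r$-barrier $B'$ for $\mathcal A$ such that 1. $B'=H(B)$ for some connected 3-regular graph $H$ (some direction of its edges, and some vertices $p\ne q$ of $H$); 2. if $\{u,v\}$ and $\{u',v'\}$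 are the distinguished edges of $B'$, then every walk in $B'$ from $u$ or $v$ to $u'$ or $v'$ traverses at least 3 distinct copies of $B$, i.e. for at least 3 copies it has a part that stays in the copy and leads from an end of one distinguished edge of $B$ to an end of the other; 3. $B'$ has at most $C\binom{k}{r}\,n\,\alpha_B^2$ vertices. -/

import Mathlib

/-- A simple 3-regular graph with edge labels `0, 1, 2`, where the two port numbers of an edge
coincide: `nbr l v` is the other end of the edge labelled `l` at `v`. -/
structure CubicGraph (V : Type) where
  nbr : Fin 3 → V → V
  nbr_nbr : ∀ l v, nbr l (nbr l v) = v
  nbr_ne : ∀ l v, nbr l v ≠ v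
  nbr_inj : ∀ v, Function.Injective fun l => nbr l v

namespace CubicGraph

/-- The underlying simple graph. -/
def graph {V : Type} (G : CubicGraph V) : SimpleGraph V where
  Adj a b := ∃ l, G.nbr l a = b
  symm := ⟨by rintro a b ⟨l, rfl⟩; exact ⟨l, G.nbr_nbr l a⟩⟩
  loopless := ⟨by rintro a ⟨l, h⟩; exact G.nbr_ne l a h⟩

end CubicGraph

/-- A 3-regular graph with two distinguished edges labelled `0`: the first one joins
`u = port (false, false)` and `v = port (false, true)`, the second one joins
`u' = port (true, false)` and `v' = port (true, true)`. -/
structure TwoPort (V : Type) extends CubicGraph V where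
  port : Bool × Bool → V
  port_inj : Function.Injective port
  nbr_port : ∀ side, nbr 0 (port (side, false)) = port (side, true)

theorem TwoPort.nbr_port_not {V : Type} (B : TwoPort V) (i : Bool × Bool) :
    B.nbr 0 (B.port i) = B.port (i.1, !i.2) := by
  obtain ⟨side, x⟩ := i
  cases x
  · exact B.nbr_port side
  · rw [← B.nbr_port side, B.nbr_nbr]; rfl

/-- Four distinct vertices of `G` that are the ends of two edges labelled `0`, listed in the order
in which they are going to be attached to `u, v, u', v'`; every order is allowed. -/
structure Slot {X : Type} (G : CubicGraph X) where
  at_ : Bool × Bool → X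
  inj : Function.Injective at_
  closed : ∀ i, ∃ j, G.nbr 0 (at_ i) = at_ j

section Join

open Classical in
/-- The neighbours in the graph that results from joining `G` to `B`: the two distinguished edges
of `B` and the two edges of `G` given by the slot are removed, and each of the four vertices of
degree 2 of `B` is joined to one of the four vertices of degree 2 of `G` by an edge labelled `0`. -/
noncomputable def joinNbr {V X : Type} (B : TwoPort V) (G : CubicGraph X) (g : Slot G) (l : Fin 3) :
    V ⊕ X → V ⊕ X
  | .inl b => if l = 0 then
      (match Function.partialInv B.port b with
        | some i => .inr (g.at_ i)
        | none => .inl (B.nbr 0 b))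
      else .inl (B.nbr l b)
  | .inr x => if l = 0 then
      (match Function.partialInv g.at_ x with
        | some i => .inl (B.port i)
        | none => .inr (G.nbr 0 x))
      else .inr (G.nbr l x)

theorem partialInv_eq_some {α β : Type} {f : α → β} (hf : Function.Injective f) (a : α) :
    Function.partialInv f (f a) = some a :=
  (Function.Injective.isPartialInv hf a (f a)).2 rfl

theorem eq_of_partialInv {α β : Type} {f : α → β} (hf : Function.Injective f) {a : α} {b : β}
    (h : Function.partialInv f b = some a) : f a = b :=
  (Function.Injective.isPartialInv hf a b).1 h

theorem partialInv_nbr_port {V : Type} (B : TwoPort V) {b : V}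
    (h : Function.partialInv B.port b = none) :
    Function.partialInv B.port (B.nbr 0 b) = none := by
  cases h' : Function.partialInv B.port (B.nbr 0 b) with
  | none => rfl
  | some i =>
    have h1 := eq_of_partialInv B.port_inj h'
    have h2 : B.port (i.1, !i.2) = b := by rw [← B.nbr_port_not, h1, B.nbr_nbr]
    rw [← h2, partialInv_eq_some B.port_inj] at h
    cases h

theorem partialInv_nbr_slot {X : Type} {G : CubicGraph X} (g : Slot G) {x : X}
    (h : Function.partialInv g.at_ x = none) :
    Function.partialInv g.at_ (G.nbr 0 x) = none := by
  cases h' : Function.partialInv g.at_ (G.nbr 0 x) with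
  | none => rfl
  | some i =>
    have h1 := eq_of_partialInv g.inj h'
    obtain ⟨j, hj⟩ := g.closed i
    have h2 : g.at_ j = x := by rw [← hj, h1, G.nbr_nbr]
    rw [← h2, partialInv_eq_some g.inj] at h
    cases h

/-- The 3-regular graph obtained by joining `G` to `B`. -/
noncomputable def join {V X : Type} (B : TwoPort V) (G : CubicGraph X) (g : Slot G) :
    CubicGraph (V ⊕ X) where
  nbr := joinNbr B G g
  nbr_nbr := by
    intro l y
    by_cases hl : l = 0
    · subst hl
      rcases y with b | x
      · cases h : Function.partialInv B.port b with
        | none => simp [joinNbr, h, partialInv_nbr_port B h, B.nbr_nbr]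
        | some i =>
          simp [joinNbr, h, partialInv_eq_some g.inj, eq_of_partialInv B.port_inj h]
      · cases h : Function.partialInv g.at_ x with
        | none => simp [joinNbr, h, partialInv_nbr_slot g h, G.nbr_nbr]
        | some i =>
          simp [joinNbr, h, partialInv_eq_some B.port_inj, eq_of_partialInv g.inj h]
    · rcases y with b | x <;> simp [joinNbr, hl, B.nbr_nbr, G.nbr_nbr]
  nbr_ne := by
    intro l y
    rcases y with b | x
    · by_cases hl : l = 0
      · cases h : Function.partialInv B.port b <;> simp [joinNbr, hl, h, B.nbr_ne]
      · simp [joinNbr, hl, B.nbr_ne]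
    · by_cases hl : l = 0
      · cases h : Function.partialInv g.at_ x <;> simp [joinNbr, hl, h, G.nbr_ne]
      · simp [joinNbr, hl, G.nbr_ne]
  nbr_inj := by
    intro y l m hlm
    rcases y with b | x
    · have hB := @(B.nbr_inj b)
      cases h : Function.partialInv B.port b <;>
        by_cases hl : l = 0 <;> by_cases hm : m = 0 <;>
        simp [joinNbr, hl, hm, h] at hlm ⊢ <;>
        first
          | exact hB hlm
          | exact absurd (hB hlm) (by first | exact hm | exact hl)
    · have hG := @(G.nbr_inj x)
      cases h : Function.partialInv g.at_ x <;>
        by_cases hl : l = 0 <;> by_cases hm : m = 0 <;>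
        simp [joinNbr, hl, hm, h] at hlm ⊢ <;>
        first
          | exact hG hlm
          | exact absurd (hG hlm) (by first | exact hm | exact hl)

end Join

/-- A set of `k` cooperative agents with `s` states each. The transition function of agent `i` gets
the state of `i`, for every other agent its state if it is at the same vertex and `none` otherwise,
and the label of the edge through which `i` entered its current vertex (`none` if `i` has not moved
yet); all degrees are 3. It returns the new state and the label of the edge to be
traversed (`none` for staying). -/
structure Agents (k s : ℕ) where
  start : Fin k → Fin s
  halting : Fin k → Set (Fin s)
  trans : (i : Fin k) → Fin s → ({j : Fin k // j ≠ i} → Option (Fin s)) → Option (Fin 3) →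
    Fin s × Option (Fin 3)

/-- Positions, states and entry labels of all agents at some time. -/
structure Snapshot (k s : ℕ) (Y : Type) where
  pos : Fin k → Y
  state : Fin k → Fin s
  entry : Fin k → Option (Fin 3)

namespace Agents

open Classical in
/-- The action of agent `i`. -/
noncomputable def action {k s : ℕ} (A : Agents k s) {Y : Type} (c : Snapshot k s Y) (i : Fin k) :
    Fin s × Option (Fin 3) :=
  A.trans i (c.state i) (fun j => if c.pos j = c.pos i then some (c.state j) else none) (c.entry i)

open Classical in
/-- One synchronous step of all agents; the process has terminated once all agents are in halting
states. -/
noncomputable def step {k s : ℕ} (A : Agents k s) {Y : Type} (G : CubicGraph Y) (c : Snapshot k s Y) :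
    Snapshot k s Y :=
  if ∀ i, c.state i ∈ A.halting i then c else
  { pos := fun i => match (A.action c i).2 with
      | some l => G.nbr l (c.pos i)
      | none => c.pos i
    state := fun i => (A.action c i).1
    entry := fun i => match (A.action c i).2 with
      | some l => some l
      | none => c.entry i }

/-- The run of all agents on `G` from the given positions, in their starting states. -/
noncomputable def run {k s : ℕ} (A : Agents k s) {Y : Type} (G : CubicGraph Y) (pos₀ : Fin k → Y)
    (t : ℕ) : Snapshot k s Y :=
  (A.step G)^[t] { pos := pos₀, state := A.start, entry := fun _ => none }

end Agents

section Barrier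

variable {k s : ℕ} {V X : Type}

/-- At time `t` agent `i` is inside the part `V` of the joined graph. -/
def Inside (ρ : ℕ → Snapshot k s (V ⊕ X)) (i : Fin k) (t : ℕ) : Prop :=
  ∃ b : V, (ρ t).pos i = .inl b

/-- At time `t` agent `i` is at one of the two ends of a distinguished edge of `B`: at `u` or `v`
if `side = false`, at `u'` or `v'` if `side = true`. -/
def AtSide (B : TwoPort V) (ρ : ℕ → Snapshot k s (V ⊕ X)) (side : Bool) (i : Fin k) (t : ℕ) :
    Prop :=
  ∃ x, (ρ t).pos i = .inl (B.port (side, x))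

/-- From time `t₁` to time `t₂` only agents in `S` are inside the part `V`. -/
def OnlyInside (ρ : ℕ → Snapshot k s (V ⊕ X)) (S : Finset (Fin k)) (t₁ t₂ : ℕ) : Prop :=
  ∀ t, t₁ ≤ t → t ≤ t₂ → ∀ j, Inside ρ j t → j ∈ S

/-- Between times `t₁` and `t₂` agent `i` leaves `B` only via the two vertices of the given side. -/
def LeavesOnlyVia (B : TwoPort V) (ρ : ℕ → Snapshot k s (V ⊕ X)) (side : Bool) (i : Fin k)
    (t₁ t₂ : ℕ) : Prop :=
  ∀ t, t₁ ≤ t → t < t₂ → Inside ρ i t → ¬ Inside ρ i (t + 1) → AtSide B ρ side i t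

/-- No set `S` of at most `r` agents can traverse `B`: no agent of `S` gets through `B` from
`u` or `v` to `u'` or `v'`, or vice versa, while only agents of `S` are in `B`. -/
def NoTraversal (B : TwoPort V) (r : ℕ) (ρ : ℕ → Snapshot k s (V ⊕ X)) : Prop :=
  ∀ S : Finset (Fin k), S.card ≤ r → ∀ i ∈ S, ∀ (side : Bool) (t₁ t₂ : ℕ), t₁ ≤ t₂ →
    OnlyInside ρ S t₁ t₂ → (∀ t, t₁ ≤ t → t ≤ t₂ → Inside ρ i t) →
    AtSide B ρ side i t₁ → ¬ AtSide B ρ (!side) i t₂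

/-- No set `S` of `r + 1` agents can split up in `B`: it does not happen that, in a period in which
all agents of `S` and no others visit `B`, an agent `i` of `S`, present at one side at the beginning,
leaves `B` via the opposite side while another agent `j` of `S` leaves `B` via the first side
(and both are outside at the end). -/
def NoSplit (B : TwoPort V) (r : ℕ) (ρ : ℕ → Snapshot k s (V ⊕ X)) : Prop :=
  ∀ S : Finset (Fin k), S.card = r + 1 → ∀ i ∈ S, ∀ j ∈ S, ∀ (side : Bool) (t₁ t₂ : ℕ), t₁ ≤ t₂ →
    OnlyInside ρ S t₁ t₂ → (∀ a ∈ S, ∃ t, t₁ ≤ t ∧ t ≤ t₂ ∧ Inside ρ a t) →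
    AtSide B ρ side i t₁ → ¬ Inside ρ i t₂ → ¬ Inside ρ j t₂ →
    LeavesOnlyVia B ρ (!side) i t₁ t₂ → ¬ LeavesOnlyVia B ρ side j t₁ t₂

/-- `B` is an `r`-barrier for the set of agents `A`. All graphs are connected. -/
def IsBarrier (A : Agents k s) (r : ℕ) (B : TwoPort V) : Prop :=
  1 ≤ r ∧ r ≤ k ∧ B.graph.Connected ∧
    ∀ (X : Type) [Finite X] (G : CubicGraph X) (g : Slot G), G.graph.Connected →
      ∀ pos₀ : Fin k → X,
        NoTraversal B r (A.run (join B G g) fun i => .inr (pos₀ i)) ∧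
        NoSplit B r (A.run (join B G g) fun i => .inr (pos₀ i))

end Barrier

/-- A direction for every edge of `H`: `out w l` tells whether the edge labelled `l` at `w` points
away from `w`. -/
structure Direction {W : Type} (H : CubicGraph W) where
  out : W → Fin 3 → Bool
  flip : ∀ w l, out (H.nbr l w) l = !out w l

/-- The vertices of `H₁(B)`, i.e. of `H` with each edge replaced by a gadget containing a copy
of `B`: the macro vertices; for every edge labelled `l` at `w`, the vertex `hub w l` that is
adjacent to `w` in the gadget (`a₀` or `b₀`) and the three vertices `rim w l x` next to the hub,
`rim w l x` being joined to the hub by label `x`; the vertices of the copies of `B`. -/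
inductive GadgetVertex {W : Type} {H : CubicGraph W} (o : Direction H) (V : Type) where
  | main (w : W)
  | hub (w : W) (l : Fin 3)
  | rim (w : W) (l x : Fin 3)
  | core (e : {d : W × Fin 3 // o.out d.1 d.2 = true}) (b : V)

namespace Direction

variable {V W : Type} {H : CubicGraph W} (o : Direction H)

/-- The end of the edge `e`: its tail (`false`) or its head (`true`). -/
def endOf (e : {d : W × Fin 3 // o.out d.1 d.2 = true}) : Bool → W
  | false => e.1.1
  | true => H.nbr e.1.2 e.1.1

/-- The edge labelled `l` at `w`. -/
def edgeAt (w : W) (l : Fin 3) : {d : W × Fin 3 // o.out d.1 d.2 = true} :=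
  if h : o.out w l = true then ⟨(w, l), h⟩
  else ⟨(H.nbr l w, l), by simpa [o.flip] using h⟩

/-- The end of the edge `edgeAt w l` at which `w` is. -/
def sideAt (w : W) (l : Fin 3) : Bool := !o.out w l

theorem edgeAt_endOf (e : {d : W × Fin 3 // o.out d.1 d.2 = true}) (side : Bool) :
    o.edgeAt (o.endOf e side) e.1.2 = e := by
  obtain ⟨⟨w, l⟩, h⟩ := e
  simp only at h
  cases side
  · simp [endOf, edgeAt, h]
  · simp [endOf, edgeAt, o.flip, h, H.nbr_nbr]

theorem sideAt_endOf (e : {d : W × Fin 3 // o.out d.1 d.2 = true}) (side : Bool) :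
    o.sideAt (o.endOf e side) e.1.2 = side := by
  obtain ⟨⟨w, l⟩, h⟩ := e
  simp only at h
  cases side <;> simp [endOf, sideAt, o.flip, h]

theorem edgeAt_label (w : W) (l : Fin 3) : (o.edgeAt w l).1.2 = l := by
  unfold edgeAt; split <;> rfl

theorem endOf_edgeAt (w : W) (l : Fin 3) : o.endOf (o.edgeAt w l) (o.sideAt w l) = w := by
  by_cases h : o.out w l = true
  · simp [edgeAt, sideAt, h, endOf]
  · simp [edgeAt, sideAt, h, endOf, H.nbr_nbr]

end Direction

/-- The rim vertex (`1` or `2`) that is attached to `u`, `u'` (`false`) or to `v`, `v'` (`true`). -/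
def rimIdx : Bool → Fin 3
  | false => 1
  | true => 2

open Classical in
/-- The neighbours in `H(B)`, which consists of two copies of `H₁(B)`, distinguished by a Boolean.
On each side of the copy of `B` in a gadget, the hub and the three rim vertices form a
complete graph on four vertices, without the edge between rim vertices 1 and 2 that would have
label 0; these two are joined to `B` instead. The hub of the edge labelled `l` uses its label `l` for
the macro vertex, so that rim vertex `l` has degree 2; it is joined by label `l` to its
counterpart in the other copy of `H₁(B)`. -/
noncomputable def expandNbr {V W : Type} (B : TwoPort V) {H : CubicGraph W} (o : Direction H)
    (m : Fin 3) : Bool × GadgetVertex o V → Bool × GadgetVertex o V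
  | (c, .main w) => (c, .hub w m)
  | (c, .hub w l) => if m = l then (c, .main w) else (c, .rim w l m)
  | (c, .rim w l x) =>
      if m = x then (if m = l then (!c, .rim w l x) else (c, .hub w l))
      else if x = 0 then (c, .rim w l (if m = 1 then 2 else 1))
      else if m = 0 then
        (c, .core (o.edgeAt w l) (B.port (o.sideAt w l, decide (x = 2))))
      else (c, .rim w l 0)
  | (c, .core e b) =>
      if m = 0 then
        (match Function.partialInv B.port b with
          | some i => (c, .rim (o.endOf e i.1) e.1.2 (rimIdx i.2))
          | none => (c, .core e (B.nbr 0 b)))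
      else (c, .core e (B.nbr m b))

theorem expandNbr_expandNbr {V W : Type} (B : TwoPort V) {H : CubicGraph W} (o : Direction H)
    (m : Fin 3) (y : Bool × GadgetVertex o V) : expandNbr B o m (expandNbr B o m y) = y := by
  obtain ⟨c, y⟩ := y
  cases y with
  | main w => simp [expandNbr]
  | hub w l => by_cases h : m = l <;> simp [expandNbr, h]
  | rim w l x =>
    by_cases hx : m = x
    · by_cases hl : m = l
      · subst hx; subst hl; simp [expandNbr]
      · subst hx; simp [expandNbr, hl]
    · fin_cases m <;> fin_cases x <;>
        simp_all [expandNbr, partialInv_eq_some B.port_inj, Direction.endOf_edgeAt,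
          Direction.edgeAt_label, rimIdx]
  | core e b =>
    by_cases hm : m = 0
    · subst hm
      cases h : Function.partialInv B.port b with
      | none => simp [expandNbr, h, partialInv_nbr_port B h, B.nbr_nbr]
      | some i =>
        have hb := eq_of_partialInv B.port_inj h
        obtain ⟨side, x⟩ := i
        cases x <;>
          simp [expandNbr, h, rimIdx, Direction.edgeAt_endOf, Direction.sideAt_endOf, hb]
    · simp [expandNbr, hm, B.nbr_nbr]

theorem expandNbr_ne {V W : Type} (B : TwoPort V) {H : CubicGraph W} (o : Direction H)
    (m : Fin 3) (y : Bool × GadgetVertex o V) : expandNbr B o m y ≠ y := by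
  obtain ⟨c, y⟩ := y
  cases y with
  | main w => simp [expandNbr]
  | hub w l => by_cases h : m = l <;> simp [expandNbr, h]
  | rim w l x =>
    fin_cases m <;> fin_cases x <;> simp [expandNbr] <;> split <;> simp
  | core e b =>
    by_cases hm : m = 0
    · subst hm
      cases h : Function.partialInv B.port b <;> simp [expandNbr, h, B.nbr_ne]
    · simp [expandNbr, hm, B.nbr_ne]

theorem expandNbr_inj {V W : Type} (B : TwoPort V) {H : CubicGraph W} (o : Direction H)
    (y : Bool × GadgetVertex o V) : Function.Injective fun m => expandNbr B o m y := by
  obtain ⟨c, y⟩ := y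
  intro m m' h
  cases y with
  | main w => simpa [expandNbr] using h
  | hub w l =>
    by_cases h1 : m = l <;> by_cases h2 : m' = l <;> simp_all [expandNbr]
  | rim w l x =>
    fin_cases m <;> fin_cases m' <;> fin_cases x <;> simp [expandNbr] at h ⊢ <;>
      split at h <;> simp at h
  | core e b =>
    have hB := @(B.nbr_inj b)
    cases hp : Function.partialInv B.port b <;>
      by_cases hl : m = 0 <;> by_cases hm : m' = 0 <;>
      simp [expandNbr, hl, hm, hp] at h ⊢ <;>
      first
        | exact hB h
        | exact absurd (hB h) (by first | exact hm | exact hl)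

/-- The graph `H(B)`. It depends on the direction of the edges of `H`: the ends `u, v` of `B`
point to the tail, the ends `u', v'` to the head of the edge. -/
noncomputable def expand {V W : Type} (B : TwoPort V) {H : CubicGraph W} (o : Direction H) :
    CubicGraph (Bool × GadgetVertex o V) where
  nbr := expandNbr B o
  nbr_nbr := expandNbr_expandNbr B o
  nbr_ne := expandNbr_ne B o
  nbr_inj := expandNbr_inj B o

/-- `H(B)` with two distinguished edges: those labelled `0` at the macro vertices `p` and `q`
in the first copy of `H₁(B)`. -/
noncomputable def expandTwoPort {V W : Type} (B : TwoPort V) {H : CubicGraph W} (o : Direction H)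
    (p q : W) (hpq : p ≠ q) : TwoPort (Bool × GadgetVertex o V) where
  toCubicGraph := expand B o
  port i := (false, if i.2 then .hub (if i.1 then q else p) 0 else .main (if i.1 then q else p))
  port_inj := by
    rintro ⟨a, x⟩ ⟨b, y⟩ h
    cases a <;> cases b <;> cases x <;> cases y <;> simp [hpq, hpq.symm] at h ⊢
  nbr_port := by
    intro side
    simp [expand, expandNbr]

/-- The copy of `B` given by `e` is traversed by the walk `x 0, …, x m`: a part of the walk
stays in the copy and leads from an end of one distinguished edge of `B` to an end of the other. -/
def Traverses {V W : Type} (B : TwoPort V) {H : CubicGraph W} {o : Direction H}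
    (x : ℕ → Bool × GadgetVertex o V) (m : ℕ)
    (e : Bool × {d : W × Fin 3 // o.out d.1 d.2 = true}) : Prop :=
  ∃ a b : ℕ, a ≤ b ∧ b ≤ m ∧ (∀ t, a ≤ t → t ≤ b → ∃ z, x t = (e.1, .core e.2 z)) ∧
    ∃ side y z, x a = (e.1, .core e.2 (B.port (side, y))) ∧
      x b = (e.1, .core e.2 (B.port (!side, z)))

/-- A location relative to a macro vertex `w` of `H(B)`, at `w` or in one of the three surrounding
gadgets; in a gadget, `far = true` refers to the hub and the rim at the other end. -/
inductive StarPos (V : Type) where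
  | centre
  | hub (far : Bool) (l : Fin 3)
  | rim (far : Bool) (l x : Fin 3)
  | core (l : Fin 3) (b : V)

/-- The vertex of `H(B)` at a given location relative to the macro vertex `w`, in either of the two
copies of `H₁(B)`. -/
def locate {V W : Type} {H : CubicGraph W} (o : Direction H) (w : W) :
    Bool × StarPos V → Bool × GadgetVertex o V
  | (c, .centre) => (c, .main w)
  | (c, .hub far l) => (c, .hub (if far then H.nbr l w else w) l)
  | (c, .rim far l x) => (c, .rim (if far then H.nbr l w else w) l x)
  | (c, .core l b) => (c, .core (o.edgeAt w l) b)

/-- The configurations of a set `S` of agents with respect to a macro vertex: for each agent in `S`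
its state, the label of the edge leading back to its previous vertex and its relative location. -/
abbrev Config (s : ℕ) {k : ℕ} (S : Finset (Fin k)) (V : Type) : Type :=
  S → Fin s × Option (Fin 3) × (Bool × StarPos V)

section Alpha

variable {k s : ℕ} {V W X : Type} {H : CubicGraph W} {o : Direction H}

/-- At the given moment, all agents of `S` are at the macro vertex `w` or in the gadgets around it,
and `c` is the configuration of `S` with respect to `w`. -/
def HasConfig (σ : Snapshot k s ((Bool × GadgetVertex o V) ⊕ X)) (w : W) (S : Finset (Fin k))
    (c : Config s S V) : Prop :=
  ∀ i : S, σ.state i = (c i).1 ∧ σ.entry i = (c i).2.1 ∧ σ.pos i = .inl (locate o w (c i).2.2)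

/-- Some agent of `S` is at the macro vertex `w` (in one of its two copies). -/
def Visits (σ : Snapshot k s ((Bool × GadgetVertex o V) ⊕ X)) (S : Finset (Fin k)) (w : W) :
    Prop :=
  ∃ i ∈ S, ∃ c : Bool, σ.pos i = .inl (c, .main w)

/-- No agent outside `S` is at the macro vertex `w` or in the gadgets around it. -/
def AloneAt (σ : Snapshot k s ((Bool × GadgetVertex o V) ⊕ X)) (S : Finset (Fin k)) (w : W) :
    Prop :=
  ∀ j, j ∉ S → ∀ a, σ.pos j ≠ .inl (locate o w a)

/-- The set `S` arrives at time `t` at a new macro vertex `v` in configuration `c`: it visited a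
macro vertex `w ≠ v` before, stayed around `w` until time `t`, when one of its agents
visits `v`, and no other agents were around `w` and `v` in the meantime. -/
def Arrives (ρ : ℕ → Snapshot k s ((Bool × GadgetVertex o V) ⊕ X)) (S : Finset (Fin k)) (t : ℕ)
    (v : W) (c : Config s S V) : Prop :=
  ∃ (w : W) (t' : ℕ), w ≠ v ∧ t' < t ∧ Visits (ρ t') S w ∧
    (∀ τ, t' ≤ τ → τ < t → ∃ c', HasConfig (ρ τ) w S c') ∧
    (∀ τ, t' ≤ τ → τ ≤ t → AloneAt (ρ τ) S w ∧ AloneAt (ρ τ) S v) ∧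
    Visits (ρ t) S v ∧ HasConfig (ρ t) v S c

end Alpha

/-- The possible configurations of the set `S` of agents, with respect to the current macro
vertex, at the moments `t₀, t₁, t₂, …` when it starts at a macro vertex or arrives at a new macro
vertex of a graph `H(B)`. The graph `H(B)` may be joined to any graph `G`, and the run is one of
all agents, starting in their starting states anywhere outside of the copies of `B`. -/
def macroConfigs {k s : ℕ} (A : Agents k s) {V : Type} (B : TwoPort V) (S : Finset (Fin k)) :
    Set (Config s S V) :=
  {c | (∀ i, c i = (A.start i, none, (false, .centre))) ∨
    ∃ (W X : Type) (_ : Finite W) (_ : Finite X) (H : CubicGraph W) (o : Direction H) (p q : W)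
      (hpq : p ≠ q) (G : CubicGraph X) (g : Slot G)
      (pos₀ : Fin k → (Bool × GadgetVertex o V) ⊕ X) (t : ℕ) (v : W),
      H.graph.Connected ∧ G.graph.Connected ∧
      (∀ i a e b, pos₀ i ≠ .inl (a, .core e b)) ∧
      Arrives (A.run (join (expandTwoPort B o p q hpq) G g) pos₀) S t v c}

/-- The number `α_B`: the maximum, over the sets `S` of `r` agents, of the number of possible
configurations of `S` at the moments of arrival at macro vertices. -/
noncomputable def alpha {k s : ℕ} (A : Agents k s) (r : ℕ) {V : Type} (B : TwoPort V) : ℕ :=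
  (Finset.univ.powersetCard r).sup fun S : Finset (Fin k) => (macroConfigs A B S).ncard

/-!
The graph `H` is a chain of rings. A ring is a 3-regular bipartite graph on `ZMod L × ZMod 3` and a
second copy of it, in which the edges labelled `1` and `2` shift the first coordinate by `a` and
`b`; two consecutive rings are connected by exchanging the ends of one edge labelled `0` each. All
edges are directed from one class of the bipartition to the other, and the *level* of a vertex is the
index of its ring.

The first half of the proof is about a single deterministic walker in `H` which perceives nothing
but the class of its vertex (`Walker`). Eventually it repeats a cycle of labels, and for every such
cycle there are coprime `a, b` such that the cycle does not change the position in the ring with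
these parameters. If the ring is large enough compared to the number of states, a walker in this
cycle stays in the ring and is stuck there. Hence a chain that contains such a ring for each cycle of
each of finitely many walkers, twice, blocks all of them in both directions
(`Chain.exists_blocking`). The number of vertices is of order `α ^ 2` per walker, since the lengths
of the cycles of a walker sum up to at most its number of states.

The second half shows that groups of `r` agents act like such walkers. Every copy of `B` inside a
large graph still is an `(r - 1)`-barrier (`IsPart.barrier`). So whenever an agent gets through
a copy of `B`, all agents of its group `D` visit this copy, and afterwards they cannot be at different
sides of the edge of `H` to which the copy belongs, because they would have split up
(`Scene.not_onSide`). It follows that the agents of `D`, as long as the other agents are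
far away, get from one macro vertex to the next one together (`Company.exists_gathered`,
`Company.next`). Their configuration upon arrival determines the next arrival and the configuration
then (`macroNext_of_run`, `MacroNext.unique`), up to the direction of the edges at the macro vertex,
which is its class. So the group follows a walker whose states are at most `2 α` in number
(`groupWalker`), one for each of the `binom(k, r)` groups, and all of these are blocked
(`Company.exists_lev_le`).

Consequently no `r` agents get through `H(B)`. If `r + 1` agents were to split up in `H(B)`, consider
the agents `i` and `j` that leave at opposite ends, and the last moment at which they are close
to each other. According to the level at that moment, either `i` has still to get through the upper
half of the chain, away from `j`, or `j` through the lower half, away from `i`; in both cases the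
agent is in company of the `r - 1` others only and is blocked (`no_split_of_noAscent`).
-/

/-! ### Chains of rings -/

/-- The parameters of a ring: its size `3 * N + 1` and the two shifts `a`, `b` performed by the
labels `1` and `2`; the label `0` performs no shift. -/
structure RingParams where
  N : ℕ
  a : ℤ
  b : ℤ
  one_le : 1 ≤ N
  coprime : IsCoprime a b

namespace RingParams

/-- The length of a ring. It is `1` modulo `3`, so that `ZMod length × ZMod 3` is cyclic. -/
def length (P : RingParams) : ℕ := 3 * P.N + 1

instance (P : RingParams) : NeZero P.length := ⟨by unfold length; omega⟩

/-- The shift performed by a label. -/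
def shift (P : RingParams) : Fin 3 → ℤ := ![0, P.a, P.b]

/-- The translation of the ring performed by a label. The second component keeps the three
translations distinct even if the shifts coincide. -/
def vec (P : RingParams) (m : Fin 3) : ZMod P.length × ZMod 3 := ((P.shift m : ℤ), (m.val : ℕ))

/-- The place of a ring at which the next ring is attached. -/
def exit (P : RingParams) : ZMod P.length × ZMod 3 := ((P.N : ℕ), 0)

theorem exit_ne_zero (P : RingParams) : P.exit ≠ 0 := by
  intro h
  have h1 := congrArg Prod.fst h
  simp only [exit, Prod.fst_zero, ZMod.natCast_eq_zero_iff] at h1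
  have := Nat.le_of_dvd P.one_le h1
  have := P.one_le
  unfold length at *
  omega

end RingParams

/-- The sign with which the labels act on the two classes of vertices of a bipartite ring. -/
def classSign : Bool → ℤ
  | false => 1
  | true => -1

/-- The places in a chain of `K` rings. -/
abbrev Chain (K : ℕ) (prm : ℕ → RingParams) : Type :=
  Σ j : Fin K, ZMod (prm j).length × ZMod 3

namespace Chain

variable {K : ℕ} {prm : ℕ → RingParams}

/-- The involution that exchanges the exit of each ring with the entrance `0` of the next one. -/
def swap : Chain K prm → Chain K prm
  | ⟨⟨j, hj⟩, x⟩ =>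
    if h : x = (prm j).exit ∧ j + 1 < K then ⟨⟨j + 1, h.2⟩, 0⟩
    else if x = 0 then
      match j, hj, x with
      | 0, hj, x => ⟨⟨0, hj⟩, x⟩
      | i + 1, hj, _ => ⟨⟨i, by omega⟩, (prm i).exit⟩
    else ⟨⟨j, hj⟩, x⟩

theorem swap_exit {j : ℕ} (hj : j + 1 < K) :
    swap (prm := prm) ⟨⟨j, by omega⟩, (prm j).exit⟩ = ⟨⟨j + 1, hj⟩, 0⟩ := by
  simp [swap, hj]

theorem swap_zero_succ {j : ℕ} (hj : j + 1 < K) :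
    swap (prm := prm) ⟨⟨j + 1, hj⟩, 0⟩ = ⟨⟨j, by omega⟩, (prm j).exit⟩ := by
  have := (prm (j + 1)).exit_ne_zero.symm
  simp [swap, this]

theorem swap_of_ne {j : Fin K} {x : ZMod (prm j).length × ZMod 3}
    (h1 : ¬ (x = (prm j).exit ∧ j.1 + 1 < K)) (h2 : ¬ (x = 0 ∧ 0 < j.1)) :
    swap (prm := prm) ⟨j, x⟩ = ⟨j, x⟩ := by
  obtain ⟨j, hj⟩ := j
  by_cases hx : x = 0
  · cases j with
    | zero => simp only [swap]; rw [dif_neg h1]; simp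
    | succ i => simp [hx] at h2
  · simp only [swap]; rw [dif_neg h1, if_neg hx]

/-- The three kinds of places with respect to `swap`. -/
theorem swap_cases (y : Chain K prm) :
    (∃ (j : ℕ) (hj : j + 1 < K), y = ⟨⟨j, by omega⟩, (prm j).exit⟩ ∧
      swap y = ⟨⟨j + 1, hj⟩, 0⟩) ∨
    (∃ (j : ℕ) (hj : j + 1 < K), y = ⟨⟨j + 1, hj⟩, 0⟩ ∧
      swap y = ⟨⟨j, by omega⟩, (prm j).exit⟩) ∨ swap y = y := by
  obtain ⟨⟨j, hj⟩, x⟩ := y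
  by_cases h1 : x = (prm j).exit ∧ j + 1 < K
  · left
    obtain ⟨rfl, h1⟩ := h1
    exact ⟨j, h1, rfl, swap_exit h1⟩
  · by_cases h2 : x = 0 ∧ 0 < j
    · right; left
      obtain ⟨i, rfl⟩ : ∃ i, j = i + 1 := ⟨j - 1, by omega⟩
      exact ⟨i, hj, by rw [h2.1], by rw [← swap_zero_succ hj, h2.1]⟩
    · right; right
      exact swap_of_ne h1 h2

theorem swap_swap (y : Chain K prm) : swap (swap y) = y := by
  rcases swap_cases y with ⟨j, hj, rfl, h⟩ | ⟨j, hj, rfl, h⟩ | h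
  · rw [h, swap_zero_succ hj]
  · rw [h, swap_exit hj]
  · rw [h, h]

/-- The translation of a ring of the chain by a label, in the direction given by the class. -/
def translate (m : Fin 3) (c : Bool) (y : Chain K prm) : Chain K prm :=
  ⟨y.1, y.2 + classSign c • (prm y.1).vec m⟩

theorem translate_translate (m : Fin 3) (c : Bool) (y : Chain K prm) :
    translate m (!c) (translate m c y) = y := by
  obtain ⟨j, x⟩ := y
  have h : ∀ v : ZMod (prm j).length × ZMod 3,
      x + classSign c • v + classSign (!c) • v = x := by
    intro v
    cases c <;> simp [classSign]
  exact congrArg (Sigma.mk j) (h _)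

theorem vec_ne {P : RingParams} {m m' : Fin 3} (h : m ≠ m') : P.vec m ≠ P.vec m' := by
  intro h1
  have h2 := congrArg Prod.snd h1
  simp only [RingParams.vec] at h2
  revert h h2
  clear h1
  revert m m'
  decide

theorem vec_ne_zero {P : RingParams} {m : Fin 3} (h : m ≠ 0) : P.vec m ≠ 0 := by
  have := vec_ne (P := P) h
  simpa [RingParams.vec, RingParams.shift] using this

theorem translate_ne_swap {m : Fin 3} (hm : m ≠ 0) (c : Bool) (y : Chain K prm) :
    translate m c y ≠ swap y := by
  intro h
  rcases swap_cases y with ⟨j, hj, rfl, h1⟩ | ⟨j, hj, rfl, h1⟩ | h1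
  · rw [h1] at h; simpa [translate] using congrArg (fun z => z.1.1) h
  · rw [h1] at h; simpa [translate] using congrArg (fun z => z.1.1) h
  · rw [h1] at h
    obtain ⟨j, x⟩ := y
    have h2 : classSign c • (prm j).vec m = 0 := by simpa [translate] using h
    have h3 := vec_ne_zero (P := prm j) hm
    cases c <;> simp [classSign, h3] at h2

theorem translate_inj {m m' : Fin 3} {c : Bool} {y : Chain K prm}
    (h : translate m c y = translate m' c y) : m = m' := by
  by_contra hm
  obtain ⟨j, x⟩ := y
  have h2 : classSign c • (prm j).vec m = classSign c • (prm j).vec m' := by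
    simpa [translate] using h
  have h3 := vec_ne (P := prm j) hm
  cases c <;> simp [classSign, h3] at h2

/-- The bipartite cubic graph on a chain of rings: there are two vertices at each place; the
labels `1` and `2` act by translations in the rings, the label `0` joins the two vertices at a
place, except that consecutive rings are connected by exchanging the ends of two such edges. -/
def cubic (K : ℕ) (prm : ℕ → RingParams) : CubicGraph (Bool × Chain K prm) where
  nbr m w := (!w.1, if m = 0 then swap w.2 else translate m w.1 w.2)
  nbr_nbr := by
    rintro m ⟨c, y⟩
    by_cases hm : m = 0
    · simp [hm, swap_swap]
    · simp [hm, translate_translate]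
  nbr_ne := by
    rintro m ⟨c, y⟩ h
    simpa using congrArg Prod.fst h
  nbr_inj := by
    rintro ⟨c, y⟩ m m' h
    have h := congrArg Prod.snd h
    by_cases hm : m = 0 <;> by_cases hm' : m' = 0 <;> simp only [hm, hm', if_true, if_false] at h ⊢
    · exact absurd h.symm (translate_ne_swap hm' c y)
    · exact absurd h (translate_ne_swap hm c y)
    · exact translate_inj h

theorem cubic_nbr_of_ne {m : Fin 3} (hm : m ≠ 0) (w : Bool × Chain K prm) :
    (cubic K prm).nbr m w = (!w.1, translate m w.1 w.2) := by simp [cubic, hm]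

theorem cubic_nbr_zero (w : Bool × Chain K prm) :
    (cubic K prm).nbr 0 w = (!w.1, swap w.2) := by simp [cubic]

/-- All edges are directed from one class to the other. -/
def direction (K : ℕ) (prm : ℕ → RingParams) : Direction (cubic K prm) where
  out w _ := w.1
  flip _ _ := rfl

/-- The index of the ring, as a measure of the progress along the chain. -/
def level (w : Bool × Chain K prm) : ℤ := (w.2.1.1 : ℤ)

theorem abs_level_nbr_sub_le (m : Fin 3) (w : Bool × Chain K prm) :
    |level ((cubic K prm).nbr m w) - level w| ≤ 1 := by
  obtain ⟨c, y⟩ := w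
  by_cases hm : m = 0
  · subst hm
    rw [cubic_nbr_zero]
    rcases swap_cases y with ⟨j, hj, rfl, h⟩ | ⟨j, hj, rfl, h⟩ | h <;> simp [h, level]
  · rw [cubic_nbr_of_ne hm]; simp [level, translate]

/-! ### Connectedness of the chain -/

/-- Reachability in the chain. -/
abbrev Conn (v w : Bool × Chain K prm) : Prop := (cubic K prm).graph.Reachable v w

theorem conn_nbr (m : Fin 3) (w : Bool × Chain K prm) : Conn w ((cubic K prm).nbr m w) :=
  SimpleGraph.Adj.reachable ⟨m, rfl⟩

theorem conn_translate {m : Fin 3} (hm : m ≠ 0) (y : Chain K prm) :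
    Conn (false, y) (true, translate m false y) := by
  have := conn_nbr m ((false, y) : Bool × Chain K prm)
  rwa [cubic_nbr_of_ne hm] at this

theorem conn_of_swap {y : Chain K prm} (h : swap y = y) : Conn (false, y) (true, y) := by
  have := conn_nbr 0 ((false, y) : Bool × Chain K prm)
  rwa [cubic_nbr_zero, h] at this

theorem swap_eq_of_snd_ne {j : Fin K} {x : ZMod (prm j).length × ZMod 3} (h : x.2 ≠ 0) :
    swap (prm := prm) ⟨j, x⟩ = ⟨j, x⟩ := by
  apply swap_of_ne
  · rintro ⟨rfl, -⟩; exact h rfl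
  · rintro ⟨rfl, -⟩; exact h rfl

theorem conn_step {m : Fin 3} (hm : m ≠ 0) (j : Fin K) {x x' : ZMod (prm j).length × ZMod 3}
    (h : x' = x + (prm j).vec m) :
    Conn (K := K) (prm := prm) (false, ⟨j, x⟩) (true, ⟨j, x'⟩) := by
  have := conn_translate hm (⟨j, x⟩ : Chain K prm)
  simp only [translate, classSign, one_smul] at this
  rwa [h]

/-- The two vertices at a place are connected: if they are not joined by an edge, then a detour
through a hexagon replaces the edge. -/
theorem conn_classes (y : Chain K prm) : Conn (false, y) (true, y) := by
  obtain ⟨j, x⟩ := y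
  by_cases hx : x.2 = 0
  · have h1 : ((1 : Fin 3)) ≠ 0 := by decide
    have h2 : ((2 : Fin 3)) ≠ 0 := by decide
    have e1 := conn_step h1 j (x := x) rfl
    have e2 := conn_step h2 j (x := x + (prm j).vec 1 - (prm j).vec 2) (sub_add_cancel _ _).symm
    have e3 : Conn (K := K) (prm := prm) (false, ⟨j, x + (prm j).vec 1 - (prm j).vec 2⟩)
        (true, ⟨j, x + (prm j).vec 1 - (prm j).vec 2⟩) := by
      apply conn_of_swap
      apply swap_eq_of_snd_ne
      rw [Prod.snd_sub, Prod.snd_add, hx]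
      simp only [RingParams.vec]
      decide
    have e4 := conn_step h1 j (x := x - (prm j).vec 2)
      (x' := x + (prm j).vec 1 - (prm j).vec 2) (by abel)
    have e5 := conn_step h2 j (x := x - (prm j).vec 2) (sub_add_cancel _ _).symm
    exact e1.trans (e2.symm.trans (e3.trans (e4.symm.trans e5)))
  · exact conn_of_swap (swap_eq_of_snd_ne hx)

theorem conn_ring (j : Fin K) (x : ZMod (prm j).length × ZMod 3) :
    Conn (K := K) (prm := prm) (false, ⟨j, 0⟩) (false, ⟨j, x⟩) := by
  -- the translations that preserve the connected components form a subgroup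
  let T : AddSubgroup (ZMod (prm j).length × ZMod 3) :=
    { carrier := {v | ∀ x, Conn (K := K) (prm := prm) (false, ⟨j, x⟩) (false, ⟨j, x + v⟩)}
      zero_mem' := fun x => by rw [add_zero]
      add_mem' := fun {v w} hv hw x => by rw [← add_assoc]; exact (hv x).trans (hw _)
      neg_mem' := fun {v} hv x => by
        have := hv (x + -v)
        rw [neg_add_cancel_right] at this
        exact this.symm }
  have hT : ∀ m : Fin 3, m ≠ 0 → (prm j).vec m ∈ T := fun m hm x =>
    (conn_step hm j rfl).trans (conn_classes _).symm
  have hT1 := hT 1 (by decide)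
  have hT2 := hT 2 (by decide)
  have h01 : ((0, 1) : ZMod (prm j).length × ZMod 3) ∈ T := by
    have h := T.nsmul_mem hT1 (prm j).length
    have : (prm j).length • (prm j).vec 1 = (0, 1) := by
      ext
      · simp [RingParams.vec]
      · have h3 : (3 : ZMod 3) = 0 := by decide
        rw [Prod.smul_snd, nsmul_eq_mul]
        simp [RingParams.vec, RingParams.length, h3]
    rwa [this] at h
  have h10 : ((1, 0) : ZMod (prm j).length × ZMod 3) ∈ T := by
    obtain ⟨s, t, hst⟩ := (prm j).coprime
    have h := T.add_mem (T.zsmul_mem hT1 s) (T.zsmul_mem hT2 t)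
    have h2 := T.sub_mem h (T.zsmul_mem h01 (s + 2 * t))
    have : s • (prm j).vec 1 + t • (prm j).vec 2 -
        (s + 2 * t) • ((0, 1) : ZMod (prm j).length × ZMod 3) = (1, 0) := by
      ext
      · have := congrArg (Int.cast : ℤ → ZMod (prm j).length) hst
        push_cast at this
        simpa [RingParams.vec, RingParams.shift] using this
      · simp [RingParams.vec]; ring
    rwa [this] at h2
  have hx : x ∈ T := by
    have h := T.add_mem (T.nsmul_mem h10 x.1.val) (T.nsmul_mem h01 x.2.val)
    have : x.1.val • ((1, 0) : ZMod (prm j).length × ZMod 3) + x.2.val • (0, 1) = x := by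
      ext <;> simp
    rwa [this] at h
  have := hx 0
  rwa [zero_add] at this

theorem cubic_connected (hK : 0 < K) : (cubic K prm).graph.Connected := by
  have key : ∀ (n : ℕ) (hn : n < K),
      Conn (K := K) (prm := prm) (false, ⟨⟨0, hK⟩, 0⟩) (false, ⟨⟨n, hn⟩, 0⟩) := by
    intro n
    induction n with
    | zero => intro hn; exact SimpleGraph.Reachable.refl _
    | succ n ih =>
      intro hn
      refine (ih (by omega)).trans ((conn_ring ⟨n, by omega⟩ (prm n).exit).trans ?_)
      have h := conn_nbr 0 ((false, ⟨⟨n, by omega⟩, (prm n).exit⟩) : Bool × Chain K prm)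
      rw [cubic_nbr_zero, swap_exit hn] at h
      exact h.trans (conn_classes _).symm
  have all : ∀ w : Bool × Chain K prm, Conn (false, ⟨⟨0, hK⟩, 0⟩) w := by
    rintro ⟨c, ⟨⟨j, hj⟩, x⟩⟩
    have h := (key j hj).trans (conn_ring ⟨j, hj⟩ x)
    cases c
    · exact h
    · exact h.trans (conn_classes _)
  have : Nonempty (Bool × Chain K prm) := ⟨(false, ⟨⟨0, hK⟩, 0⟩)⟩
  exact ⟨fun v w => (all v).symm.trans (all w)⟩

end Chain

/-! ### Oblivious walkers in a chain of rings -/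

/-- A deterministic walker that does not perceive anything of the graph but the class of its
vertex, which changes in every step: `label q` is the label of the edge that is traversed in state
`q`. -/
structure Walker (Q : Type) where
  next : Q → Q
  label : Q → Fin 3
  cls : Q → Bool
  cls_next : ∀ q, cls (next q) = !cls q

namespace Walker

variable {Q W : Type}

/-- The position after `n` steps of the walker that starts at `w` in state `q`. -/
def walk (M : Walker Q) (H : CubicGraph W) (w : W) (q : Q) : ℕ → W
  | 0 => w
  | n + 1 => H.nbr (M.label (M.next^[n] q)) (walk M H w q n)

/-- The signed shift performed in state `q` in a ring. -/
def weight (M : Walker Q) (P : RingParams) (q : Q) : ℤ :=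
  classSign (M.cls q) * P.shift (M.label q)

/-- The signed shift performed during `n` steps in a ring. -/
def drift (M : Walker Q) (P : RingParams) (n : ℕ) (q : Q) : ℤ :=
  birkhoffSum M.next (M.weight P) n q

theorem drift_zero (M : Walker Q) (P : RingParams) (q : Q) : M.drift P 0 q = 0 := by
  simp [drift]

theorem drift_succ (M : Walker Q) (P : RingParams) (n : ℕ) (q : Q) :
    M.drift P (n + 1) q = M.drift P n q + M.weight P (M.next^[n] q) := by
  simp [drift, birkhoffSum_succ]

theorem drift_add (M : Walker Q) (P : RingParams) (m n : ℕ) (q : Q) :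
    M.drift P (m + n) q = M.drift P m q + M.drift P n (M.next^[m] q) := by
  simp [drift, birkhoffSum_add]

end Walker

namespace Chain

variable {K : ℕ} {prm : ℕ → RingParams} {Q : Type}

theorem cls_walk (M : Walker Q) {w : Bool × Chain K prm} {q : Q} (h : w.1 = M.cls q) (n : ℕ) :
    (M.walk (cubic K prm) w q n).1 = M.cls (M.next^[n] q) := by
  induction n with
  | zero => exact h
  | succ n ih =>
    rw [Function.iterate_succ_apply', M.cls_next, ← ih]
    rfl

theorem exit_fst_ne_drift {P : RingParams} {d : ℤ} (h : |d| < P.N) :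
    ((d : ℤ) : ZMod P.length) ≠ ((P.N : ℕ) : ZMod P.length) := by
  intro he
  rw [← sub_eq_zero] at he
  have h1 : (((d - (P.N : ℤ)) : ℤ) : ZMod P.length) = 0 := by push_cast; exact he
  rw [ZMod.intCast_zmod_eq_zero_iff_dvd] at h1
  rw [abs_lt] at h
  obtain ⟨k, hk⟩ := h1
  unfold RingParams.length at hk
  push_cast at hk
  have hN : (1 : ℤ) ≤ P.N := by exact_mod_cast P.one_le
  rcases lt_trichotomy k 0 with hk0 | hk0 | hk0
  · nlinarith
  · subst hk0; linarith
  · nlinarith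

theorem exit_add_drift_ne_zero {P : RingParams} {d : ℤ} (h : |d| < P.N) :
    (((P.N : ℤ) + d : ℤ) : ZMod P.length) ≠ 0 := by
  intro he
  apply exit_fst_ne_drift (P := P) (d := -d) (by rwa [abs_neg])
  push_cast at he ⊢
  exact (eq_neg_of_add_eq_zero_left he).symm

/-- The position in a ring after a step that stays in the ring. -/
theorem translate_weight (M : Walker Q) {j : Fin K} {q : Q} {d : ℤ} {f : ZMod 3} :
    ∃ f', translate (prm := prm) (M.label q) (M.cls q) ⟨j, ((d : ℤ), f)⟩ =
      ⟨j, ((d + M.weight (prm j) q : ℤ), f')⟩ := by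
  refine ⟨f + classSign (M.cls q) • ((M.label q).val : ZMod 3), ?_⟩
  refine congrArg (Sigma.mk j) ?_
  ext <;> simp [RingParams.vec, Walker.weight]

/-- A ring in which the walker does not drift is not passed by it: while the walker is in the
ring, its place is determined by its drift since it has entered through the entrance. -/
theorem level_walk_le (M : Walker Q) {w : Bool × Chain K prm} {q : Q} (hw : w.1 = M.cls q)
    (j : Fin K) (hb : ∀ s u, |M.drift (prm j) u (M.next^[s] q)| < (prm j).N)
    (hlt : level w < (j.1 : ℤ)) (n : ℕ) :
    level (M.walk (cubic K prm) w q n) ≤ (j.1 : ℤ) := by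
  have key : level (M.walk (cubic K prm) w q n) < (j.1 : ℤ) ∨
      ∃ s u f, s + u = n ∧ (M.walk (cubic K prm) w q n).2 =
        ⟨j, ((M.drift (prm j) u (M.next^[s] q) : ℤ), f)⟩ := by
    induction n with
    | zero => exact Or.inl hlt
    | succ n ih =>
      have hc := cls_walk M hw n
      have hs : M.walk (cubic K prm) w q (n + 1) =
        (cubic K prm).nbr (M.label (M.next^[n] q)) (M.walk (cubic K prm) w q n) := rfl
      rw [hs]
      generalize M.walk (cubic K prm) w q n = v at hc ih
      obtain ⟨c, y⟩ := v
      simp only at hc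
      subst hc
      by_cases hm : M.label (M.next^[n] q) = 0
      · rw [hm, cubic_nbr_zero]
        rcases ih with ih | ⟨s, u, f, hsu, ih⟩
        · rcases swap_cases y with ⟨i, hi, rfl, h⟩ | ⟨i, hi, rfl, h⟩ | h
          · simp only [level, h] at ih ⊢
            by_cases hij : i + 1 = j.1
            · right
              obtain ⟨j, hj⟩ := j
              simp only at hij
              subst hij
              exact ⟨n + 1, 0, 0, rfl, by rw [M.drift_zero]; simp; rfl⟩
            · left; push_cast at ih ⊢; omega
          · left; simp only [level, h] at ih ⊢; push_cast at ih ⊢; omega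
          · left; simpa only [level, h] using ih
        · simp only at ih
          subst ih
          rcases swap_cases (prm := prm)
            ⟨j, ((M.drift (prm j) u (M.next^[s] q) : ℤ), f)⟩ with
              ⟨i, hi, he, h⟩ | ⟨i, hi, he, h⟩ | h
          · exfalso
            obtain ⟨j, hj⟩ := j
            rw [Sigma.mk.injEq, Fin.mk.injEq] at he
            obtain ⟨rfl, he⟩ := he
            have := congrArg Prod.fst (eq_of_heq he)
            exact exit_fst_ne_drift (hb s u) this
          · left
            simp only [h, level]
            obtain ⟨j, hj⟩ := j
            rw [Sigma.mk.injEq, Fin.mk.injEq] at he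
            obtain ⟨rfl, he⟩ := he
            push_cast; omega
          · right
            refine ⟨s, u + 1, f, by omega, ?_⟩
            simp only [h]
            rw [M.drift_succ, ← Function.iterate_add_apply, add_comm u s, hsu,
              Walker.weight, hm]
            simp [RingParams.shift]
      · rw [cubic_nbr_of_ne hm]
        rcases ih with ih | ⟨s, u, f, hsu, ih⟩
        · exact Or.inl ih
        · right
          simp only at ih
          subst ih
          obtain ⟨f', hf'⟩ := translate_weight (prm := prm) M (j := j) (q := M.next^[n] q)
            (d := M.drift (prm j) u (M.next^[s] q)) (f := f)
          refine ⟨s, u + 1, f', by omega, ?_⟩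
          simp only [hf']
          rw [M.drift_succ, ← Function.iterate_add_apply, add_comm u s, hsu]
  rcases key with h | ⟨s, u, f, -, h⟩
  · exact h.le
  · simp [level, h]

/-- The version of `level_walk_le` for walkers that enter the ring through its exit. -/
theorem le_level_walk (M : Walker Q) {w : Bool × Chain K prm} {q : Q} (hw : w.1 = M.cls q)
    (j : Fin K) (hb : ∀ s u, |M.drift (prm j) u (M.next^[s] q)| < (prm j).N)
    (hlt : (j.1 : ℤ) < level w) (n : ℕ) :
    (j.1 : ℤ) ≤ level (M.walk (cubic K prm) w q n) := by
  have key : (j.1 : ℤ) < level (M.walk (cubic K prm) w q n) ∨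
      ∃ s u f, s + u = n ∧ (M.walk (cubic K prm) w q n).2 =
        ⟨j, (((prm j).N + M.drift (prm j) u (M.next^[s] q) : ℤ), f)⟩ := by
    induction n with
    | zero => exact Or.inl hlt
    | succ n ih =>
      have hc := cls_walk M hw n
      have hs : M.walk (cubic K prm) w q (n + 1) =
        (cubic K prm).nbr (M.label (M.next^[n] q)) (M.walk (cubic K prm) w q n) := rfl
      rw [hs]
      generalize M.walk (cubic K prm) w q n = v at hc ih
      obtain ⟨c, y⟩ := v
      simp only at hc
      subst hc
      by_cases hm : M.label (M.next^[n] q) = 0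
      · rw [hm, cubic_nbr_zero]
        rcases ih with ih | ⟨s, u, f, hsu, ih⟩
        · rcases swap_cases y with ⟨i, hi, rfl, h⟩ | ⟨i, hi, rfl, h⟩ | h
          · left; simp only [level, h] at ih ⊢; push_cast at ih ⊢; omega
          · simp only [level, h] at ih ⊢
            by_cases hij : i = j.1
            · right
              obtain ⟨j, hj⟩ := j
              simp only at hij
              subst hij
              exact ⟨n + 1, 0, 0, rfl, by rw [M.drift_zero]; simp [RingParams.exit]⟩
            · left; push_cast at ih ⊢; omega
          · left; simpa only [level, h] using ih
        · simp only at ih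
          subst ih
          rcases swap_cases (prm := prm)
            ⟨j, (((prm j).N + M.drift (prm j) u (M.next^[s] q) : ℤ), f)⟩ with
              ⟨i, hi, he, h⟩ | ⟨i, hi, he, h⟩ | h
          · left
            simp only [h, level]
            obtain ⟨j, hj⟩ := j
            rw [Sigma.mk.injEq, Fin.mk.injEq] at he
            obtain ⟨rfl, he⟩ := he
            push_cast; omega
          · exfalso
            obtain ⟨j, hj⟩ := j
            rw [Sigma.mk.injEq, Fin.mk.injEq] at he
            obtain ⟨rfl, he⟩ := he
            have := congrArg Prod.fst (eq_of_heq he)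
            exact exit_add_drift_ne_zero (hb s u) this
          · right
            refine ⟨s, u + 1, f, by omega, ?_⟩
            simp only [h]
            rw [M.drift_succ, ← Function.iterate_add_apply, add_comm u s, hsu,
              Walker.weight, hm]
            simp [RingParams.shift]
      · rw [cubic_nbr_of_ne hm]
        rcases ih with ih | ⟨s, u, f, hsu, ih⟩
        · exact Or.inl ih
        · right
          simp only at ih
          subst ih
          obtain ⟨f', hf'⟩ := translate_weight (prm := prm) M (j := j) (q := M.next^[n] q)
            (d := (prm j).N + M.drift (prm j) u (M.next^[s] q)) (f := f)
          refine ⟨s, u + 1, f', by omega, ?_⟩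
          simp only [hf']
          rw [M.drift_succ, ← Function.iterate_add_apply, add_comm u s, hsu, add_assoc]
  rcases key with h | ⟨s, u, f, -, h⟩
  · exact h.le
  · simp [level, h]

end Chain

/-! ### Rings in which a walker does not drift -/

namespace Walker

variable {Q : Type} (M : Walker Q)

/-- Two states are equivalent if the walker gets into the same cycle of states from them. -/
def orbitSetoid : Setoid Q where
  r x y := ∃ m n, M.next^[m] x = M.next^[n] y
  iseqv :=
    { refl := fun x => ⟨0, 0, rfl⟩
      symm := fun ⟨m, n, h⟩ => ⟨n, m, h.symm⟩
      trans := by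
        rintro x y z ⟨m, n, h⟩ ⟨m', n', h'⟩
        refine ⟨m' + m, n + n', ?_⟩
        rw [Function.iterate_add_apply, h, ← Function.iterate_add_apply, add_comm m' n,
          Function.iterate_add_apply, h', ← Function.iterate_add_apply] }

/-- The cycles of states. -/
abbrev Cycles : Type := Quotient M.orbitSetoid

theorem exists_periodic [Finite Q] (κ : M.Cycles) :
    ∃ q : Q, Quotient.mk M.orbitSetoid q = κ ∧ q ∈ Function.periodicPts M.next := by
  induction κ using Quotient.inductionOn with
  | h q =>
    obtain ⟨m, n, hmn, h⟩ := Finite.exists_ne_map_eq_of_infinite fun n : ℕ => M.next^[n] q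
    wlog hlt : m < n generalizing m n
    · exact this n m hmn.symm h.symm (by omega)
    refine ⟨M.next^[m] q, Quotient.sound ⟨0, m, rfl⟩, n - m, by omega, ?_⟩
    show M.next^[n - m] (M.next^[m] q) = _
    rw [← Function.iterate_add_apply, Nat.sub_add_cancel hlt.le]
    exact h.symm

/-- A state on a cycle. -/
noncomputable def rep [Finite Q] (κ : M.Cycles) : Q := (M.exists_periodic κ).choose

theorem mk_rep [Finite Q] (κ : M.Cycles) : Quotient.mk M.orbitSetoid (M.rep κ) = κ :=
  (M.exists_periodic κ).choose_spec.1

theorem rep_periodic [Finite Q] (κ : M.Cycles) : M.rep κ ∈ Function.periodicPts M.next :=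
  (M.exists_periodic κ).choose_spec.2

/-- The length of a cycle of states. -/
noncomputable def period [Finite Q] (κ : M.Cycles) : ℕ :=
  Function.minimalPeriod M.next (M.rep κ)

theorem period_pos [Finite Q] (κ : M.Cycles) : 0 < M.period κ :=
  Function.minimalPeriod_pos_of_mem_periodicPts (M.rep_periodic κ)

theorem sum_period_le [Finite Q] [Fintype M.Cycles] : ∑ κ, M.period κ ≤ Nat.card Q := by
  have hinj : Function.Injective
      fun p : (Σ κ : M.Cycles, Fin (M.period κ)) => M.next^[p.2.1] (M.rep p.1) := by
    rintro ⟨κ, t⟩ ⟨κ', t'⟩ h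
    simp only at h
    have hκ : κ = κ' := by
      rw [← M.mk_rep κ, ← M.mk_rep κ']
      exact Quotient.sound ⟨t, t', h⟩
    subst hκ
    have := Function.iterate_injOn_Iio_minimalPeriod (f := M.next) (x := M.rep κ) t.2 t'.2 h
    rw [Fin.ext this]
  have := Nat.card_le_card_of_injective _ hinj
  rwa [Nat.card_eq_fintype_card, Fintype.card_sigma,
    Finset.sum_congr rfl fun κ _ => Fintype.card_fin _] at this

/-- The signed number of occurrences of the label `l` during a cycle. -/
noncomputable def signedCount [Finite Q] (κ : M.Cycles) (l : Fin 3) : ℤ :=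
  birkhoffSum M.next (fun q => if M.label q = l then classSign (M.cls q) else 0)
    (M.period κ) (M.rep κ)

theorem abs_signedCount_le [Finite Q] (κ : M.Cycles) (l : Fin 3) :
    |M.signedCount κ l| ≤ M.period κ := by
  unfold signedCount birkhoffSum
  refine (Finset.abs_sum_le_sum_abs _ _).trans ?_
  refine (Finset.sum_le_card_nsmul _ _ 1 ?_).trans (by simp)
  intro t _
  generalize M.next^[t] (M.rep κ) = q
  by_cases h : M.label q = l
  · cases hc : M.cls q <;> simp [h, hc, classSign]
  · simp [h]

theorem drift_period [Finite Q] (κ : M.Cycles) (P : RingParams) :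
    M.drift P (M.period κ) (M.rep κ) =
      P.a * M.signedCount κ 1 + P.b * M.signedCount κ 2 := by
  unfold drift signedCount birkhoffSum
  rw [Finset.mul_sum, Finset.mul_sum, ← Finset.sum_add_distrib]
  refine Finset.sum_congr rfl fun t _ => ?_
  generalize M.next^[t] (M.rep κ) = q
  unfold weight RingParams.shift
  beta_reduce
  generalize M.label q = l
  fin_cases l <;> simp [mul_comm]

/-- There are shifts, not larger than the period, for which the walker does not drift during a
cycle. -/
theorem exists_shifts [Finite Q] (κ : M.Cycles) :
    ∃ a b : ℤ, IsCoprime a b ∧ |a| ≤ M.period κ ∧ |b| ≤ M.period κ ∧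
      a * M.signedCount κ 1 + b * M.signedCount κ 2 = 0 := by
  have hp : (1 : ℤ) ≤ M.period κ := by exact_mod_cast M.period_pos κ
  have h1 := M.abs_signedCount_le κ 1
  have h2 := M.abs_signedCount_le κ 2
  generalize M.signedCount κ 1 = d at *
  generalize M.signedCount κ 2 = e at *
  by_cases h : d = 0 ∧ e = 0
  · exact ⟨1, 0, isCoprime_one_left, by simpa using hp, by simp, by simp [h.1, h.2]⟩
  · have hg : 0 < Int.gcd d e := by
      rw [Int.gcd_pos_iff]; tauto
    obtain ⟨d', e', hcop, hd, he⟩ := Int.exists_gcd_one hg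
    have hg' : (1 : ℤ) ≤ Int.gcd d e := by exact_mod_cast hg
    refine ⟨e', -d', ?_, ?_, ?_, ?_⟩
    · rw [IsCoprime.neg_right_iff]
      exact (Int.isCoprime_iff_gcd_eq_one.2 hcop).symm
    · refine le_trans ?_ h2
      rw [he, abs_mul, Nat.abs_cast]
      exact le_mul_of_one_le_right (abs_nonneg _) hg'
    · refine le_trans ?_ h1
      rw [hd, abs_mul, abs_neg, Nat.abs_cast]
      exact le_mul_of_one_le_right (abs_nonneg _) hg'
    · generalize (Int.gcd d e : ℤ) = g at hd he
      rw [hd, he]; ring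

/-- The ring that blocks the walker if it gets into the cycle `κ`. -/
noncomputable def ring [Finite Q] (κ : M.Cycles) : RingParams where
  N := M.period κ * Nat.card Q + 1
  a := (M.exists_shifts κ).choose
  b := (M.exists_shifts κ).choose_spec.choose
  one_le := by omega
  coprime := (M.exists_shifts κ).choose_spec.choose_spec.1

theorem abs_weight_ring_le [Finite Q] (κ : M.Cycles) (q : Q) :
    |M.weight (M.ring κ) q| ≤ M.period κ := by
  have h := (M.exists_shifts κ).choose_spec.choose_spec
  have h1 : |(M.ring κ).a| ≤ M.period κ := h.2.1
  have h2 : |(M.ring κ).b| ≤ M.period κ := h.2.2.1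
  unfold weight RingParams.shift
  have hs : |classSign (M.cls q)| = 1 := by cases M.cls q <;> simp [classSign]
  rw [abs_mul, hs, one_mul]
  rcases M.label q with ⟨l, hl⟩
  interval_cases l
  · simp
  · simpa using h1
  · simpa using h2

theorem drift_ring_of_periodic [Finite Q] (κ : M.Cycles) {q : Q}
    (hq : Quotient.mk M.orbitSetoid q = κ) {p : ℕ} (hp : 0 < p) (h : M.next^[p] q = q) :
    M.drift (M.ring κ) p q = 0 := by
  have h0 : M.drift (M.ring κ) (M.period κ) (M.rep κ) = 0 := by
    rw [drift_period]
    exact (M.exists_shifts κ).choose_spec.choose_spec.2.2.2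
  have hk : ∀ k, M.drift (M.ring κ) (M.period κ * k) (M.rep κ) = 0 := by
    intro k
    induction k with
    | zero => simp [drift_zero]
    | succ k ih =>
      have hper : M.next^[M.period κ * k] (M.rep κ) = M.rep κ :=
        ((Function.isPeriodicPt_minimalPeriod M.next (M.rep κ)).mul_const k)
      rw [Nat.mul_succ, drift_add, ih, hper, h0, zero_add]
  obtain ⟨m, n, hmn⟩ : ∃ m n, M.next^[m] q = M.next^[n] (M.rep κ) := by
    have : Quotient.mk M.orbitSetoid q = Quotient.mk M.orbitSetoid (M.rep κ) := by
      rw [M.mk_rep, hq]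
    exact Quotient.exact this
  have hpq : ∀ k, M.next^[p * k] q = q := fun k =>
    (show Function.IsPeriodicPt M.next p q from h).mul_const k
  obtain ⟨c, hc⟩ : ∃ c, q = M.next^[c] (M.rep κ) := by
    refine ⟨(p * m - m) + n, ?_⟩
    rw [Function.iterate_add_apply, ← hmn, ← Function.iterate_add_apply,
      Nat.sub_add_cancel (Nat.le_mul_of_pos_left m hp), hpq]
  have hdvd : M.period κ ∣ p := by
    have hper : Function.IsPeriodicPt M.next p (M.rep κ) := by
      have h1 : M.next^[M.period κ * c - c] q = M.rep κ := by
        rw [hc, ← Function.iterate_add_apply,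
          Nat.sub_add_cancel (Nat.le_mul_of_pos_left c (M.period_pos κ))]
        exact (Function.isPeriodicPt_minimalPeriod M.next (M.rep κ)).mul_const c
      rw [← h1]
      exact (show Function.IsPeriodicPt M.next p q from h).apply_iterate _
    exact hper.minimalPeriod_dvd
  obtain ⟨k, rfl⟩ := hdvd
  -- the drift during a period does not depend on where in the cycle the period starts
  have e1 := M.drift_add (M.ring κ) c (M.period κ * k) (M.rep κ)
  have e2 := M.drift_add (M.ring κ) (M.period κ * k) c (M.rep κ)
  have hper : M.next^[M.period κ * k] (M.rep κ) = M.rep κ :=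
    ((Function.isPeriodicPt_minimalPeriod M.next (M.rep κ)).mul_const k)
  rw [hper, hk, add_comm] at e2
  rw [e2, ← hc] at e1
  linarith

/-- The walker does not drift far in the ring made for its cycle: all but boundedly many steps
cancel, since a repeated state closes a cycle of drift zero. -/
theorem abs_drift_ring_lt [Finite Q] (q : Q) (n : ℕ) :
    |M.drift (M.ring (Quotient.mk M.orbitSetoid q)) n q| <
      (M.ring (Quotient.mk M.orbitSetoid q)).N := by
  set κ := Quotient.mk M.orbitSetoid q with hκ
  have hlin : ∀ n, |M.drift (M.ring κ) n q| ≤ M.period κ * n := by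
    intro n
    induction n with
    | zero => simp [drift_zero]
    | succ n ih =>
      rw [drift_succ]
      refine (abs_add_le _ _).trans ?_
      have := M.abs_weight_ring_le κ (M.next^[n] q)
      push_cast
      linarith
  have key : ∀ n, |M.drift (M.ring κ) n q| ≤ M.period κ * Nat.card Q := by
    intro n
    induction n using Nat.strong_induction_on with
    | _ n ih =>
      by_cases hn : n ≤ Nat.card Q
      · refine (hlin n).trans ?_
        gcongr
      · have : ¬ Function.Injective fun t : Fin (Nat.card Q + 1) => M.next^[t.1] q := by
          intro hinj
          have := Nat.card_le_card_of_injective _ hinj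
          simp at this
        simp only [Function.Injective, not_forall] at this
        obtain ⟨⟨i, hi⟩, ⟨j, hj⟩, h, hne⟩ := this
        simp only [Fin.mk.injEq] at h hne
        wlog hlt : i < j generalizing i j
        · exact this j hj i hi h.symm (Ne.symm hne) (by omega)
        have hper : M.next^[j - i] (M.next^[i] q) = M.next^[i] q := by
          rw [← Function.iterate_add_apply, Nat.sub_add_cancel hlt.le, h]
        have hz : M.drift (M.ring κ) (j - i) (M.next^[i] q) = 0 := by
          refine M.drift_ring_of_periodic κ ?_ (by omega) hper
          rw [hκ]
          exact Quotient.sound ⟨0, i, rfl⟩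
        have e : M.drift (M.ring κ) n q = M.drift (M.ring κ) (n - (j - i)) q := by
          have e1 : n = i + ((j - i) + (n - j)) := by omega
          have e2 : n - (j - i) = i + (n - j) := by omega
          rw [e2, drift_add]
          conv_lhs => rw [e1]
          rw [drift_add, drift_add, hz, hper, zero_add]
        rw [e]
        exact ih _ (by omega)
  have h := key n
  have : ((M.ring κ).N : ℤ) = M.period κ * Nat.card Q + 1 := by simp [ring]
  rw [this]
  omega

end Walker

/-! ### A chain that no walker passes -/

namespace Chain

/-- A ring without any special property. -/
def padding : RingParams := ⟨1, 1, 0, le_rfl, isCoprime_one_left⟩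

/-- The chain of the rings in a list. -/
abbrev ofList (l : List RingParams) : ℕ → RingParams := fun j => l.getD j padding

theorem card_ofList (l : List RingParams) :
    Nat.card (Bool × Chain l.length (ofList l)) = 6 * (l.map RingParams.length).sum := by
  rw [Nat.card_prod, Nat.card_sigma]
  have h : ∀ j : Fin l.length, Nat.card (ZMod (ofList l j).length × ZMod 3) =
      3 * (l[j.1]).length := by
    intro j
    have he : ofList l j.1 = l[j.1] := List.getD_eq_getElem _ _ j.2
    rw [Nat.card_prod, Nat.card_zmod, Nat.card_zmod, he, mul_comm]
  rw [Finset.sum_congr rfl fun j _ => h j, ← Finset.mul_sum,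
    Fin.sum_univ_fun_getElem l RingParams.length]
  simp
  ring

/-- A chain in which none of finitely many walkers gets from the middle to the ends. It contains the
ring blocking each cycle of states of each walker in both halves; paddings of constant size separate
the middle and the ends from these rings. -/
theorem exists_blocking {ι : Type} [Fintype ι] [Nonempty ι] {Q : ι → Type} [∀ d, Finite (Q d)]
    (M : ∀ d, Walker (Q d)) {a : ℕ} (ha : 1 ≤ a) (hQ : ∀ d, Nat.card (Q d) ≤ 2 * a) :
    ∃ (W : Type) (_ : Finite W) (H : CubicGraph W) (o : Direction H) (cls : W → Bool) (p q : W)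
      (lev : W → ℤ) (mid top : ℤ),
      H.graph.Connected ∧ (∀ w l, o.out w l = cls w) ∧
      (∀ m w, |lev (H.nbr m w) - lev w| ≤ 1) ∧ lev p = 0 ∧ lev q = top ∧
      58 ≤ mid ∧ mid + 58 ≤ top ∧
      (∀ d s w, cls w = (M d).cls s → lev w ≤ mid + 18 →
        ∀ n, lev ((M d).walk H w s n) ≤ top - 40) ∧
      (∀ d s w, cls w = (M d).cls s → mid - 18 ≤ lev w →
        ∀ n, 40 ≤ lev ((M d).walk H w s n)) ∧
      Nat.card W ≤ 3120 * (Fintype.card ι * a ^ 2) := by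
  classical
  have hfin : ∀ d, Fintype (M d).Cycles := fun d => Fintype.ofFinite _
  let J := Σ d, (M d).Cycles
  let f : J → RingParams := fun x => (M x.1).ring x.2
  let real : List RingParams := (Finset.univ : Finset J).toList.map f
  let pad : List RingParams := List.replicate 40 padding
  let l : List RingParams := pad ++ (real ++ (pad ++ (real ++ pad)))
  have hpad : pad.length = 40 := by simp [pad]
  have hl : l.length = 120 + 2 * real.length := by
    simp only [l, List.length_append, hpad]; ring
  have hmem : ∀ x : J, ∃ i, i < real.length ∧ real[i]? = some (f x) := by
    intro x
    have : f x ∈ real := List.mem_map_of_mem (Finset.mem_toList.2 (Finset.mem_univ x))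
    obtain ⟨i, hi, h⟩ := List.getElem_of_mem this
    exact ⟨i, hi, by rw [List.getElem?_eq_getElem hi, h]⟩
  have hfirst : ∀ i, i < real.length → ofList l (40 + i) = real.getD i padding := by
    intro i hi
    show l.getD (40 + i) padding = _
    rw [List.getD_append_right _ _ _ _ (by omega), hpad, Nat.add_sub_cancel_left,
      List.getD_append _ _ _ _ hi]
  have hsecond : ∀ i, i < real.length →
      ofList l (80 + real.length + i) = real.getD i padding := by
    intro i hi
    show l.getD (80 + real.length + i) padding = _
    rw [List.getD_append_right _ _ _ _ (by omega), List.getD_append_right _ _ _ _ (by omega),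
      List.getD_append_right _ _ _ _ (by omega), hpad,
      show 80 + real.length + i - 40 - real.length - 40 = i by omega,
      List.getD_append _ _ _ _ hi]
  have hblock : ∀ d (s : Q d) (P : RingParams), P = f ⟨d, Quotient.mk _ s⟩ →
      ∀ n u, |(M d).drift P u ((M d).next^[n] s)| < P.N := by
    rintro d s P rfl n u
    have h := (M d).abs_drift_ring_lt ((M d).next^[n] s) u
    have he : Quotient.mk (M d).orbitSetoid ((M d).next^[n] s) = Quotient.mk _ s :=
      Quotient.sound ⟨0, n, rfl⟩
    rw [he] at h
    exact h
  have hK : 0 < l.length := by omega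
  have hcount : (l.map RingParams.length).sum ≤ 520 * (Fintype.card ι * a ^ 2) := by
    have h1 : (real.map RingParams.length).sum ≤ 20 * (Fintype.card ι * a ^ 2) := by
      have e : (real.map RingParams.length).sum = ∑ x : J, (f x).length := by
        simp only [real, List.map_map]
        exact Finset.sum_map_toList _ _
      rw [e, Fintype.sum_sigma]
      have hd : ∀ d ∈ (Finset.univ : Finset ι),
          ∑ κ : (M d).Cycles, (f ⟨d, κ⟩).length ≤ 20 * a ^ 2 := by
        intro d _
        have hs := (M d).sum_period_le
        have h1 : ∀ κ : (M d).Cycles, (f ⟨d, κ⟩).length ≤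
            (3 * Nat.card (Q d) + 4) * (M d).period κ := by
          intro κ
          have := (M d).period_pos κ
          show 3 * ((M d).period κ * Nat.card (Q d) + 1) + 1 ≤ _
          nlinarith
        calc ∑ κ : (M d).Cycles, (f ⟨d, κ⟩).length
            ≤ ∑ κ : (M d).Cycles, (3 * Nat.card (Q d) + 4) * (M d).period κ :=
              Finset.sum_le_sum fun κ _ => h1 κ
          _ = (3 * Nat.card (Q d) + 4) * ∑ κ : (M d).Cycles, (M d).period κ := by
              rw [Finset.mul_sum]
          _ ≤ (3 * (2 * a) + 4) * (2 * a) := by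
              have := hQ d
              gcongr
              exact hs.trans this
          _ ≤ 20 * a ^ 2 := by nlinarith
      refine (Finset.sum_le_card_nsmul _ _ _ hd).trans ?_
      rw [Finset.card_univ, smul_eq_mul]
      exact le_of_eq (by ring)
    have h2 : 1 ≤ Fintype.card ι * a ^ 2 := Nat.mul_pos Fintype.card_pos (by positivity)
    have h3 : (pad.map RingParams.length).sum = 160 := by
      simp [pad, padding, RingParams.length]
    simp only [l, List.map_append, List.sum_append, h3]
    omega
  refine ⟨Bool × Chain l.length (ofList l), inferInstance, cubic _ _, direction _ _, Prod.fst,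
    (false, ⟨⟨0, hK⟩, 0⟩), (false, ⟨⟨l.length - 1, by omega⟩, 0⟩), level,
    60 + real.length, l.length - 1, cubic_connected hK, fun _ _ => rfl, abs_level_nbr_sub_le,
    by simp [level], ?_, by omega, by omega, ?_, ?_, ?_⟩
  · simp only [level]; omega
  · intro d s w hw hlev n
    obtain ⟨i, hi, hfi⟩ := hmem ⟨d, Quotient.mk _ s⟩
    have hj : 80 + real.length + i < l.length := by omega
    have hP : ofList l (80 + real.length + i) = f ⟨d, Quotient.mk _ s⟩ := by
      rw [hsecond i hi, List.getD_eq_getElem?_getD, hfi]; rfl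
    have := level_walk_le (M d) hw (⟨80 + real.length + i, hj⟩ : Fin l.length)
      (fun n u => hblock d s _ hP n u) (by push_cast; omega) n
    push_cast at this
    omega
  · intro d s w hw hlev n
    obtain ⟨i, hi, hfi⟩ := hmem ⟨d, Quotient.mk _ s⟩
    have hj : 40 + i < l.length := by omega
    have hP : ofList l (40 + i) = f ⟨d, Quotient.mk _ s⟩ := by
      rw [hfirst i hi, List.getD_eq_getElem?_getD, hfi]; rfl
    have := le_level_walk (M d) hw (⟨40 + i, hj⟩ : Fin l.length)
      (fun n u => hblock d s _ hP n u) (by push_cast; omega) n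
    push_cast at this
    omega
  · rw [card_ofList]
    omega

end Chain

/-! ### Runs on isomorphic graphs -/

/-- The snapshot with the positions mapped to another graph. -/
def Snapshot.map {k s : ℕ} {Y Z : Type} (φ : Y → Z) (c : Snapshot k s Y) : Snapshot k s Z where
  pos i := φ (c.pos i)
  state := c.state
  entry := c.entry

namespace Agents

variable {k s : ℕ} (A : Agents k s) {Y Z : Type} {φ : Y → Z}

theorem action_map (hφ : Function.Injective φ) (c : Snapshot k s Y) (i : Fin k) :
    A.action (c.map φ) i = A.action c i := by
  unfold action
  congr 1
  funext j
  have : (c.map φ).pos j = (c.map φ).pos i ↔ c.pos j = c.pos i := hφ.eq_iff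
  classical exact if_congr this rfl rfl

theorem step_map (hφ : Function.Injective φ) {G : CubicGraph Y} {G' : CubicGraph Z}
    (h : ∀ l y, φ (G.nbr l y) = G'.nbr l (φ y)) (c : Snapshot k s Y) :
    A.step G' (c.map φ) = (A.step G c).map φ := by
  unfold step
  by_cases hh : ∀ i, c.state i ∈ A.halting i
  · rw [if_pos hh, if_pos (by exact hh)]
  · rw [if_neg hh, if_neg (by exact hh)]
    simp only [A.action_map hφ]
    simp only [Snapshot.map, Snapshot.mk.injEq, and_true]
    funext i
    cases (A.action c i).2 <;> simp [h]

theorem run_map (hφ : Function.Injective φ) {G : CubicGraph Y} {G' : CubicGraph Z}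
    (h : ∀ l y, φ (G.nbr l y) = G'.nbr l (φ y)) (pos₀ : Fin k → Y) (t : ℕ) :
    A.run G' (fun i => φ (pos₀ i)) t = (A.run G pos₀ t).map φ := by
  unfold run
  induction t with
  | zero => rfl
  | succ t ih => rw [Function.iterate_succ_apply', Function.iterate_succ_apply', ih,
      A.step_map hφ h]

theorem run_succ (G : CubicGraph Y) (pos₀ : Fin k → Y) (t : ℕ) :
    A.run G pos₀ (t + 1) = A.step G (A.run G pos₀ t) := by
  unfold run
  rw [Function.iterate_succ_apply']

/-- In one step an agent stays or moves along an edge. -/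
theorem run_pos_succ (G : CubicGraph Y) (pos₀ : Fin k → Y) (t : ℕ) (i : Fin k) :
    (A.run G pos₀ (t + 1)).pos i = (A.run G pos₀ t).pos i ∨
      ∃ l, (A.run G pos₀ (t + 1)).pos i = G.nbr l ((A.run G pos₀ t).pos i) := by
  rw [run_succ, step]
  split
  · exact Or.inl rfl
  · simp only
    cases (A.action (A.run G pos₀ t) i).2 with
    | none => exact Or.inl rfl
    | some l => exact Or.inr ⟨l, rfl⟩

end Agents

/-! ### A barrier inside a larger graph -/

/-- The map `f` embeds `B` without its distinguished edges into `Γ`, where the vertices `at_ i`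
are attached to the ends of the distinguished edges. At each side the two attached vertices have a
common neighbour `mid side`. -/
structure IsPart {V Y : Type} (B : TwoPort V) (Γ : CubicGraph Y) (f : V → Y)
    (at_ : Bool × Bool → Y) (mid : Bool → Y) : Prop where
  inj : Function.Injective f
  at_inj : Function.Injective at_
  at_ne : ∀ i b, f b ≠ at_ i
  mid_ne : ∀ side b, f b ≠ mid side
  nbr_port : ∀ i, Γ.nbr 0 (f (B.port i)) = at_ i
  nbr_inner : ∀ b, Function.partialInv B.port b = none → Γ.nbr 0 (f b) = f (B.nbr 0 b)
  nbr_other : ∀ m b, m ≠ 0 → Γ.nbr m (f b) = f (B.nbr m b)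
  nbr_at : ∀ m i, Γ.nbr m (at_ i) ≠ at_ (!i.1, i.2)
  nbr_mid : ∀ side x, Γ.nbr (if x then 1 else 2) (at_ (side, x)) = mid side

namespace IsPart

variable {V Y : Type} {B : TwoPort V} {Γ : CubicGraph Y} {f : V → Y} {at_ : Bool × Bool → Y}
  {mid : Bool → Y}

theorem nbr_zero_at (h : IsPart B Γ f at_ mid) (i : Bool × Bool) :
    Γ.nbr 0 (at_ i) = f (B.port i) := by
  rw [← h.nbr_port, Γ.nbr_nbr]

theorem nbr_ne (h : IsPart B Γ f at_ mid) {y : Y} (hy : ∀ b, f b ≠ y) {m : Fin 3}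
    (hm : m = 0 → ∀ i, at_ i ≠ y) (b : V) : f b ≠ Γ.nbr m y := by
  intro he
  have h1 : Γ.nbr m (f b) = y := by rw [he, Γ.nbr_nbr]
  by_cases h0 : m = 0
  · subst h0
    cases hp : Function.partialInv B.port b with
    | none => rw [h.nbr_inner b hp] at h1; exact hy _ h1
    | some i =>
      rw [← eq_of_partialInv B.port_inj hp, h.nbr_port] at h1
      exact hm rfl i h1
  · rw [h.nbr_other m b h0] at h1
    exact hy _ h1

open Classical in
/-- The rest of the graph, in which the attached vertices of opposite sides are joined, so that it
remains connected. -/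
noncomputable def rest (h : IsPart B Γ f at_ mid) : CubicGraph {y : Y // ∀ b, f b ≠ y} where
  nbr m y :=
    if hm : m = 0 ∧ ∃ i, at_ i = y.1 then
      ⟨at_ (!hm.2.choose.1, hm.2.choose.2), fun b => h.at_ne _ b⟩
    else ⟨Γ.nbr m y.1, h.nbr_ne y.2 fun h0 i hi => hm ⟨h0, i, hi⟩⟩
  nbr_nbr := by
    rintro m ⟨y, hy⟩
    by_cases hm : m = 0 ∧ ∃ i, at_ i = y
    · have h1 : m = 0 ∧ ∃ i, at_ i = at_ (!hm.2.choose.1, hm.2.choose.2) := ⟨hm.1, _, rfl⟩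
      have h2 := h.at_inj h1.2.choose_spec
      simp only [dif_pos hm, dif_pos h1, Subtype.mk.injEq]
      rw [h2]
      simpa using hm.2.choose_spec
    · have h1 : ¬ (m = 0 ∧ ∃ i, at_ i = Γ.nbr m y) := by
        rintro ⟨rfl, i, hi⟩
        have := h.nbr_zero_at i
        rw [hi, Γ.nbr_nbr] at this
        exact hy _ this.symm
      simp only [dif_neg hm, dif_neg h1, Γ.nbr_nbr]
  nbr_ne := by
    rintro m ⟨y, hy⟩ he
    by_cases hm : m = 0 ∧ ∃ i, at_ i = y
    · simp only [dif_pos hm, Subtype.mk.injEq] at he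
      have h2 := he.trans hm.2.choose_spec.symm
      have := congrArg Prod.fst (h.at_inj h2)
      simp at this
    · simp only [dif_neg hm, Subtype.mk.injEq] at he
      exact Γ.nbr_ne _ _ he
  nbr_inj := by
    rintro ⟨y, hy⟩ m m' he
    by_cases hm : m = 0 ∧ ∃ i, at_ i = y <;> by_cases hm' : m' = 0 ∧ ∃ i, at_ i = y
    · rw [hm.1, hm'.1]
    · simp only [dif_pos hm, dif_neg hm', Subtype.mk.injEq] at he
      obtain ⟨j, hj⟩ : ∃ j, at_ j = y ∧ at_ (!j.1, j.2) = Γ.nbr m' y :=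
        ⟨_, hm.2.choose_spec, he⟩
      rw [← hj.1] at hj
      exact absurd hj.2.symm (h.nbr_at _ _)
    · simp only [dif_neg hm, dif_pos hm', Subtype.mk.injEq] at he
      obtain ⟨j, hj⟩ : ∃ j, at_ j = y ∧ Γ.nbr m y = at_ (!j.1, j.2) :=
        ⟨_, hm'.2.choose_spec, he⟩
      rw [← hj.1] at hj
      exact absurd hj.2 (h.nbr_at _ _)
    · simp only [dif_neg hm, dif_neg hm', Subtype.mk.injEq] at he
      exact Γ.nbr_inj _ he

theorem rest_nbr_at (h : IsPart B Γ f at_ mid) (i : Bool × Bool) :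
    h.rest.nbr 0 ⟨at_ i, h.at_ne i⟩ = ⟨at_ (!i.1, i.2), h.at_ne _⟩ := by
  have h1 : (0 : Fin 3) = 0 ∧ ∃ j, at_ j = at_ i := ⟨rfl, i, rfl⟩
  have h2 := h.at_inj h1.2.choose_spec
  simp only [rest, dif_pos h1, h2]

theorem rest_nbr (h : IsPart B Γ f at_ mid) {m : Fin 3} {y : Y} (hy : ∀ b, f b ≠ y)
    (hm : ¬ (m = 0 ∧ ∃ i, at_ i = y)) : (h.rest.nbr m ⟨y, hy⟩).1 = Γ.nbr m y := by
  simp only [rest, dif_neg hm]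

/-- The attached vertices as a slot of the rest of the graph. -/
noncomputable def slot (h : IsPart B Γ f at_ mid) : Slot h.rest where
  at_ i := ⟨at_ i, h.at_ne i⟩
  inj _ _ hij := h.at_inj (congrArg Subtype.val hij)
  closed i := ⟨(!i.1, i.2), h.rest_nbr_at i⟩

/-- The vertices of `B` together with those of the rest of the graph. -/
def glue (f : V → Y) : V ⊕ {y : Y // ∀ b, f b ≠ y} → Y
  | .inl b => f b
  | .inr y => y.1

theorem glue_injective (h : IsPart B Γ f at_ mid) : Function.Injective (glue f) := by
  rintro (b | ⟨y, hy⟩) (b' | ⟨y', hy'⟩) he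
  · exact congrArg _ (h.inj he)
  · exact absurd he (hy' b)
  · exact absurd he.symm (hy b')
  · simp only [glue] at he; subst he; rfl

theorem glue_nbr (h : IsPart B Γ f at_ mid) (m : Fin 3) (z : V ⊕ {y : Y // ∀ b, f b ≠ y}) :
    glue f ((join B h.rest h.slot).nbr m z) = Γ.nbr m (glue f z) := by
  rcases z with b | ⟨y, hy⟩
  · by_cases hm : m = 0
    · subst hm
      cases hp : Function.partialInv B.port b with
      | none => simp [join, joinNbr, hp, glue, h.nbr_inner b hp]
      | some i =>
        have := eq_of_partialInv B.port_inj hp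
        subst this
        simp [join, joinNbr, hp, glue, h.nbr_port, slot]
    · simp [join, joinNbr, hm, glue, h.nbr_other m b hm]
  · by_cases hm : m = 0
    · subst hm
      cases hp : Function.partialInv h.slot.at_ ⟨y, hy⟩ with
      | none =>
        have : ¬ ((0 : Fin 3) = 0 ∧ ∃ i, at_ i = y) := by
          rintro ⟨-, i, rfl⟩
          have := partialInv_eq_some h.slot.inj i
          rw [show h.slot.at_ i = ⟨at_ i, hy⟩ from rfl, hp] at this
          cases this
        simp [join, joinNbr, hp, glue, h.rest_nbr hy this]
      | some i =>
        have := congrArg Subtype.val (eq_of_partialInv h.slot.inj hp)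
        simp only [slot] at this
        subst this
        simp [join, joinNbr, hp, glue, h.nbr_zero_at]
    · simp [join, joinNbr, hm, glue, h.rest_nbr hy fun h' => hm h'.1]

theorem rest_connected (h : IsPart B Γ f at_ mid) (hΓ : Γ.graph.Connected) :
    h.rest.graph.Connected := by
  let R : {y : Y // ∀ b, f b ≠ y} → {y : Y // ∀ b, f b ≠ y} → Prop := h.rest.graph.Reachable
  have adj : ∀ (m : Fin 3) (y : Y) (hy : ∀ b, f b ≠ y) (hm : ¬ (m = 0 ∧ ∃ i, at_ i = y))
      (hy' : ∀ b, f b ≠ Γ.nbr m y), R ⟨y, hy⟩ ⟨Γ.nbr m y, hy'⟩ := fun m y hy hm hy' =>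
    SimpleGraph.Adj.reachable ⟨m, Subtype.ext (h.rest_nbr hy hm)⟩
  -- the four attached vertices are connected in the rest
  have toMid : ∀ side x, R ⟨at_ (side, x), h.at_ne _⟩ ⟨mid side, h.mid_ne side⟩ := by
    intro side x
    have h1 := h.nbr_mid side x
    have h2 : (if x then (1 : Fin 3) else 2) ≠ 0 := by cases x <;> decide
    have h3 := adj _ _ (h.at_ne (side, x)) (fun h' => h2 h'.1)
      (fun b => by rw [h1]; exact h.mid_ne side b)
    simpa only [h1] using h3
  have across : R ⟨at_ (false, false), h.at_ne _⟩ ⟨at_ (true, false), h.at_ne _⟩ :=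
    SimpleGraph.Adj.reachable ⟨0, h.rest_nbr_at _⟩
  have atAll : ∀ i, R ⟨at_ i, h.at_ne i⟩ ⟨at_ (false, false), h.at_ne _⟩ := by
    rintro ⟨side, x⟩
    cases side
    · exact (toMid false x).trans (toMid false false).symm
    · exact ((toMid true x).trans (toMid true false).symm).trans across.symm
  have all : ∀ y z : Y, Γ.graph.Walk y z → ∀ hy : ∀ b, f b ≠ y, ((∃ b, f b = z)) →
      R ⟨y, hy⟩ ⟨at_ (false, false), h.at_ne _⟩ := by
    intro y z p
    induction p with
    | nil => rintro hy ⟨b, hb⟩; exact absurd hb (hy b)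
    | cons hadj p ih =>
      rename_i y y' z
      intro hy hz
      obtain ⟨m, rfl⟩ := hadj
      by_cases hm : m = 0 ∧ ∃ i, at_ i = y
      · obtain ⟨-, i, rfl⟩ := hm
        exact atAll i
      · have hy' : ∀ b, f b ≠ Γ.nbr m y := h.nbr_ne hy fun h0 i hi => hm ⟨h0, i, hi⟩
        exact (adj m y hy hm hy').trans (ih hy' hz)
  have : Nonempty {y : Y // ∀ b, f b ≠ y} := ⟨⟨_, h.at_ne (false, false)⟩⟩
  have all' : ∀ y, R y ⟨at_ (false, false), h.at_ne _⟩ := by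
    rintro ⟨y, hy⟩
    obtain ⟨p⟩ := hΓ.preconnected y (f (B.port (false, false)))
    exact all _ _ p hy ⟨_, rfl⟩
  exact ⟨fun y z => (all' y).trans (all' z).symm⟩

/-- A barrier keeps its properties as a part of a larger graph. -/
theorem barrier (h : IsPart B Γ f at_ mid) {k s r : ℕ} {A : Agents k s} (hB : IsBarrier A r B)
    [Finite Y] (hΓ : Γ.graph.Connected) {pos₀ : Fin k → Y} (h0 : ∀ i b, f b ≠ pos₀ i) :
    ∃ (X : Type) (ρ : ℕ → Snapshot k s (V ⊕ X)) (φ : V ⊕ X → Y), Function.Injective φ ∧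
      (∀ b, φ (.inl b) = f b) ∧ (∀ t, A.run Γ pos₀ t = (ρ t).map φ) ∧
      NoTraversal B r ρ ∧ NoSplit B r ρ := by
  obtain ⟨-, -, -, hB⟩ := hB
  have := hB _ h.rest h.slot (h.rest_connected hΓ) fun i => ⟨pos₀ i, h0 i⟩
  refine ⟨_, _, glue f, h.glue_injective, fun _ => rfl, fun t => ?_, this.1, this.2⟩
  rw [← A.run_map h.glue_injective h.glue_nbr]
  rfl

end IsPart

/-! ### The graph `H(B)` joined to another graph -/

section Expand

variable {V W X : Type} {B : TwoPort V} {H : CubicGraph W} {o : Direction H}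

/-- Whether the edge with label `m` at a vertex may be one of the distinguished edges for the
choice `p, q` of macro vertices. -/
def IsPortEdge (o : Direction H) (V : Type) (p q : W) (m : Fin 3) (y : Bool × GadgetVertex o V) :
    Prop :=
  m = 0 ∧ y.1 = false ∧ ∃ w, (w = p ∨ w = q) ∧ (y.2 = .main w ∨ y.2 = .hub w 0)

theorem isPortEdge_port {p q : W} {hpq : p ≠ q} (i : Bool × Bool) :
    IsPortEdge o V p q 0 ((expandTwoPort B o p q hpq).port i) := by
  obtain ⟨a, x⟩ := i
  cases a <;> cases x <;> simp [IsPortEdge, expandTwoPort]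

theorem join_nbr_inl {p q : W} {hpq : p ≠ q} {G : CubicGraph X} {g : Slot G} {m : Fin 3}
    {y : Bool × GadgetVertex o V} (h : ¬ IsPortEdge o V p q m y) :
    (join (expandTwoPort B o p q hpq) G g).nbr m (.inl y) = .inl (expandNbr B o m y) := by
  by_cases hm : m = 0
  · subst hm
    cases hp : Function.partialInv (expandTwoPort B o p q hpq).port y with
    | none => simp only [join, joinNbr, if_true, hp]; rfl
    | some i =>
      exfalso
      apply h
      rw [← eq_of_partialInv (expandTwoPort B o p q hpq).port_inj hp]
      exact isPortEdge_port i
  · simp only [join, joinNbr, if_neg hm]; rfl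

/-- From a vertex of `H(B)` the step along an edge stays in `H(B)` or starts at a port. -/
theorem join_nbr_cases {p q : W} {hpq : p ≠ q} {G : CubicGraph X} {g : Slot G} (m : Fin 3)
    (y : Bool × GadgetVertex o V) :
    (join (expandTwoPort B o p q hpq) G g).nbr m (.inl y) = .inl (expandNbr B o m y) ∨
      (∃ x, (join (expandTwoPort B o p q hpq) G g).nbr m (.inl y) = .inr x) ∧
      ∃ i, y = (expandTwoPort B o p q hpq).port i := by
  by_cases hm : m = 0
  · subst hm
    cases hp : Function.partialInv (expandTwoPort B o p q hpq).port y with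
    | none => left; simp only [join, joinNbr, if_true, hp]; rfl
    | some i =>
      right
      exact ⟨⟨g.at_ i, by simp only [join, joinNbr, if_true, hp]⟩, i,
        (eq_of_partialInv (expandTwoPort B o p q hpq).port_inj hp).symm⟩
  · left; simp only [join, joinNbr, if_neg hm]; rfl

theorem endOf_edgeAt_not (w : W) (l : Fin 3) :
    o.endOf (o.edgeAt w l) (!o.sideAt w l) = H.nbr l w := by
  by_cases h : o.out w l = true
  · simp [Direction.edgeAt, Direction.sideAt, h, Direction.endOf]
  · simp [Direction.edgeAt, Direction.sideAt, h, Direction.endOf]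

theorem nbr_endOf (e : {d : W × Fin 3 // o.out d.1 d.2 = true}) (side : Bool) :
    H.nbr e.1.2 (o.endOf e side) = o.endOf e (!side) := by
  cases side <;> simp [Direction.endOf, H.nbr_nbr]

theorem endOf_ne (e : {d : W × Fin 3 // o.out d.1 d.2 = true}) (side : Bool) :
    o.endOf e (!side) ≠ o.endOf e side := by
  rw [← nbr_endOf]; exact H.nbr_ne _ _

section Connected

variable {Y : Type} {Γ : CubicGraph Y} {φ : Bool × GadgetVertex o V → Y} {p q : W}

/-- The graph contains `H(B)` without its distinguished edges. -/
def ContainsExpand (B : TwoPort V) (o : Direction H) (p q : W) (Γ : CubicGraph Y)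
    (φ : Bool × GadgetVertex o V → Y) : Prop :=
  ∀ m y, ¬ IsPortEdge o V p q m y → Γ.nbr m (φ y) = φ (expandNbr B o m y)

/-- `H(B)` remains connected without its distinguished edges: the two copies of a gadget are
joined, and in the second copy no edge is missing. -/
theorem ContainsExpand.connected (h : ContainsExpand B o p q Γ φ) (hB : B.graph.Connected)
    (hH : H.graph.Connected) (y : Bool × GadgetVertex o V) (w : W) :
    Γ.graph.Reachable (φ y) (φ (true, .main w)) := by
  have step : ∀ m y, ¬ IsPortEdge o V p q m y →
      Γ.graph.Reachable (φ y) (φ (expandNbr B o m y)) := fun m y hy =>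
    SimpleGraph.Adj.reachable ⟨m, h m y hy⟩
  have rimZero : ∀ c w l (x : Bool), Γ.graph.Reachable (φ (c, .rim w l (rimIdx x)))
      (φ (c, .rim w l 0)) := by
    intro c w l x
    cases x
    · simpa [expandNbr, rimIdx] using
        step 2 (c, .rim w l 1) (by simp [IsPortEdge])
    · simpa [expandNbr, rimIdx] using
        step 1 (c, .rim w l 2) (by simp [IsPortEdge])
  have rims : ∀ c w l x, Γ.graph.Reachable (φ (c, .rim w l x)) (φ (c, .rim w l 0)) := by
    intro c w l x
    fin_cases x
    · exact SimpleGraph.Reachable.refl _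
    · exact rimZero c w l false
    · exact rimZero c w l true
  have hubRim : ∀ c w l, Γ.graph.Reachable (φ (c, .hub w l)) (φ (c, .rim w l 0)) := by
    intro c w l
    obtain ⟨m, hm, hl⟩ : ∃ m : Fin 3, m ≠ 0 ∧ m ≠ l := by revert l; decide
    have := step m (c, .hub w l) (by simp [IsPortEdge, hm])
    rw [show expandNbr B o m (c, .hub w l) = (c, .rim w l m) by simp [expandNbr, hl]] at this
    exact this.trans (rims c w l m)
  have copies : ∀ c w l, Γ.graph.Reachable (φ (c, .rim w l 0)) (φ (true, .rim w l 0)) := by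
    intro c w l
    cases c
    · have := step l (false, .rim w l l) (by simp [IsPortEdge])
      rw [show expandNbr B o l (false, .rim w l l) = (true, .rim w l l) by
        simp [expandNbr]] at this
      exact (rims _ w l l).symm.trans (this.trans (rims _ w l l))
    · exact SimpleGraph.Reachable.refl _
  have rimMain : ∀ c w l, Γ.graph.Reachable (φ (c, .rim w l 0)) (φ (true, .main w)) := by
    intro c w l
    have := step l (true, .main w) (by simp [IsPortEdge])
    rw [show expandNbr B o l (true, .main w) = (true, .hub w l) by simp [expandNbr]] at this
    exact (copies c w l).trans ((hubRim true w l).symm.trans this.symm)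
  have mainMain : ∀ c w, Γ.graph.Reachable (φ (c, .main w)) (φ (true, .main w)) := by
    intro c w
    have := step 1 (c, .main w) (by simp [IsPortEdge])
    rw [show expandNbr B o 1 (c, .main w) = (c, .hub w 1) by simp [expandNbr]] at this
    exact this.trans ((hubRim c w 1).trans (rimMain c w 1))
  have coreAdj : ∀ c e m b, Γ.graph.Reachable (φ (c, .core e b)) (φ (c, .core e (B.nbr m b))) := by
    intro c e m b
    have hs := step m (c, .core e b) (by simp [IsPortEdge])
    by_cases hm : m = 0
    · subst hm
      cases hp : Function.partialInv B.port b with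
      | none => simpa [expandNbr, hp] using hs
      | some i =>
        have hb := eq_of_partialInv B.port_inj hp
        subst hb
        have hs' := step 0 (c, .core e (B.port (i.1, !i.2))) (by simp [IsPortEdge])
        rw [B.nbr_port_not]
        simp only [expandNbr, hp, if_true, partialInv_eq_some B.port_inj] at hs hs'
        exact hs.trans ((rimZero _ _ _ _).trans ((rimZero _ _ _ _).symm.trans hs'.symm))
    · simpa [expandNbr, hm] using hs
  have coreWalk : ∀ c e (b b' : V), B.graph.Walk b b' →
      Γ.graph.Reachable (φ (c, .core e b)) (φ (c, .core e b')) := by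
    intro c e b b' w
    induction w with
    | nil => exact SimpleGraph.Reachable.refl _
    | cons hadj _ ih =>
      obtain ⟨m, rfl⟩ := hadj
      exact (coreAdj c e m _).trans ih
  have coreEnd : ∀ c e b side, Γ.graph.Reachable (φ (c, .core e b))
      (φ (true, .main (o.endOf e side))) := by
    intro c e b side
    obtain ⟨w⟩ := hB.preconnected b (B.port (side, false))
    have hs := step 0 (c, .core e (B.port (side, false))) (by simp [IsPortEdge])
    simp only [expandNbr, if_true, partialInv_eq_some B.port_inj] at hs
    exact (coreWalk c e _ _ w).trans (hs.trans ((rims _ _ _ _).trans (rimMain _ _ _)))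
  have mainWalk : ∀ v w : W, H.graph.Walk v w →
      Γ.graph.Reachable (φ (true, .main v)) (φ (true, .main w)) := by
    intro v w pw
    induction pw with
    | nil => exact SimpleGraph.Reachable.refl _
    | @cons v _ _ hadj _ ih =>
      obtain ⟨l, rfl⟩ := hadj
      have h1 := coreEnd true (o.edgeAt v l) (B.port (false, false)) (o.sideAt v l)
      have h2 := coreEnd true (o.edgeAt v l) (B.port (false, false)) (!o.sideAt v l)
      rw [o.endOf_edgeAt] at h1
      rw [endOf_edgeAt_not] at h2
      exact (h1.symm.trans h2).trans ih
  have main : ∀ v, Γ.graph.Reachable (φ (true, .main v)) (φ (true, .main w)) := fun v =>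
    let ⟨pw⟩ := hH.preconnected v w
    mainWalk v w pw
  obtain ⟨c, y⟩ := y
  cases y with
  | main v => exact (mainMain c v).trans (main v)
  | hub v l => exact (hubRim c v l).trans ((rimMain c v l).trans (main v))
  | rim v l x => exact (rims c v l x).trans ((rimMain c v l).trans (main v))
  | core e b => exact (coreEnd c e b false).trans (main _)

end Connected

theorem expand_connected {p q : W} {hpq : p ≠ q} (hB : B.graph.Connected)
    (hH : H.graph.Connected) : (expandTwoPort B o p q hpq).graph.Connected := by
  have h : ContainsExpand B o p q (expandTwoPort B o p q hpq).toCubicGraph id :=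
    fun _ _ _ => rfl
  have all := fun y => h.connected hB hH y p
  have : Nonempty (Bool × GadgetVertex o V) := ⟨(true, .main p)⟩
  exact ⟨fun y z => (all y).trans (all z).symm⟩

theorem join_expand_connected {p q : W} {hpq : p ≠ q} {G : CubicGraph X} {g : Slot G}
    (hB : B.graph.Connected) (hH : H.graph.Connected) (hG : G.graph.Connected) :
    (join (expandTwoPort B o p q hpq) G g).graph.Connected := by
  have h : ContainsExpand B o p q (join (expandTwoPort B o p q hpq) G g) Sum.inl :=
    fun _ _ hy => join_nbr_inl hy
  have inl := fun y => h.connected hB hH y p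
  have slot : ∀ i, (join (expandTwoPort B o p q hpq) G g).graph.Reachable (.inr (g.at_ i))
      (.inl (true, .main p)) := by
    intro i
    refine SimpleGraph.Reachable.trans
      (SimpleGraph.Adj.reachable (v := .inl ((expandTwoPort B o p q hpq).port i)) ⟨0, ?_⟩) (inl _)
    simp [join, joinNbr, partialInv_eq_some g.inj]
  have walk : ∀ x x' : X, G.graph.Walk x x' → (∃ i, x' = g.at_ i) →
      (join (expandTwoPort B o p q hpq) G g).graph.Reachable (.inr x) (.inl (true, .main p)) := by
    intro x x' pw
    induction pw with
    | nil => rintro ⟨i, rfl⟩; exact slot i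
    | @cons x _ _ hadj _ ih =>
      intro hx
      obtain ⟨m, rfl⟩ := hadj
      by_cases hm : m = 0 ∧ ∃ i, g.at_ i = x
      · obtain ⟨-, i, rfl⟩ := hm
        exact slot i
      · refine SimpleGraph.Reachable.trans (SimpleGraph.Adj.reachable ⟨m, ?_⟩) (ih hx)
        by_cases h0 : m = 0
        · subst h0
          cases hp : Function.partialInv g.at_ x with
          | none => simp [join, joinNbr, hp]
          | some i => exact absurd ⟨rfl, i, eq_of_partialInv g.inj hp⟩ hm
        · simp [join, joinNbr, h0]
  have inr : ∀ x, (join (expandTwoPort B o p q hpq) G g).graph.Reachable (.inr x)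
      (.inl (true, .main p)) := fun x =>
    let ⟨pw⟩ := hG.preconnected x (g.at_ (false, false))
    walk _ _ pw ⟨_, rfl⟩
  have all : ∀ y, (join (expandTwoPort B o p q hpq) G g).graph.Reachable y
      (.inl (true, .main p)) := by
    rintro (y | x)
    · exact inl y
    · exact inr x
  have : Nonempty ((Bool × GadgetVertex o V) ⊕ X) := ⟨.inl (true, .main p)⟩
  exact ⟨fun y z => (all y).trans (all z).symm⟩

/-- A copy of `B` is a part of the graph obtained by joining a graph to `H(B)`. -/
theorem isPart_core {p q : W} {hpq : p ≠ q} {G : CubicGraph X} {g : Slot G}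
    (κ : Bool × {d : W × Fin 3 // o.out d.1 d.2 = true}) :
    IsPart B (join (expandTwoPort B o p q hpq) G g) (fun b => .inl (κ.1, .core κ.2 b))
      (fun i => .inl (κ.1, .rim (o.endOf κ.2 i.1) κ.2.1.2 (rimIdx i.2)))
      (fun side => .inl (κ.1, .rim (o.endOf κ.2 side) κ.2.1.2 0)) where
  inj b b' h := by simpa using h
  at_inj := by
    rintro ⟨side, x⟩ ⟨side', x'⟩ h
    simp only [Sum.inl.injEq, Prod.mk.injEq, GadgetVertex.rim.injEq, true_and] at h
    have h1 : side = side' := by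
      by_contra hne
      have : side = !side' := by cases side <;> cases side' <;> simp_all
      subst this
      exact endOf_ne _ _ h.1
    have h2 : x = x' := by
      have := h.2
      cases x <;> cases x' <;> simp_all [rimIdx]
    rw [h1, h2]
  at_ne i b := by simp
  mid_ne side b := by simp
  nbr_port i := by
    rw [join_nbr_inl (by simp [IsPortEdge])]
    simp [expandNbr, partialInv_eq_some B.port_inj]
  nbr_inner b hb := by
    rw [join_nbr_inl (by simp [IsPortEdge])]
    simp [expandNbr, hb]
  nbr_other m b hm := by
    rw [join_nbr_inl (by simp [IsPortEdge])]
    simp [expandNbr, hm]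
  nbr_at := by
    rintro m ⟨side, x⟩ h
    rw [join_nbr_inl (by simp [IsPortEdge])] at h
    have hne := endOf_ne (o := o) κ.2 side
    fin_cases m <;> cases x <;> simp [expandNbr, rimIdx, hne.symm] at h <;> split at h <;>
      simp at h
  nbr_mid := by
    intro side x
    rw [join_nbr_inl (by simp [IsPortEdge])]
    cases x <;> simp [expandNbr, rimIdx]

end Expand

/-! ### Zones and copies of `B` -/

section Zone

variable {V W X : Type} {H : CubicGraph W} {o : Direction H}

/-- The edges of a directed graph, each given by its tail and its label. -/
abbrev DirEdge (o : Direction H) : Type := {d : W × Fin 3 // o.out d.1 d.2 = true}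

/-- The macro vertex to whose zone a vertex of a gadget belongs. The zone of a macro vertex consists
of itself and the hubs and rims next to it; the vertices of the copies of `B` are in no zone. -/
def GadgetVertex.zone : GadgetVertex o V → Option W
  | .main w => some w
  | .hub w _ => some w
  | .rim w _ _ => some w
  | .core _ _ => none

/-- The position is in the copy `κ` of `B`. -/
def InCore (κ : Bool × DirEdge o) (z : (Bool × GadgetVertex o V) ⊕ X) : Prop :=
  ∃ b, z = .inl (κ.1, .core κ.2 b)

/-- The position is an end of a distinguished edge of the copy `κ` of `B`. -/
def AtPort (B : TwoPort V) (κ : Bool × DirEdge o) (σ : Bool) (z : (Bool × GadgetVertex o V) ⊕ X) :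
    Prop :=
  ∃ x, z = .inl (κ.1, .core κ.2 (B.port (σ, x)))

/-- The position is in the zone of the macro vertex `w`. -/
def InZone (w : W) (z : (Bool × GadgetVertex o V) ⊕ X) : Prop :=
  ∃ y, z = .inl y ∧ y.2.zone = some w

/-- A sequence of positions that stays or moves along an edge of `H(B)` in each step, unless it
leaves or enters `H(B)` in the zone of a macro vertex in `L`. -/
structure Moves (B : TwoPort V) (o : Direction H) (L : W → Prop)
    (x : ℕ → (Bool × GadgetVertex o V) ⊕ X) : Prop where
  inl : ∀ t y, x t = .inl y → x (t + 1) = .inl y ∨ (∃ m, x (t + 1) = .inl (expandNbr B o m y)) ∨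
    (∃ w, y.2.zone = some w ∧ L w) ∧ ∃ z, x (t + 1) = .inr z
  inr : ∀ t z y, x t = .inr z → x (t + 1) = .inl y → ∃ w, y.2.zone = some w ∧ L w

theorem AtPort.inCore {B : TwoPort V} {κ : Bool × DirEdge o} {σ : Bool}
    {z : (Bool × GadgetVertex o V) ⊕ X} (h : AtPort B κ σ z) : InCore κ z := by
  obtain ⟨x, h⟩ := h; exact ⟨_, h⟩

theorem InCore.not_inZone {κ : Bool × DirEdge o} {z : (Bool × GadgetVertex o V) ⊕ X} {w : W}
    (h : InCore κ z) : ¬ InZone w z := by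
  rintro ⟨y, h1, h2⟩
  obtain ⟨b, rfl⟩ := h
  rw [Sum.inl.injEq] at h1
  subst h1
  cases h2

theorem InCore.unique {κ κ' : Bool × DirEdge o} {z : (Bool × GadgetVertex o V) ⊕ X}
    (h : InCore κ z) (h' : InCore κ' z) : κ = κ' := by
  obtain ⟨b, rfl⟩ := h
  obtain ⟨b', h'⟩ := h'
  simp only [Sum.inl.injEq, Prod.mk.injEq, GadgetVertex.core.injEq] at h'
  exact Prod.ext h'.1 h'.2.1

theorem InZone.unique {w w' : W} {z : (Bool × GadgetVertex o V) ⊕ X}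
    (h : InZone w z) (h' : InZone w' z) : w = w' := by
  obtain ⟨y, rfl, h⟩ := h
  obtain ⟨y', h1, h'⟩ := h'
  rw [Sum.inl.injEq] at h1
  subst h1
  exact Option.some.inj (h.symm.trans h')

theorem inZone_or_inCore (y : Bool × GadgetVertex o V) :
    (∃ w, InZone (X := X) w (.inl y)) ∨ ∃ κ, InCore (X := X) κ (.inl y) := by
  obtain ⟨c, y⟩ := y
  cases y with
  | main w => exact .inl ⟨w, _, rfl, rfl⟩
  | hub w l => exact .inl ⟨w, _, rfl, rfl⟩
  | rim w l x => exact .inl ⟨w, _, rfl, rfl⟩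
  | core e b => exact .inr ⟨(c, e), b, rfl⟩

variable {B : TwoPort V}

theorem zone_step {w : W} {y : Bool × GadgetVertex o V} (h : y.2.zone = some w) (m : Fin 3) :
    InZone (X := X) w (.inl (expandNbr B o m y)) ∨
      ∃ κ σ, AtPort (X := X) B κ σ (.inl (expandNbr B o m y)) ∧ o.endOf κ.2 σ = w := by
  obtain ⟨c, y⟩ := y
  cases y with
  | main v => left; exact ⟨_, rfl, h⟩
  | hub v l =>
    left
    refine ⟨_, rfl, ?_⟩
    by_cases hm : m = l <;> simpa [expandNbr, hm, GadgetVertex.zone] using h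
  | rim v l x =>
    simp only [GadgetVertex.zone, Option.some.injEq] at h
    subst h
    by_cases hmx : m = x
    · left
      refine ⟨_, rfl, ?_⟩
      subst hmx
      by_cases hml : m = l <;> simp [expandNbr, hml, GadgetVertex.zone]
    · by_cases hx : x = 0
      · left
        refine ⟨_, rfl, ?_⟩
        simp only [expandNbr, if_neg hmx, if_pos hx, GadgetVertex.zone]
      · by_cases hm : m = 0
        · right
          refine ⟨(c, o.edgeAt v l), o.sideAt v l, ⟨decide (x = 2), ?_⟩, o.endOf_edgeAt v l⟩
          simp only [expandNbr, if_neg hmx, if_neg hx, if_pos hm]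
        · left
          refine ⟨_, rfl, ?_⟩
          simp only [expandNbr, if_neg hmx, if_neg hx, if_neg hm, GadgetVertex.zone]
  | core e b => cases h

theorem core_step (c : Bool) (e : DirEdge o) (b : V) (m : Fin 3) :
    InCore (X := X) (c, e) (.inl (expandNbr B o m (c, .core e b))) ∨
      ∃ σ x, b = B.port (σ, x) ∧
        InZone (X := X) (o.endOf e σ) (.inl (expandNbr B o m (c, .core e b))) := by
  by_cases hm : m = 0
  · subst hm
    cases hp : Function.partialInv B.port b with
    | none => left; exact ⟨B.nbr 0 b, by simp [expandNbr, hp]⟩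
    | some i =>
      right
      exact ⟨i.1, i.2, (eq_of_partialInv B.port_inj hp).symm,
        _, rfl, by simp [expandNbr, hp, GadgetVertex.zone]⟩
  · left; exact ⟨B.nbr m b, by simp [expandNbr, hm]⟩

namespace Moves

variable {L : W → Prop} {x : ℕ → (Bool × GadgetVertex o V) ⊕ X}

theorem of_inZone (hx : Moves B o L x) {t : ℕ} {w : W} (h : InZone w (x t)) (hL : ¬ L w) :
    InZone w (x (t + 1)) ∨ ∃ κ σ, AtPort B κ σ (x (t + 1)) ∧ o.endOf κ.2 σ = w := by
  obtain ⟨y, hy, hw⟩ := h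
  rcases hx.inl t y hy with h1 | ⟨m, h1⟩ | ⟨⟨w', hw', hL'⟩, -⟩
  · left; rw [h1]; exact ⟨y, rfl, hw⟩
  · rw [h1]; exact zone_step hw m
  · rw [hw, Option.some.injEq] at hw'
    subst hw'
    exact absurd hL' hL

theorem of_inCore (hx : Moves B o L x) {t : ℕ} {κ : Bool × DirEdge o} (h : InCore κ (x t)) :
    InCore κ (x (t + 1)) ∨ ∃ σ, AtPort B κ σ (x t) ∧ InZone (o.endOf κ.2 σ) (x (t + 1)) := by
  obtain ⟨b, hy⟩ := h
  rcases hx.inl t _ hy with h1 | ⟨m, h1⟩ | ⟨⟨w', hw', hL'⟩, -⟩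
  · left; rw [h1]; exact ⟨b, rfl⟩
  · rcases core_step (X := X) (B := B) κ.1 κ.2 b m with h2 | ⟨σ, z, rfl, h2⟩
    · left; rw [h1]; exact h2
    · right; exact ⟨σ, ⟨z, hy⟩, by rw [h1]; exact h2⟩
  · cases hw'

/-- A copy of `B` is entered through one of its ports. -/
theorem entry (hx : Moves B o L x) {t : ℕ} {κ : Bool × DirEdge o} (h : ¬ InCore κ (x t))
    (h' : InCore κ (x (t + 1))) :
    ∃ σ, AtPort B κ σ (x (t + 1)) ∧ InZone (o.endOf κ.2 σ) (x t) := by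
  cases hy : x t with
  | inr z =>
    obtain ⟨b, hb⟩ := h'
    obtain ⟨w, hw, -⟩ := hx.inr t z _ hy hb
    cases hw
  | inl y =>
    rcases hx.inl t y hy with h1 | ⟨m, h1⟩ | ⟨-, z, h1⟩
    · rw [h1, ← hy] at h'; exact absurd h' h
    · rcases inZone_or_inCore (X := X) y with ⟨w, hw⟩ | ⟨κ', hκ'⟩
      · have hw' : y.2.zone = some w := by
          obtain ⟨y', e, hw⟩ := hw
          rw [Sum.inl.injEq] at e
          rwa [e]
        rcases zone_step (X := X) (B := B) hw' m with h2 | ⟨κ', σ, h2, h3⟩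
        · rw [h1] at h'; exact absurd h2 h'.not_inZone
        · rw [h1] at h' ⊢
          obtain rfl := h'.unique h2.inCore
          exact ⟨σ, h2, by rw [h3]; exact hw⟩
      · obtain ⟨b, hb⟩ := hκ'
        rw [Sum.inl.injEq] at hb
        subst hb
        rcases core_step (X := X) (B := B) κ'.1 κ'.2 b m with h2 | ⟨σ, z, -, h2⟩
        · rw [h1] at h'
          obtain rfl := h'.unique h2
          exact absurd ⟨b, hy⟩ h
        · rw [h1] at h'; exact absurd h2 h'.not_inZone
    · obtain ⟨b, hb⟩ := h'
      rw [h1] at hb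
      cases hb

/-- A sequence of positions that starts in the zones of a set `U` of macro vertices (or in a copy
of `B` between two of them) remains there or in the copies of `B` next to them, unless it gets
through a copy of `B` from a macro vertex in `U` to another one. -/
theorem zone_invariant (hx : Moves B o L x) {U : W → Prop} (hU : ∀ w, L w → ¬ U w) {t₀ t₁ : ℕ}
    (hc : ∀ κ σ s₁ s₂, t₀ < s₁ → s₁ ≤ s₂ → s₂ < t₁ → (∀ t, s₁ ≤ t → t ≤ s₂ → InCore κ (x t)) →
      AtPort B κ σ (x s₁) → AtPort B κ (!σ) (x s₂) → U (o.endOf κ.2 σ) → U (o.endOf κ.2 (!σ)))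
    (h₀ : (∃ w, InZone w (x t₀) ∧ U w) ∨ ∃ κ, InCore κ (x t₀) ∧ ∀ σ, U (o.endOf κ.2 σ))
    {t : ℕ} (h1 : t₀ ≤ t) (h2 : t ≤ t₁) :
    (∃ w, InZone w (x t) ∧ U w) ∨ ∃ κ σ, InCore κ (x t) ∧ U (o.endOf κ.2 σ) := by
  have key : (∃ w, InZone w (x t) ∧ U w) ∨ ∃ κ, InCore κ (x t) ∧
      ((∀ σ, U (o.endOf κ.2 σ)) ∨ ∃ σ s, t₀ < s ∧ s ≤ t ∧ (∀ τ, s ≤ τ → τ ≤ t → InCore κ (x τ)) ∧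
        AtPort B κ σ (x s) ∧ U (o.endOf κ.2 σ)) := by
    induction t, h1 using Nat.le_induction with
    | base =>
      rcases h₀ with h | ⟨κ, h, h'⟩
      · exact .inl h
      · exact .inr ⟨κ, h, .inl h'⟩
    | succ t h1 ih =>
      rcases ih (by omega) with ⟨w, hw, hwU⟩ | ⟨κ, hκ, hκU⟩
      · rcases hx.of_inZone hw fun h => hU w h hwU with h | ⟨κ, σ, h, rfl⟩
        · exact .inl ⟨w, h, hwU⟩
        · refine .inr ⟨κ, h.inCore, .inr ⟨σ, t + 1, by omega, le_rfl, ?_, h, hwU⟩⟩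
          intro τ h3 h4
          obtain rfl : τ = t + 1 := by omega
          exact h.inCore
      · rcases hx.of_inCore hκ with h | ⟨σ', hp, hz⟩
        · refine .inr ⟨κ, h, ?_⟩
          rcases hκU with hκU | ⟨σ, s, h3, h4, h5, h6, h7⟩
          · exact .inl hκU
          · refine .inr ⟨σ, s, h3, by omega, fun τ h8 h9 => ?_, h6, h7⟩
            rcases Nat.lt_or_ge t τ with h10 | h10
            · obtain rfl : τ = t + 1 := by omega
              exact h
            · exact h5 τ h8 h10
        · refine .inl ⟨_, hz, ?_⟩
          rcases hκU with hκU | ⟨σ, s, h3, h4, h5, h6, h7⟩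
          · exact hκU σ'
          · by_cases hσ : σ' = σ
            · rwa [hσ]
            · obtain rfl : σ' = !σ := Bool.eq_not_of_ne hσ
              exact hc κ σ s t h3 h4 (by omega) h5 h6 hp h7
  rcases key with h | ⟨κ, h, h' | ⟨σ, s, -, -, -, -, h'⟩⟩
  · exact .inl h
  · exact .inr ⟨κ, false, h, h' false⟩
  · exact .inr ⟨κ, σ, h, h'⟩

end Moves

/-- A walk between two macro vertices of levels at least 3 apart traverses at least 3 copies of
`B`: one for each level that is left. -/
theorem three_le_ncard_traverses [Finite W] {p q : W} {hpq : p ≠ q} {lev : W → ℤ}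
    (hlev : ∀ m w, |lev (H.nbr m w) - lev w| ≤ 1) (hp : lev p = 0) (hq : 3 ≤ lev q) (x y : Bool)
    (P : (expandTwoPort B o p q hpq).graph.Walk ((expandTwoPort B o p q hpq).port (false, x))
      ((expandTwoPort B o p q hpq).port (true, y))) :
    3 ≤ {e | Traverses B P.getVert P.length e}.ncard := by
  have hzp : ∀ x, ((expandTwoPort B o p q hpq).port (false, x)).2.zone = some p := by
    intro x; cases x <;> rfl
  have hzq : ∀ x, ((expandTwoPort B o p q hpq).port (true, x)).2.zone = some q := by
    intro x; cases x <;> rfl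
  have hm : Moves (X := Empty) B o (fun _ => False) fun t => .inl (P.getVert t) := by
    refine ⟨fun t y hy => ?_, fun t z => z.elim⟩
    rw [Sum.inl.injEq] at hy
    subst hy
    by_cases ht : t < P.length
    · obtain ⟨m, hm⟩ := P.adj_getVert_succ ht
      exact .inr (.inl ⟨m, congrArg Sum.inl hm.symm⟩)
    · left
      have h1 := P.getVert_of_length_le (i := t) (by omega)
      have h2 := P.getVert_of_length_le (i := t + 1) (by omega)
      exact congrArg Sum.inl (h2.trans h1.symm)
  have key : ∀ n : Fin 3, ∃ κ, Traverses B P.getVert P.length κ ∧ ∃ σ,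
      lev (o.endOf κ.2 σ) = n ∧ lev (o.endOf κ.2 (!σ)) = n + 1 := by
    intro n
    by_contra hno
    have hn : ((n.1 : ℕ) : ℤ) < 3 := by exact_mod_cast n.2
    have h := hm.zone_invariant (U := fun w => lev w ≤ n) (t₀ := 0) (t₁ := P.length)
      (fun _ h => h.elim) ?_ (.inl ⟨p, ⟨_, rfl, ?_⟩, ?_⟩) (Nat.zero_le _) le_rfl
    · have hend : InZone (X := Empty) q (.inl (P.getVert P.length)) :=
        ⟨_, rfl, by rw [P.getVert_length]; exact hzq y⟩
      rcases h with ⟨w, hw, hwU⟩ | ⟨κ, σ, hκ, -⟩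
      · rw [hw.unique hend] at hwU
        linarith
      · exact hκ.not_inZone hend
    · intro κ σ s₁ s₂ _ h12 h2 hin h3 h4 hU
      by_contra hU'
      refine hno ⟨κ, ⟨s₁, s₂, h12, h2.le, fun t h5 h6 => ?_, σ, ?_⟩, σ, ?_⟩
      · obtain ⟨b, hb⟩ := hin t h5 h6
        exact ⟨b, Sum.inl.inj hb⟩
      · obtain ⟨a, ha⟩ := h3
        obtain ⟨b, hb⟩ := h4
        exact ⟨a, b, Sum.inl.inj ha, Sum.inl.inj hb⟩
      · have := hlev κ.2.1.2 (o.endOf κ.2 σ)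
        rw [nbr_endOf, abs_le] at this
        constructor <;> omega
    · rw [P.getVert_zero]; exact hzp x
    · rw [hp]; positivity
  choose κ hκ hlevκ using key
  have hinj : Function.Injective κ := by
    intro n n' hnn
    obtain ⟨σ, h1, h2⟩ := hlevκ n
    obtain ⟨σ', h1', h2'⟩ := hlevκ n'
    rw [← hnn] at h1' h2'
    apply Fin.ext
    by_cases hσ : σ = σ'
    · subst hσ; omega
    · obtain rfl : σ = !σ' := Bool.eq_not_of_ne hσ
      rw [Bool.not_not] at h2
      omega
  have hsub : Set.range κ ⊆ {e | Traverses B P.getVert P.length e} := by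
    rintro _ ⟨n, rfl⟩; exact hκ n
  have hcard : (Set.range κ).ncard = 3 := by
    rw [← Set.image_univ, Set.ncard_image_of_injective _ hinj, Set.ncard_univ]; simp
  calc 3 = (Set.range κ).ncard := hcard.symm
    _ ≤ _ := Set.ncard_le_ncard hsub (Set.toFinite _)

end Zone

/-! ### Agents near one edge -/

section Scene

variable {k : ℕ} {V W X : Type} {H : CubicGraph W} {o : Direction H} {B : TwoPort V}
  {L : W → Prop} {r : ℕ} {P : Fin k → ℕ → (Bool × GadgetVertex o V) ⊕ X}

/-- The positions of agents that move in `H(B)` and to which every copy of `B` is a barrier: it is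
neither traversed by fewer than `r` agents nor do `r` agents split up in it. -/
structure AmongBarriers (B : TwoPort V) (L : W → Prop) (r : ℕ)
    (P : Fin k → ℕ → (Bool × GadgetVertex o V) ⊕ X) : Prop where
  moves : ∀ a, Moves B o L (P a)
  noTraversal : ∀ κ, ∀ S : Finset (Fin k), S.card < r → ∀ i ∈ S, ∀ (σ : Bool) (t₁ t₂ : ℕ),
    t₁ ≤ t₂ → (∀ t, t₁ ≤ t → t ≤ t₂ → ∀ j, InCore κ (P j t) → j ∈ S) →
    (∀ t, t₁ ≤ t → t ≤ t₂ → InCore κ (P i t)) →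
    AtPort B κ σ (P i t₁) → ¬ AtPort B κ (!σ) (P i t₂)
  noSplit : ∀ κ, ∀ S : Finset (Fin k), S.card = r → ∀ i ∈ S, ∀ j ∈ S, ∀ (σ : Bool) (t₁ t₂ : ℕ),
    t₁ ≤ t₂ → (∀ t, t₁ ≤ t → t ≤ t₂ → ∀ j, InCore κ (P j t) → j ∈ S) →
    (∀ a ∈ S, ∃ t, t₁ ≤ t ∧ t ≤ t₂ ∧ InCore κ (P a t)) →
    AtPort B κ σ (P i t₁) → ¬ InCore κ (P i t₂) → ¬ InCore κ (P j t₂) →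
    (∀ t, t₁ ≤ t → t < t₂ → InCore κ (P i t) → ¬ InCore κ (P i (t + 1)) →
      AtPort B κ (!σ) (P i t)) →
    ¬ ∀ t, t₁ ≤ t → t < t₂ → InCore κ (P j t) → ¬ InCore κ (P j (t + 1)) → AtPort B κ σ (P j t)

/-- The macro vertex is an end of the edge or adjacent to one. -/
def NearEdge (e : DirEdge o) (w : W) : Prop :=
  ∃ τ, w = o.endOf e τ ∨ ∃ m, w = H.nbr m (o.endOf e τ)

/-- From time `T₀` to time `z`, the agents outside the set `D` of `r` agents keep away from the
edge `e`, while the agent `i` in `D` visits copies of `B` only next to the ends of `e`. In `H` all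
edges are directed from one class of a bipartition to the other. -/
structure Scene (B : TwoPort V) (L : W → Prop) (r : ℕ)
    (P : Fin k → ℕ → (Bool × GadgetVertex o V) ⊕ X) (cls : W → Bool) (D : Finset (Fin k))
    (i : Fin k) (e : DirEdge o) (T₀ z : ℕ) : Prop where
  among : AmongBarriers B L r P
  cls : ∀ w l, o.out w l = cls w
  mem : i ∈ D
  card : D.card = r
  near : ∀ t, T₀ ≤ t → t ≤ z → ∀ κ, InCore κ (P i t) → ∃ σ, o.endOf κ.2 σ = o.endOf e σ
  alone : ∀ t, T₀ ≤ t → t ≤ z → ∀ a, a ∉ D → ∀ κ σ, InCore κ (P a t) →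
    ¬ NearEdge e (o.endOf κ.2 σ)
  far : ∀ w, L w → ¬ NearEdge e w

variable {cls : W → Bool}

theorem cls_nbr (hcls : ∀ w l, o.out w l = cls w) (m : Fin 3) (w : W) :
    cls (H.nbr m w) = !cls w := by
  rw [← hcls _ m, o.flip, hcls]

theorem cls_endOf (hcls : ∀ w l, o.out w l = cls w) (e : DirEdge o) (σ : Bool) :
    cls (o.endOf e σ) = !σ := by
  have h : cls (o.endOf e false) = true := by
    rw [← hcls _ e.1.2]; exact e.2
  cases σ
  · exact h
  · rw [← Bool.not_false, ← nbr_endOf, cls_nbr hcls, h]; rfl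

theorem endOf_eq_endOf (hcls : ∀ w l, o.out w l = cls w) {e e' : DirEdge o} {σ σ' : Bool}
    (h : o.endOf e σ = o.endOf e' σ') : σ = σ' := by
  have := congrArg cls h
  rwa [cls_endOf hcls, cls_endOf hcls, Bool.not_inj_iff] at this

theorem dirEdge_ext {e e' : DirEdge o} {σ : Bool} (h : o.endOf e σ = o.endOf e' σ)
    (h' : o.endOf e (!σ) = o.endOf e' (!σ)) : e = e' := by
  rw [← nbr_endOf, ← nbr_endOf, ← h] at h'
  have hl := H.nbr_inj _ h'
  rw [← o.edgeAt_endOf e σ, ← o.edgeAt_endOf e' σ, ← h, hl]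

/-- The macro vertices at one side of an edge: the end at this side and its other neighbours. -/
def SideVertex (e : DirEdge o) (σ : Bool) (w : W) : Prop :=
  w = o.endOf e σ ∨ (∃ m, w = H.nbr m (o.endOf e σ)) ∧ w ≠ o.endOf e (!σ)

/-- The position is next to the end `σ` of the edge `e`, but not in the gadget of `e` beyond the
zone of this end. -/
def StartSide (e : DirEdge o) (σ : Bool) (z : (Bool × GadgetVertex o V) ⊕ X) : Prop :=
  InZone (o.endOf e σ) z ∨ ∃ κ, InCore κ z ∧ κ.2 ≠ e ∧ o.endOf κ.2 σ = o.endOf e σ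

/-- The position is in a copy of `B` that belongs to the edge. -/
def InEdge (e : DirEdge o) (z : (Bool × GadgetVertex o V) ⊕ X) : Prop :=
  ∃ c, InCore (c, e) z

/-- The position is in the zone of a macro vertex at the given side, or in a copy of `B`
next to such a vertex. -/
def Attached (e : DirEdge o) (σ : Bool) (z : (Bool × GadgetVertex o V) ⊕ X) : Prop :=
  (∃ w, InZone w z ∧ SideVertex e σ w) ∨
    ∃ κ τ, InCore κ z ∧ κ.2 ≠ e ∧ SideVertex e σ (o.endOf κ.2 τ)

/-- The sequence of positions started at the side `σ` of the edge `e` after time `T` and has not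
been in the copies of `B` that belong to `e` since then. -/
def OnSide (e : DirEdge o) (σ : Bool) (x : ℕ → (Bool × GadgetVertex o V) ⊕ X) (T z : ℕ) : Prop :=
  ∃ z₀, T ≤ z₀ ∧ z₀ ≤ z ∧ StartSide e σ (x z₀) ∧ ∀ t, z₀ ≤ t → t ≤ z → ¬ InEdge e (x t)

theorem StartSide.not_inEdge {e : DirEdge o} {σ : Bool} {z : (Bool × GadgetVertex o V) ⊕ X}
    (h : StartSide e σ z) : ¬ InEdge e z := by
  rintro ⟨c, hc⟩
  rcases h with h | ⟨κ, hκ, hne, -⟩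
  · exact hc.not_inZone h
  · exact hne (congrArg Prod.snd (hκ.unique hc))

theorem StartSide.not_attached (hcls : ∀ w l, o.out w l = cls w) {e : DirEdge o} {σ : Bool}
    {z : (Bool × GadgetVertex o V) ⊕ X} (h : StartSide e σ z) : ¬ Attached e (!σ) z := by
  have hside : ¬ SideVertex e (!σ) (o.endOf e σ) := by
    rintro (h | ⟨-, h⟩)
    · exact endOf_ne _ _ h.symm
    · rw [Bool.not_not] at h; exact h rfl
  rintro (⟨w, hw, hwU⟩ | ⟨κ, τ, hκ, hκe, hU⟩)
  · rcases h with h | ⟨κ, hκ, -⟩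
    · rw [h.unique hw] at hside; exact hside hwU
    · exact hκ.not_inZone hw
  · rcases h with h | ⟨κ', hκ', hne, hend⟩
    · exact hκ.not_inZone h
    · obtain rfl := hκ.unique hκ'
      by_cases hτ : τ = σ
      · rw [hτ, hend] at hU; exact hside hU
      · obtain rfl : τ = !σ := Bool.eq_not_of_ne hτ
        rcases hU with hU | ⟨⟨m, hU⟩, -⟩
        · exact hne (dirEdge_ext hend hU)
        · have := congrArg cls hU
          rw [cls_nbr hcls, cls_endOf hcls, cls_endOf hcls] at this
          simp at this

theorem SideVertex.nearEdge {e : DirEdge o} {σ : Bool} {w : W} (h : SideVertex e σ w) :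
    NearEdge e w := by
  rcases h with h | ⟨h, -⟩
  · exact ⟨σ, .inl h⟩
  · exact ⟨σ, .inr h⟩

theorem nearEdge_endOf (e : DirEdge o) (σ : Bool) : NearEdge e (o.endOf e σ) := ⟨σ, .inl rfl⟩

namespace Scene

variable {D : Finset (Fin k)} {i : Fin k} {e : DirEdge o} {T₀ z : ℕ}

theorem mono (h : Scene B L r P cls D i e T₀ z) {T₁ z₁ : ℕ} (hT : T₀ ≤ T₁) (hz : z₁ ≤ z) :
    Scene B L r P cls D i e T₁ z₁ :=
  { h with
    near := fun t h1 h2 => h.near t (hT.trans h1) (h2.trans hz)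
    alone := fun t h1 h2 => h.alone t (hT.trans h1) (h2.trans hz) }

/-- While an agent gets through a copy of `B` near the edge, all agents of `D` visit this copy,
because fewer agents would be stopped by the barrier. -/
theorem visit (h : Scene B L r P cls D i e T₀ z) {a : Fin k} {κ : Bool × DirEdge o} {σ τ : Bool}
    {s₁ s₂ : ℕ} (h1 : T₀ ≤ s₁) (h12 : s₁ ≤ s₂) (h2 : s₂ ≤ z) (ha : a ∈ D)
    (hκ : NearEdge e (o.endOf κ.2 τ)) (hin : ∀ t, s₁ ≤ t → t ≤ s₂ → InCore κ (P a t))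
    (hp : AtPort B κ σ (P a s₁)) (hq : AtPort B κ (!σ) (P a s₂)) {b : Fin k} (hb : b ∈ D) :
    ∃ t, s₁ ≤ t ∧ t ≤ s₂ ∧ InCore κ (P b t) := by
  by_contra hno
  push Not at hno
  have hab : a ≠ b := by
    rintro rfl
    exact hno s₁ le_rfl h12 (hin s₁ le_rfl h12)
  refine h.among.noTraversal κ (D.erase b) ?_ a (Finset.mem_erase.2 ⟨hab, ha⟩) σ s₁ s₂ h12 ?_ hin
    hp hq
  · rw [← h.card]; exact Finset.card_erase_lt_of_mem hb
  · intro t h3 h4 j hj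
    refine Finset.mem_erase.2 ⟨?_, ?_⟩
    · rintro rfl; exact hno t h3 h4 hj
    · by_contra hjD
      exact h.alone t (h1.trans h3) (h4.trans h2) j hjD κ τ hj hκ

/-- An agent that starts at one side of the edge remains at this side until it enters the copies
of `B` that belong to the edge. -/
theorem attached (h : Scene B L r P cls D i e T₀ z) {a : Fin k} (ha : a ∈ D) {σ : Bool}
    {z₀ z₁ : ℕ} (h0 : T₀ ≤ z₀) (h01 : z₀ ≤ z₁) (h1 : z₁ ≤ z) (hs : StartSide e σ (P a z₀))
    (hout : ∀ t, z₀ ≤ t → t ≤ z₁ → ¬ InEdge e (P a t)) : Attached e σ (P a z₁) := by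
  have key := (h.among.moves a).zone_invariant (U := SideVertex e σ) (t₀ := z₀) (t₁ := z₁)
    (fun w hw hU => h.far w hw hU.nearEdge) ?_ ?_ h01 le_rfl
  · rcases key with hk | ⟨κ, τ, hκ, hU⟩
    · exact .inl hk
    · refine .inr ⟨κ, τ, hκ, ?_, hU⟩
      intro he
      exact hout z₁ h01 le_rfl ⟨κ.1, by rwa [← he]⟩
  · intro κ τ s₁ s₂ h3 h4 h5 hin hp hq hU
    have hκe : κ.2 ≠ e := by
      intro he
      exact hout s₁ (by omega) (by omega) ⟨κ.1, by rw [← he]; exact hin s₁ le_rfl h4⟩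
    obtain ⟨t, h6, h7, h8⟩ := h.visit (by omega) h4 (by omega) ha hU.nearEdge hin hp hq h.mem
    obtain ⟨σ', hσ'⟩ := h.near t (by omega) (by omega) κ h8
    -- the end `τ` is `v` or a neighbour of `v`, where `v` is the end `σ` of `e`
    rcases hU with hU | ⟨⟨m, hU⟩, hne⟩
    · obtain rfl := endOf_eq_endOf h.cls hU
      refine .inr ⟨⟨κ.2.1.2, ?_⟩, fun he => hκe (dirEdge_ext hU he)⟩
      rw [← hU, nbr_endOf]
    · have hτ : τ = !σ := by
        have := congrArg cls hU
        rw [cls_nbr h.cls, cls_endOf h.cls, cls_endOf h.cls] at this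
        simpa using this
      subst hτ
      by_cases hσ : σ' = σ
      · subst hσ; left; rwa [Bool.not_not]
      · obtain rfl : σ' = !σ := Bool.eq_not_of_ne hσ
        exact absurd hσ' hne
  · rcases hs with hs | ⟨κ, hκ, hne, hend⟩
    · exact .inl ⟨_, hs, .inl rfl⟩
    · refine .inr ⟨κ, hκ, fun τ => ?_⟩
      by_cases hτ : τ = σ
      · rw [hτ]; exact .inl hend
      · obtain rfl : τ = !σ := Bool.eq_not_of_ne hτ
        refine .inr ⟨⟨κ.2.1.2, ?_⟩, fun he => hne (dirEdge_ext hend he)⟩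
        rw [← hend, nbr_endOf]

theorem attached_of_onSide (h : Scene B L r P cls D i e T₀ z) {a : Fin k} (ha : a ∈ D) {σ : Bool}
    (hs : OnSide e σ (P a) T₀ z) : Attached e σ (P a z) := by
  obtain ⟨z₀, h0, h1, h2, h3⟩ := hs
  exact h.attached ha h0 h1 le_rfl h2 h3

/-- Leaving the copies of `B` that belong to `e` leads to one of the sides. -/
theorem exit (h : Scene B L r P cls D i e T₀ z) {a : Fin k} {t : ℕ} (hin : InEdge e (P a t))
    (hout : ¬ InEdge e (P a (t + 1))) : ∃ σ, InZone (o.endOf e σ) (P a (t + 1)) := by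
  obtain ⟨c, hc⟩ := hin
  rcases (h.among.moves a).of_inCore hc with h1 | ⟨σ, -, h1⟩
  · exact absurd ⟨c, h1⟩ hout
  · exact ⟨σ, h1⟩

theorem exists_onSide_of_inEdge (h : Scene B L r P cls D i e T₀ z) {a : Fin k} {T : ℕ}
    (hT0 : T₀ ≤ T) (hTz : T ≤ z) (hT : InEdge e (P a T)) (hz : ¬ InEdge e (P a z)) :
    ∃ σ, OnSide e σ (P a) T₀ z := by
  -- `m` is the last moment inside
  classical
  have hex : ∃ n, n ≤ z ∧ InEdge e (P a (z - n)) := ⟨z - T, by omega, by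
    rwa [show z - (z - T) = T by omega]⟩
  obtain ⟨h1, h2⟩ := Nat.find_spec hex
  have h3 := fun n hn => Nat.find_min (H := hex) (m := n) hn
  set n := Nat.find hex
  have hn0 : n ≠ 0 := by
    rintro h0; rw [h0] at h2; exact hz h2
  have hnT : n ≤ z - T := Nat.find_min' hex ⟨by omega, by
    rwa [show z - (z - T) = T by omega]⟩
  have hout : ∀ t, z - n < t → t ≤ z → ¬ InEdge e (P a t) := by
    intro t h4 h5 h6
    exact h3 (z - t) (by omega) ⟨by omega, by rwa [show z - (z - t) = t by omega]⟩
  obtain ⟨σ, hσ⟩ := h.exit h2 (hout _ (by omega) (by omega))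
  exact ⟨σ, z - n + 1, by omega, by omega, .inl hσ, fun t h4 h5 => hout t (by omega) h5⟩

theorem exists_onSide (h : Scene B L r P cls D i e T₀ z) {a : Fin k} {T : ℕ} {ν : Bool}
    (hT0 : T₀ ≤ T) (hTz : T ≤ z) (hT : StartSide e ν (P a T)) (hz : ¬ InEdge e (P a z)) :
    ∃ σ, OnSide e σ (P a) T₀ z := by
  by_cases hout : ∀ t, T ≤ t → t ≤ z → ¬ InEdge e (P a t)
  · exact ⟨ν, T, hT0, hTz, hT, hout⟩
  · push Not at hout
    obtain ⟨t, h1, h2, h3⟩ := hout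
    exact h.exists_onSide_of_inEdge (hT0.trans h1) h2 h3 hz

/-- If an agent `b` started at the side `μ` and ended at the other side, where it has not left
the edge via `μ`, another agent `b'` that never left via the other side cannot be at
the side `μ`: otherwise all agents of `D` have visited the copy through which `b` came, and they
have split up there. -/
theorem no_split (h : Scene B L r P cls D i e T₀ z) {b b' : Fin k} (hb : b ∈ D) (hb' : b' ∈ D)
    {μ : Bool} {τ : ℕ} (hτ0 : T₀ ≤ τ) (hτz : τ ≤ z) (hs : StartSide e μ (P b τ))
    (hbz : OnSide e (!μ) (P b) T₀ z) (hbz' : OnSide e μ (P b') T₀ z)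
    (hexit : ∀ c t, τ ≤ t → t < z → InCore (c, e) (P b t) → ¬ InZone (o.endOf e μ) (P b (t + 1)))
    (hexit' : ∀ c t, τ ≤ t → t < z → InCore (c, e) (P b' t) →
      ¬ InZone (o.endOf e (!μ)) (P b' (t + 1))) : False := by
  obtain ⟨z₀, h0, h1, h2, h3⟩ := hbz
  obtain ⟨z₁, h0', h1', h2', h3'⟩ := hbz'
  -- the first entry of `b` after time `τ`
  have hex : ∃ n, InEdge e (P b (τ + n)) ∧ τ + n ≤ z := by
    by_contra hno
    push Not at hno
    have hout : ∀ t, τ ≤ t → t ≤ z → ¬ InEdge e (P b t) := fun t h4 h5 h6 =>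
      (hno (t - τ) (by rwa [Nat.add_sub_cancel' h4])).not_ge (by omega)
    rcases Nat.le_total τ z₀ with h4 | h4
    · exact h2.not_attached h.cls (by
        rw [Bool.not_not]
        exact h.attached hb hτ0 h4 h1 hs fun t h5 h6 => hout t h5 (h6.trans h1))
    · exact hs.not_attached h.cls
        (h.attached hb h0 h4 hτz h2 fun t h5 h6 => h3 t h5 (h6.trans hτz))
  classical
  obtain ⟨hn1, hn2⟩ := Nat.find_spec hex
  have hmin := fun n hn => Nat.find_min (H := hex) (m := n) hn
  set n := Nat.find hex
  have hn0 : n ≠ 0 := by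
    intro h0
    rw [h0] at hn1
    exact hs.not_inEdge hn1
  have hout : ∀ t, τ ≤ t → t ≤ τ + n - 1 → ¬ InEdge e (P b t) := by
    intro t h4 h5 h6
    exact hmin (t - τ) (by omega) ⟨by rwa [Nat.add_sub_cancel' h4], by omega⟩
  obtain ⟨c, hc⟩ := hn1
  obtain ⟨u, hu⟩ : ∃ u, τ + n = u + 1 := ⟨τ + n - 1, by omega⟩
  rw [hu] at hc hn2
  have hu' : ¬ InEdge e (P b u) := hout u (by omega) (by omega)
  obtain ⟨σ, hp, hzone⟩ := (h.among.moves b).entry (κ := (c, e)) (fun h4 => hu' ⟨c, h4⟩) hc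
  have hσ : σ = μ := by
    by_contra hσ
    obtain rfl : σ = !μ := Bool.eq_not_of_ne hσ
    have hs' : StartSide e (!μ) (P b u) := .inl hzone
    exact hs'.not_attached h.cls (by
      rw [Bool.not_not]
      exact h.attached hb hτ0 (by omega) (by omega) hs fun t h4 h5 => hout t h4 (by omega))
  subst hσ
  have hbz : ¬ InEdge e (P b z) := h3 z h1 le_rfl
  have hbz' : ¬ InEdge e (P b' z) := h3' z h1' le_rfl
  -- the exit after this entry
  have hex2 : ∃ m, ¬ InCore (c, e) (P b (u + 1 + m)) ∧ u + 1 + m ≤ z :=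
    ⟨z - (u + 1), by rw [Nat.add_sub_cancel' hn2]; exact ⟨fun h4 => hbz ⟨c, h4⟩, le_rfl⟩⟩
  obtain ⟨hm1, hm2⟩ := Nat.find_spec hex2
  have hmin2 := fun n hn => Nat.find_min (H := hex2) (m := n) hn
  set m := Nat.find hex2
  have hm0 : m ≠ 0 := by
    intro h0
    rw [h0] at hm1
    exact hm1 hc
  obtain ⟨f, hf⟩ : ∃ f, u + 1 + m = f + 1 := ⟨u + m, by omega⟩
  rw [hf] at hm1 hm2
  have hin : ∀ t, u + 1 ≤ t → t ≤ f → InCore (c, e) (P b t) := by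
    intro t h4 h5
    by_contra h6
    exact hmin2 (t - (u + 1)) (by omega) ⟨by rwa [Nat.add_sub_cancel' h4], by omega⟩
  have port : ∀ t, τ ≤ t → t < z → InCore (c, e) (P b t) → ¬ InCore (c, e) (P b (t + 1)) →
      AtPort B (c, e) (!σ) (P b t) := by
    intro t h4 h5 h6 h7
    rcases (h.among.moves b).of_inCore h6 with h8 | ⟨σ', h8, h9⟩
    · exact absurd h8 h7
    · by_cases hσ' : σ' = σ
      · subst hσ'; exact absurd h9 (hexit c t h4 h5 h6)
      · rwa [← Bool.eq_not_of_ne hσ']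
  have port' : ∀ t, τ ≤ t → t < z → InCore (c, e) (P b' t) → ¬ InCore (c, e) (P b' (t + 1)) →
      AtPort B (c, e) σ (P b' t) := by
    intro t h4 h5 h6 h7
    rcases (h.among.moves b').of_inCore h6 with h8 | ⟨σ', h8, h9⟩
    · exact absurd h8 h7
    · by_cases hσ' : σ' = σ
      · rwa [← hσ']
      · rw [Bool.eq_not_of_ne hσ'] at h9
        exact absurd h9 (hexit' c t h4 h5 h6)
  have hvisit : ∀ a ∈ D, ∃ t, u + 1 ≤ t ∧ t ≤ z ∧ InCore (c, e) (P a t) := by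
    intro a ha
    obtain ⟨t, h4, h5, h6⟩ := h.visit (κ := (c, e)) (τ := σ) (by omega) (by omega) (by omega) hb
      (nearEdge_endOf e σ) hin hp (port f (by omega) (by omega) (hin f (by omega) le_rfl) hm1) ha
    exact ⟨t, h4, by omega, h6⟩
  refine h.among.noSplit (c, e) D h.card b hb b' hb' σ (u + 1) z hn2 ?_ hvisit hp
    (fun h4 => hbz ⟨c, h4⟩) (fun h4 => hbz' ⟨c, h4⟩) (fun t h4 h5 => port t (by omega) h5)
    (fun t h4 h5 => port' t (by omega) h5)
  intro t h4 h5 j hj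
  by_contra hjD
  exact h.alone t (by omega) h5 j hjD (c, e) σ hj (nearEdge_endOf e σ)

/-- If an agent `j` of `D` has changed from the side `ν` to the other side, no agent of `D` is at
the side `ν`. -/
theorem not_onSide (h : Scene B L r P cls D i e T₀ z) {j a : Fin k} (hj : j ∈ D) (ha : a ∈ D)
    {ν : Bool} {T : ℕ} (hT0 : T₀ ≤ T) (hTz : T ≤ z) (hs : StartSide e ν (P j T))
    (hjz : OnSide e (!ν) (P j) T₀ z) : ¬ OnSide e ν (P a) T₀ z := by
  intro haz
  -- consider the last time `m` at which `j` leaves the edge via `ν` or `a` leaves it via `!ν`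
  let bad : ℕ → Prop := fun t => T ≤ t ∧ t < z ∧
    ((∃ c, InCore (c, e) (P j t) ∧ InZone (o.endOf e ν) (P j (t + 1))) ∨
      ∃ c, InCore (c, e) (P a t) ∧ InZone (o.endOf e (!ν)) (P a (t + 1)))
  by_cases hbad : ∃ t, bad t
  · obtain ⟨m, ⟨h1, h2, h3⟩, h4⟩ : ∃ m, bad m ∧ ∀ t, bad t → t ≤ m := by
      classical
      have hne : ((Finset.range z).filter bad).Nonempty := by
        obtain ⟨t, ht⟩ := hbad
        exact ⟨t, Finset.mem_filter.2 ⟨Finset.mem_range.2 ht.2.1, ht⟩⟩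
      refine ⟨_, (Finset.mem_filter.1 (Finset.max'_mem _ hne)).2, fun t ht => ?_⟩
      exact Finset.le_max' _ _ (Finset.mem_filter.2 ⟨Finset.mem_range.2 ht.2.1, ht⟩)
    have hj' : ∀ c t, m + 1 ≤ t → t < z → InCore (c, e) (P j t) →
        ¬ InZone (o.endOf e ν) (P j (t + 1)) := fun c t h5 h6 h7 h8 => by
      have := h4 t ⟨by omega, h6, .inl ⟨c, h7, h8⟩⟩
      omega
    have ha' : ∀ c t, m + 1 ≤ t → t < z → InCore (c, e) (P a t) →
        ¬ InZone (o.endOf e (!ν)) (P a (t + 1)) := fun c t h5 h6 h7 h8 => by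
      have := h4 t ⟨by omega, h6, .inr ⟨c, h7, h8⟩⟩
      omega
    rcases h3 with ⟨c, -, h5⟩ | ⟨c, -, h5⟩
    · exact h.no_split hj ha (by omega) (by omega) (.inl h5) hjz haz hj' ha'
    · exact h.no_split ha hj (by omega) (by omega) (.inl h5) (by rwa [Bool.not_not]) hjz ha'
        (by rwa [Bool.not_not])
  · exact h.no_split hj ha hT0 hTz hs hjz haz
      (fun c t h1 h2 h3 h4 => hbad ⟨t, h1, h2, .inl ⟨c, h3, h4⟩⟩)
      (fun c t h1 h2 h3 h4 => hbad ⟨t, h1, h2, .inr ⟨c, h3, h4⟩⟩)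

/-- If all agents of `D` have started at the same side of the edge and one is at the side `σ`,
then all others that are not in the copies of `B` are at this side. -/
theorem onSide_of_onSide (h : Scene B L r P cls D i e T₀ z) {ν : Bool} {T : Fin k → ℕ}
    (hT : ∀ a ∈ D, T₀ ≤ T a ∧ T a ≤ z ∧ StartSide e ν (P a (T a))) {a b : Fin k} (ha : a ∈ D)
    (hb : b ∈ D) {σ : Bool} (hbz : OnSide e σ (P b) T₀ z) (haz : ¬ InEdge e (P a z)) :
    OnSide e σ (P a) T₀ z := by
  obtain ⟨h1, h2, h3⟩ := hT a ha
  obtain ⟨h1', h2', h3'⟩ := hT b hb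
  obtain ⟨σ', hσ'⟩ := h.exists_onSide h1 h2 h3 haz
  by_cases hσ : σ' = σ
  · rwa [← hσ]
  · obtain rfl : σ' = !σ := Bool.eq_not_of_ne hσ
    by_cases hν : ν = σ
    · subst hν
      exact absurd hbz (h.not_onSide ha hb h1 h2 h3 hσ')
    · obtain rfl : ν = !σ := Bool.eq_not_of_ne hν
      exact absurd hσ' (h.not_onSide hb ha h1' h2' h3' (by rwa [Bool.not_not]))

end Scene

end Scene

/-! ### Runs around a macro vertex -/

section Star

variable {V W X : Type} {H : CubicGraph W} {o : Direction H} {B : TwoPort V}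

open Classical in
/-- A step from a location relative to a macro vertex at which all edges point outwards (`β = true`)
or inwards (`β = false`). It leads to another such location or to the next macro vertex along the
edge with the given label, in one of the two copies. -/
noncomputable def starNbr (B : TwoPort V) (β : Bool) (m : Fin 3) :
    Bool × StarPos V → (Bool × StarPos V) ⊕ (Bool × Fin 3)
  | (c, .centre) => .inl (c, .hub false m)
  | (c, .hub far l) =>
      if m = l then (if far then .inr (c, l) else .inl (c, .centre)) else .inl (c, .rim far l m)
  | (c, .rim far l x) =>
      if m = x then (if m = l then .inl (!c, .rim far l x) else .inl (c, .hub far l))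
      else if x = 0 then .inl (c, .rim far l (if m = 1 then 2 else 1))
      else if m = 0 then .inl (c, .core l (B.port (xor (!β) far, decide (x = 2))))
      else .inl (c, .rim far l 0)
  | (c, .core l b) =>
      if m = 0 then
        (match Function.partialInv B.port b with
          | some i => .inl (c, .rim (xor (!β) i.1) l (rimIdx i.2))
          | none => .inl (c, .core l (B.nbr 0 b)))
      else .inl (c, .core l (B.nbr m b))

/-- The vertex of `H(B)` at a location relative to `w` or at the next macro vertex. -/
def place (o : Direction H) (w : W) :
    (Bool × StarPos V) ⊕ (Bool × Fin 3) → Bool × GadgetVertex o V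
  | .inl a => locate o w a
  | .inr (c, l) => (c, .main (H.nbr l w))

theorem edgeAt_nbr (w : W) (l : Fin 3) : o.edgeAt (H.nbr l w) l = o.edgeAt w l := by
  have h1 := o.edgeAt_endOf (o.edgeAt w l) (!o.sideAt w l)
  rwa [endOf_edgeAt_not, o.edgeAt_label] at h1

theorem endOf_edgeAt_eq (w : W) (l : Fin 3) (side : Bool) :
    o.endOf (o.edgeAt w l) side = if xor (o.sideAt w l) side then H.nbr l w else w := by
  by_cases h : side = o.sideAt w l
  · subst h; simp [o.endOf_edgeAt]
  · obtain rfl : side = !o.sideAt w l := Bool.eq_not_of_ne h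
    rw [endOf_edgeAt_not]; simp

theorem expandNbr_locate {w : W} {β : Bool} (hβ : ∀ l, o.out w l = β) (m : Fin 3)
    (a : Bool × StarPos V) : expandNbr B o m (locate o w a) = place o w (starNbr B β m a) := by
  have hside : ∀ l, o.sideAt w l = !β := fun l => by rw [Direction.sideAt, hβ]
  have hside' : ∀ l, o.sideAt (H.nbr l w) l = β := fun l => by
    rw [Direction.sideAt, o.flip, hβ, Bool.not_not]
  obtain ⟨c, a⟩ := a
  cases a with
  | centre => simp [locate, expandNbr, starNbr, place]
  | hub far l => by_cases h : m = l <;> cases far <;> simp [locate, expandNbr, starNbr, place, h]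
  | rim far l x =>
    by_cases hmx : m = x
    · subst hmx
      by_cases hml : m = l <;> simp [locate, expandNbr, starNbr, place, hml]
    · by_cases hx : x = 0
      · simp only [locate, expandNbr, starNbr, place, if_neg hmx, if_pos hx]
      · by_cases hm : m = 0
        · simp only [locate, expandNbr, starNbr, place, if_neg hmx, if_neg hx, if_pos hm]
          cases far <;> simp [hside, hside', edgeAt_nbr]
        · simp only [locate, expandNbr, starNbr, place, if_neg hmx, if_neg hx, if_neg hm]
  | core l b =>
    by_cases hm : m = 0
    · subst hm
      cases hp : Function.partialInv B.port b with
      | none => simp [locate, expandNbr, starNbr, place, hp]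
      | some i =>
        simp only [locate, expandNbr, starNbr, place, if_true, hp, endOf_edgeAt_eq, hside,
          o.edgeAt_label]
    · simp [locate, expandNbr, starNbr, place, hm]

theorem edgeAt_injective (w : W) : Function.Injective (o.edgeAt w) := fun l l' h => by
  rw [← o.edgeAt_label w l, h, o.edgeAt_label]

theorem ite_nbr_inj {w : W} {far far' : Bool} {l : Fin 3}
    (h : (if far then H.nbr l w else w) = if far' then H.nbr l w else w) : far = far' := by
  have := H.nbr_ne l w
  cases far <;> cases far' <;> simp_all [eq_comm]

theorem place_injective (o : Direction H) (w : W) :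
    Function.Injective (place (V := V) o w) := by
  have hn := fun l => (H.nbr_ne l w)
  rintro (⟨c, a⟩ | ⟨c, l⟩) (⟨c', a'⟩ | ⟨c', l'⟩) h
  · cases a <;> cases a' <;>
      simp only [place, locate, Prod.mk.injEq, GadgetVertex.hub.injEq,
        GadgetVertex.rim.injEq, GadgetVertex.core.injEq, reduceCtorEq, and_false] at h
    · rw [h.1]
    · obtain ⟨rfl, h, rfl⟩ := h
      rw [ite_nbr_inj h]
    · obtain ⟨rfl, h, rfl, rfl⟩ := h
      rw [ite_nbr_inj h]
    · obtain ⟨rfl, h, rfl⟩ := h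
      rw [edgeAt_injective w h]
  · cases a <;> simp [place, locate, (hn _).symm] at h
  · cases a' <;> simp [place, locate, hn] at h
  · simp only [place, Prod.mk.injEq, GadgetVertex.main.injEq] at h
    obtain ⟨rfl, h⟩ := h
    rw [H.nbr_inj w h]

theorem locate_injective (o : Direction H) (w : W) :
    Function.Injective (locate (V := V) o w) := fun a a' h => by
  have := place_injective o w (a₁ := .inl a) (a₂ := .inl a') h
  exact Sum.inl.inj this

/-- The position is at the macro vertex `w` or in a gadget around it. -/
def InStar (w : W) (z : (Bool × GadgetVertex o V) ⊕ X) : Prop :=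
  ∃ a, z = .inl (locate o w a)

/-- The position is at the macro vertex `w`. -/
def AtMain (w : W) (z : (Bool × GadgetVertex o V) ⊕ X) : Prop :=
  ∃ c, z = .inl (c, .main w)

theorem AtMain.inZone {w : W} {z : (Bool × GadgetVertex o V) ⊕ X} (h : AtMain w z) :
    InZone w z := by
  obtain ⟨c, rfl⟩ := h; exact ⟨_, rfl, rfl⟩

theorem InZone.inStar {w : W} {z : (Bool × GadgetVertex o V) ⊕ X} (h : InZone w z) :
    InStar w z := by
  obtain ⟨⟨c, y⟩, rfl, hw⟩ := h
  cases y <;> simp only [GadgetVertex.zone, Option.some.injEq, reduceCtorEq] at hw <;> subst hw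
  · exact ⟨(c, .centre), rfl⟩
  · exact ⟨(c, .hub false _), rfl⟩
  · exact ⟨(c, .rim false _ _), rfl⟩

theorem InCore.inStar {κ : Bool × DirEdge o} {z : (Bool × GadgetVertex o V) ⊕ X}
    (h : InCore κ z) (σ : Bool) : InStar (o.endOf κ.2 σ) z := by
  obtain ⟨b, rfl⟩ := h
  exact ⟨(κ.1, .core κ.2.1.2 b), by simp [locate, o.edgeAt_endOf]⟩

theorem InStar.cases {w : W} {z : (Bool × GadgetVertex o V) ⊕ X} (h : InStar w z) :
    InZone w z ∨ (∃ l, InZone (H.nbr l w) z ∧ ¬ AtMain (H.nbr l w) z) ∨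
      ∃ l, InEdge (o.edgeAt w l) z := by
  obtain ⟨⟨c, a⟩, rfl⟩ := h
  cases a with
  | centre => exact .inl ⟨_, rfl, rfl⟩
  | hub far l =>
    cases far
    · exact .inl ⟨_, rfl, rfl⟩
    · exact .inr (.inl ⟨l, ⟨_, rfl, rfl⟩, by rintro ⟨c, h⟩; simp [locate] at h⟩)
  | rim far l x =>
    cases far
    · exact .inl ⟨_, rfl, rfl⟩
    · exact .inr (.inl ⟨l, ⟨_, rfl, rfl⟩, by rintro ⟨c, h⟩; simp [locate] at h⟩)
  | core l b => exact .inr (.inr ⟨l, c, b, rfl⟩)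

theorem inEdge_inStar {w : W} {l : Fin 3} {z : (Bool × GadgetVertex o V) ⊕ X}
    (h : InEdge (o.edgeAt w l) z) : InStar w z := by
  obtain ⟨c, h⟩ := h
  have := h.inStar (o.sideAt w l)
  rwa [o.endOf_edgeAt] at this

/-- The change of a location when the centre moves along the edge labelled `l`, for the locations
in the gadget of this edge. -/
def recentre (l : Fin 3) : (Bool × StarPos V) ⊕ (Bool × Fin 3) → Option (Bool × StarPos V)
  | .inl (_, .centre) => none
  | .inl (c, .hub far l') => if l' = l then some (c, .hub (!far) l) else none
  | .inl (c, .rim far l' x) => if l' = l then some (c, .rim (!far) l x) else none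
  | .inl (c, .core l' b) => if l' = l then some (c, .core l b) else none
  | .inr (c, l') => if l' = l then some (c, .centre) else none

theorem ite_not_nbr (w : W) (l : Fin 3) (far : Bool) :
    (if !far then H.nbr l (H.nbr l w) else H.nbr l w) = if far then H.nbr l w else w := by
  cases far <;> simp [H.nbr_nbr]

theorem locate_recentre {w : W} {l : Fin 3} {x : (Bool × StarPos V) ⊕ (Bool × Fin 3)}
    {a : Bool × StarPos V} (h : recentre l x = some a) :
    place o w x = locate o (H.nbr l w) a := by
  rcases x with ⟨c, x⟩ | ⟨c, l'⟩
  · cases x with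
    | centre => simp [recentre] at h
    | hub far l' =>
      simp only [recentre, Option.ite_none_right_eq_some, Option.some.injEq] at h
      obtain ⟨rfl, rfl⟩ := h
      simp only [place, locate, ite_not_nbr]
    | rim far l' x =>
      simp only [recentre, Option.ite_none_right_eq_some, Option.some.injEq] at h
      obtain ⟨rfl, rfl⟩ := h
      simp only [place, locate, ite_not_nbr]
    | core l' b =>
      simp only [recentre, Option.ite_none_right_eq_some, Option.some.injEq] at h
      obtain ⟨rfl, rfl⟩ := h
      simp only [place, locate, edgeAt_nbr]
  · simp only [recentre, Option.ite_none_right_eq_some, Option.some.injEq] at h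
    obtain ⟨rfl, rfl⟩ := h
    rfl

theorem exists_recentre {w : W} {l : Fin 3} {x : (Bool × StarPos V) ⊕ (Bool × Fin 3)}
    (h : InZone (X := X) (H.nbr l w) (.inl (place o w x)) ∨
      InEdge (X := X) (o.edgeAt w l) (.inl (place o w x))) : ∃ a, recentre l x = some a := by
  have hn := H.nbr_ne l w
  have far_eq : ∀ (far : Bool) (l' : Fin 3), (if far then H.nbr l' w else w) = H.nbr l w →
      l' = l := by
    intro far l' he
    cases far
    · exact absurd he.symm hn
    · exact H.nbr_inj w he
  rcases h with ⟨y, hy, hz⟩ | ⟨c', b', hy⟩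
  · rw [Sum.inl.injEq] at hy
    subst hy
    rcases x with ⟨c, x⟩ | ⟨c, l'⟩
    · cases x with
      | centre => exact absurd (Option.some.inj hz).symm hn
      | hub far l' =>
        obtain rfl := far_eq far l' (Option.some.inj hz)
        simp [recentre]
      | rim far l' x =>
        obtain rfl := far_eq far l' (Option.some.inj hz)
        simp [recentre]
      | core l' b => cases hz
    · obtain rfl := far_eq true l' (Option.some.inj hz)
      simp [recentre]
  · rw [Sum.inl.injEq] at hy
    rcases x with ⟨c, x⟩ | ⟨c, l'⟩
    · cases x with
      | core l' b =>
        simp only [place, locate, Prod.mk.injEq, GadgetVertex.core.injEq] at hy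
        obtain rfl := edgeAt_injective w hy.2.1
        simp [recentre]
      | _ => simp [place, locate] at hy
    · simp [place] at hy

end Star

namespace Moves

variable {V W X : Type} {H : CubicGraph W} {o : Direction H} {B : TwoPort V}
  {L : W → Prop} {x : ℕ → (Bool × GadgetVertex o V) ⊕ X} {w : W} {β : Bool}

theorem zone_locate (w : W) (a : Bool × StarPos V) {w' : W}
    (h : (locate o w a).2.zone = some w') : w' = w ∨ ∃ l, w' = H.nbr l w := by
  obtain ⟨c, a⟩ := a
  cases a with
  | centre => exact .inl (Option.some.inj h).symm
  | hub far l =>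
    cases far
    · exact .inl (Option.some.inj h).symm
    · exact .inr ⟨l, (Option.some.inj h).symm⟩
  | rim far l x =>
    cases far
    · exact .inl (Option.some.inj h).symm
    · exact .inr ⟨l, (Option.some.inj h).symm⟩
  | core l b => cases h

theorem inside_of_inStar (hx : Moves B o L x) (hw : ¬ L w) (hn : ∀ l, ¬ L (H.nbr l w)) {t : ℕ}
    (h : InStar w (x t)) : ∃ y, x (t + 1) = .inl y := by
  obtain ⟨a, ha⟩ := h
  rcases hx.inl t _ ha with h1 | ⟨m, h1⟩ | ⟨⟨w', hw', hL⟩, -⟩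
  · exact ⟨_, h1⟩
  · exact ⟨_, h1⟩
  · rcases zone_locate w a hw' with rfl | ⟨l, rfl⟩
    · exact absurd hL hw
    · exact absurd hL (hn l)

/-- The gadgets around a macro vertex are left via the next macro vertices. -/
theorem of_inStar (hx : Moves B o L x) (hβ : ∀ l, o.out w l = β) {t : ℕ} (h : InStar w (x t))
    (h' : ∃ y, x (t + 1) = .inl y) :
    InStar w (x (t + 1)) ∨ ∃ l, AtMain (H.nbr l w) (x (t + 1)) := by
  obtain ⟨a, ha⟩ := h
  obtain ⟨y, hy⟩ := h'
  rcases hx.inl t _ ha with h1 | ⟨m, h1⟩ | ⟨-, z, h1⟩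
  · exact .inl ⟨a, h1⟩
  · rw [expandNbr_locate hβ] at h1
    rcases h2 : starNbr B β m a with a' | ⟨c, l⟩ <;> rw [h2] at h1
    · exact .inl ⟨a', h1⟩
    · exact .inr ⟨l, c, h1⟩
  · rw [h1] at hy; cases hy

/-- The gadgets around a macro vertex are entered via the next macro vertices. -/
theorem inStar_pred (hx : Moves B o L x) (hβ : ∀ l, o.out w l = β) {t : ℕ}
    (h : InStar w (x (t + 1))) (h' : ∃ y, x t = .inl y) :
    InStar w (x t) ∨ ∃ l, AtMain (H.nbr l w) (x t) := by
  obtain ⟨a, ha⟩ := h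
  obtain ⟨y, hy⟩ := h'
  rw [hy]
  rcases hx.inl t y hy with h1 | ⟨m, h1⟩ | ⟨-, z, h1⟩
  · left; exact ⟨a, by rw [← ha, h1]⟩
  · rw [ha, Sum.inl.injEq] at h1
    have h2 := expandNbr_locate (B := B) hβ m a
    rw [h1, expandNbr_expandNbr] at h2
    subst h2
    rcases h2 : starNbr B β m a with a' | ⟨c, l⟩
    · exact .inl ⟨a', rfl⟩
    · exact .inr ⟨l, c, rfl⟩
  · rw [ha] at h1; cases h1

end Moves

section Local

variable {k s : ℕ} (A : Agents k s) {V : Type} (B : TwoPort V) {D : Finset (Fin k)} (β : Bool)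

open Classical in
/-- The action of an agent of `D` when the agents of `D` are alone around a macro vertex. -/
noncomputable def localAction (c : Config s D V) (i : D) : Fin s × Option (Fin 3) :=
  A.trans i (c i).1 (fun j => if h : ∃ hj : j.1 ∈ D, (c ⟨j.1, hj⟩).2.2 = (c i).2.2 then
    some (c ⟨j.1, h.1⟩).1 else none) (c i).2.1

/-- The entry label after a step. -/
noncomputable def localEntry (c : Config s D V) (i : D) : Option (Fin 3) :=
  match (localAction A c i).2 with
  | some m => some m
  | none => (c i).2.1

/-- The location after a step, possibly at the next macro vertex. -/
noncomputable def localPos (c : Config s D V) (i : D) : (Bool × StarPos V) ⊕ (Bool × Fin 3) :=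
  match (localAction A c i).2 with
  | some m => starNbr B β m (c i).2.2
  | none => .inl (c i).2.2

/-- A step from one configuration to another one with respect to the same macro vertex. -/
def LocalNext (c c' : Config s D V) : Prop :=
  ∀ i, localPos A B β c i = .inl (c' i).2.2 ∧ (c' i).1 = (localAction A c i).1 ∧
    (c' i).2.1 = localEntry A c i

/-- A step in which an agent arrives at the next macro vertex along the edge labelled `l`; the new
configuration is with respect to this vertex. -/
def LocalArrival (c : Config s D V) (l : Fin 3) (c' : Config s D V) : Prop :=
  (∃ i b, localPos A B β c i = .inr (b, l)) ∧
    ∀ i, recentre l (localPos A B β c i) = some (c' i).2.2 ∧ (c' i).1 = (localAction A c i).1 ∧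
      (c' i).2.1 = localEntry A c i

/-- The agents of `D`, alone around a macro vertex in configuration `c`, arrive next at the macro
vertex at the other end of the edge labelled `l`, in configuration `c'`. -/
def MacroNext (c : Config s D V) (l : Fin 3) (c' : Config s D V) : Prop :=
  ∃ c₁, Relation.ReflTransGen (LocalNext A B β) c c₁ ∧ LocalArrival A B β c₁ l c'

variable {A B β}

theorem LocalNext.rightUnique : Relator.RightUnique (LocalNext A B β (D := D)) := by
  intro c c₁ c₂ h₁ h₂
  funext i
  obtain ⟨h1, h2, h3⟩ := h₁ i
  obtain ⟨h1', h2', h3'⟩ := h₂ i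
  exact Prod.ext (h2.trans h2'.symm)
    (Prod.ext (h3.trans h3'.symm) (Sum.inl.inj (h1.symm.trans h1')))

theorem LocalArrival.not_next {c c' c'' : Config s D V} {l : Fin 3}
    (h : LocalArrival A B β c l c') : ¬ LocalNext A B β c c'' := by
  obtain ⟨⟨i, b, hi⟩, -⟩ := h
  intro h
  have := (h i).1
  rw [hi] at this
  cases this

/-- The next arrival depends on the configuration and the direction of the edges only. -/
theorem MacroNext.unique {c c₁ c₂ : Config s D V} {l₁ l₂ : Fin 3}
    (h₁ : MacroNext A B β c l₁ c₁) (h₂ : MacroNext A B β c l₂ c₂) : l₁ = l₂ ∧ c₁ = c₂ := by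
  obtain ⟨d₁, hd₁, ha₁⟩ := h₁
  obtain ⟨d₂, hd₂, ha₂⟩ := h₂
  have hd : d₁ = d₂ := by
    rcases Relation.ReflTransGen.total_of_right_unique LocalNext.rightUnique hd₁ hd₂ with h | h
    · rcases h.cases_head with h | ⟨d, h, -⟩
      · exact h
      · exact absurd h ha₁.not_next
    · rcases h.cases_head with h | ⟨d, h, -⟩
      · exact h.symm
      · exact absurd h ha₂.not_next
  subst hd
  have hl : l₁ = l₂ := by
    obtain ⟨i, b, hi⟩ := ha₁.1
    have := (ha₂.2 i).1
    rw [hi] at this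
    simp only [recentre, Option.ite_none_right_eq_some] at this
    exact this.1
  subst hl
  refine ⟨rfl, funext fun i => ?_⟩
  obtain ⟨h1, h2, h3⟩ := ha₁.2 i
  obtain ⟨h1', h2', h3'⟩ := ha₂.2 i
  exact Prod.ext (h2.trans h2'.symm)
    (Prod.ext (h3.trans h3'.symm) (Option.some.inj (h1.symm.trans h1')))

end Local

section Walker

variable {k s : ℕ} (A : Agents k s) {V : Type} (B : TwoPort V) (D : Finset (Fin k))

open Classical in
/-- The walker in `H` that follows the agents of `D` from one macro vertex to the next one, as long
as they are alone. Its states are the configurations upon arrival together with the direction of the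
edges at the current macro vertex. -/
noncomputable def groupWalker : Walker ({c // c ∈ macroConfigs A B D} × Bool) where
  next q := (if h : ∃ l, ∃ c' : {c // c ∈ macroConfigs A B D}, MacroNext A B q.2 q.1.1 l c'.1 then
    h.choose_spec.choose else q.1, !q.2)
  label q := if h : ∃ l, ∃ c' : {c // c ∈ macroConfigs A B D}, MacroNext A B q.2 q.1.1 l c'.1 then
    h.choose else 0
  cls q := q.2
  cls_next _ := rfl

variable {A B D}

theorem groupWalker_eq {q : {c // c ∈ macroConfigs A B D} × Bool} {l : Fin 3}
    {c' : {c // c ∈ macroConfigs A B D}} (h : MacroNext A B q.2 q.1.1 l c'.1) :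
    (groupWalker A B D).label q = l ∧ (groupWalker A B D).next q = (c', !q.2) := by
  have hex : ∃ l, ∃ c' : {c // c ∈ macroConfigs A B D}, MacroNext A B q.2 q.1.1 l c'.1 := ⟨l, c', h⟩
  have h1 := hex.choose_spec.choose_spec.unique h
  constructor
  · simp only [groupWalker, dif_pos hex]; exact h1.1
  · simp only [groupWalker, dif_pos hex, Prod.mk.injEq, and_true]; exact Subtype.ext h1.2

instance [Finite V] : Finite (StarPos V) := by
  let f : StarPos V → Unit ⊕ (Bool × Fin 3) ⊕ (Bool × Fin 3 × Fin 3) ⊕ (Fin 3 × V)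
    | .centre => .inl ()
    | .hub far l => .inr (.inl (far, l))
    | .rim far l x => .inr (.inr (.inl (far, l, x)))
    | .core l b => .inr (.inr (.inr (l, b)))
  refine Finite.of_injective f fun a a' h => ?_
  cases a <;> cases a' <;> simp_all [f]

theorem card_groupWalker_le [Finite V] {r : ℕ} (hD : D.card = r) :
    Nat.card ({c // c ∈ macroConfigs A B D} × Bool) ≤ 2 * alpha A r B := by
  have h : (macroConfigs A B D).ncard ≤ alpha A r B :=
    Finset.le_sup (f := fun S : Finset (Fin k) => (macroConfigs A B S).ncard)
      (Finset.mem_powersetCard.2 ⟨Finset.subset_univ _, hD⟩)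
  rw [Nat.card_prod, Nat.card_eq_fintype_card (α := Bool), Fintype.card_bool]
  change Nat.card ↥(macroConfigs A B D) * 2 ≤ _
  rw [Nat.card_coe_set_eq]
  omega

theorem one_le_alpha [Finite V] {r : ℕ} (hr : r ≤ k) : 1 ≤ alpha A r B := by
  obtain ⟨D, hD⟩ := Finset.exists_subset_card_eq (s := (Finset.univ : Finset (Fin k))) (n := r)
    (by simpa using hr)
  have h : (macroConfigs A B D).ncard ≤ alpha A r B :=
    Finset.le_sup (f := fun S : Finset (Fin k) => (macroConfigs A B S).ncard)
      (Finset.mem_powersetCard.2 ⟨Finset.subset_univ _, hD.2⟩)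
  refine le_trans ?_ h
  rw [Nat.one_le_iff_ne_zero, ← Nat.pos_iff_ne_zero, Set.ncard_pos (Set.toFinite _)]
  exact ⟨fun i => (A.start i, none, (false, .centre)), .inl fun _ => rfl⟩

end Walker

section MacroStep

variable {k s : ℕ} {A : Agents k s} {V W X : Type} {H : CubicGraph W} {o : Direction H}
  {B : TwoPort V} {D : Finset (Fin k)} {β : Bool} {p q : W} {hpq : p ≠ q} {G : CubicGraph X}
  {g : Slot G} {w : W}

theorem action_eq_localAction {σ : Snapshot k s ((Bool × GadgetVertex o V) ⊕ X)}
    {c : Config s D V} (hc : HasConfig σ w D c) (ha : AloneAt σ D w) (i : D) :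
    A.action σ i = localAction A c i := by
  obtain ⟨h1, h2, h3⟩ := hc i
  unfold Agents.action localAction
  rw [h1, h2]
  congr 1
  funext j
  by_cases hj : j.1 ∈ D
  · obtain ⟨h1', h2', h3'⟩ := hc ⟨j.1, hj⟩
    simp only at h1' h3'
    by_cases he : (c ⟨j.1, hj⟩).2.2 = (c i).2.2
    · rw [if_pos (by rw [h3, h3', he]), dif_pos ⟨hj, he⟩, h1']
    · rw [if_neg, dif_neg]
      · exact fun h => he h.2
      · rw [h3, h3']
        exact fun h => he (locate_injective o w (Sum.inl.inj h))
  · rw [if_neg, dif_neg]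
    · rintro ⟨h, -⟩; exact hj h
    · rw [h3]; exact ha _ hj _

theorem step_pos_eq {σ : Snapshot k s ((Bool × GadgetVertex o V) ⊕ X)}
    {c : Config s D V} (hc : HasConfig σ w D c) (ha : AloneAt σ D w) (hβ : ∀ l, o.out w l = β)
    (hw : ∀ w', w' = p ∨ w' = q → w' ≠ w ∧ ∀ l, w' ≠ H.nbr l w)
    (hh : ¬ ∀ i, σ.state i ∈ A.halting i) (i : D) :
    let σ' := A.step (join (expandTwoPort B o p q hpq) G g) σ
    σ'.state i = (localAction A c i).1 ∧ σ'.entry i = localEntry A c i ∧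
      σ'.pos i = .inl (place o w (localPos A B β c i)) := by
  obtain ⟨h1, h2, h3⟩ := hc i
  have hact := action_eq_localAction (A := A) hc ha i
  simp only [Agents.step, if_neg hh, hact, localEntry, localPos]
  refine ⟨trivial, ?_, ?_⟩
  · cases (localAction A c i).2 with
    | none => exact h2
    | some m => rfl
  · cases (localAction A c i).2 with
    | none => exact h3
    | some m =>
      simp only
      rw [h3, join_nbr_inl, expandNbr_locate hβ]
      rintro ⟨-, -, w', hw', h4⟩
      have hz : (locate o w (c i).2.2).2.zone = some w' := by
        rcases h4 with h4 | h4 <;> rw [h4] <;> rfl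
      rcases Moves.zone_locate w _ hz with h5 | ⟨l, h5⟩
      · exact (hw w' hw').1 h5
      · exact (hw w' hw').2 l h5

/-- While the agents of `D` are alone around `w`, their configurations are determined by the
first one, until an agent arrives at the next macro vertex. -/
theorem macroNext_of_run {pos₀ : Fin k → (Bool × GadgetVertex o V) ⊕ X} {c : Config s D V}
    {τ τ' : ℕ} {w' : W} (hττ : τ < τ') (hβ : ∀ l, o.out w l = β)
    (hw : ∀ w', w' = p ∨ w' = q → w' ≠ w ∧ ∀ l, w' ≠ H.nbr l w)
    (hc : HasConfig (A.run (join (expandTwoPort B o p q hpq) G g) pos₀ τ) w D c)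
    (hstay : ∀ t, τ ≤ t → t < τ' → ∀ a ∈ D,
      InStar w ((A.run (join (expandTwoPort B o p q hpq) G g) pos₀ t).pos a))
    (halone : ∀ t, τ ≤ t → t < τ' →
      AloneAt (A.run (join (expandTwoPort B o p q hpq) G g) pos₀ t) D w)
    (hww : w' ≠ w)
    (hvisit : ∃ b ∈ D, AtMain w' ((A.run (join (expandTwoPort B o p q hpq) G g) pos₀ τ').pos b))
    (hall : ∀ l, w' = H.nbr l w → ∀ a ∈ D,
      InZone w' ((A.run (join (expandTwoPort B o p q hpq) G g) pos₀ τ').pos a) ∨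
      InEdge (o.edgeAt w l) ((A.run (join (expandTwoPort B o p q hpq) G g) pos₀ τ').pos a)) :
    ∃ l c', w' = H.nbr l w ∧ MacroNext A B β c l c' ∧
      HasConfig (A.run (join (expandTwoPort B o p q hpq) G g) pos₀ τ') w' D c' := by
  set ρ := A.run (join (expandTwoPort B o p q hpq) G g) pos₀ with hρ
  have hsucc : ∀ t, ρ (t + 1) = A.step (join (expandTwoPort B o p q hpq) G g) (ρ t) :=
    fun t => A.run_succ _ _ t
  obtain ⟨b, hb, hbm⟩ := hvisit
  -- a halted process would not arrive any more
  have hhalt : ∀ t, τ ≤ t → t < τ' → ¬ ∀ i, (ρ t).state i ∈ A.halting i := by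
    intro t h1 h2 hh
    have hconst : ∀ n, ρ (t + n) = ρ t := by
      intro n
      induction n with
      | zero => rfl
      | succ n ih => rw [← add_assoc, hsucc, ih, Agents.step, if_pos hh]
    have := hconst (τ' - t)
    rw [Nat.add_sub_cancel' h2.le] at this
    rw [this] at hbm
    obtain ⟨a, ha⟩ := hstay t h1 h2 b hb
    obtain ⟨c', hc'⟩ := hbm
    rw [ha, Sum.inl.injEq] at hc'
    obtain ⟨c'', a⟩ := a
    cases a <;> simp [locate] at hc'
    exact hww hc'.2.symm
  have hreach : ∀ t, τ ≤ t → t < τ' →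
      ∃ c₁, Relation.ReflTransGen (LocalNext A B β) c c₁ ∧ HasConfig (ρ t) w D c₁ := by
    intro t h1
    induction t, h1 using Nat.le_induction with
    | base => exact fun _ => ⟨c, .refl, hc⟩
    | succ t h1 ih =>
      intro h2
      obtain ⟨c₁, hc₁, hcfg⟩ := ih (by omega)
      have hstep := step_pos_eq (B := B) (hpq := hpq) (G := G) (g := g) hcfg
        (halone t h1 (by omega)) hβ hw (hhalt t h1 (by omega))
      simp only [← hsucc] at hstep
      have hloc : ∀ i : D, ∃ a, localPos A B β c₁ i = .inl a := by
        intro i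
        obtain ⟨a, ha⟩ := hstay (t + 1) (by omega) h2 i i.2
        refine ⟨a, place_injective o w ?_⟩
        have := (hstep i).2.2
        rw [ha, Sum.inl.injEq] at this
        exact this.symm
      choose a ha using hloc
      refine ⟨fun i => ((localAction A c₁ i).1, localEntry A c₁ i, a i),
        hc₁.tail fun i => ⟨ha i, rfl, rfl⟩, fun i => ?_⟩
      obtain ⟨h3, h4, h5⟩ := hstep i
      refine ⟨h3, h4, ?_⟩
      rw [h5, ha]
      rfl
  obtain ⟨c₁, hc₁, hcfg⟩ := hreach (τ' - 1) (by omega) (by omega)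
  have hstep := step_pos_eq (B := B) (hpq := hpq) (G := G) (g := g) hcfg
    (halone (τ' - 1) (by omega) (by omega)) hβ hw (hhalt (τ' - 1) (by omega) (by omega))
  simp only [← hsucc, Nat.sub_add_cancel (show 1 ≤ τ' by omega)] at hstep
  obtain ⟨l, c₂, hl, hw'⟩ : ∃ l c₂, localPos A B β c₁ ⟨b, hb⟩ = .inr (c₂, l) ∧ w' = H.nbr l w := by
    obtain ⟨c₂, hc₂⟩ := hbm
    have := (hstep ⟨b, hb⟩).2.2
    rw [hc₂, Sum.inl.injEq] at this
    rcases hx : localPos A B β c₁ ⟨b, hb⟩ with ⟨c₃, a⟩ | ⟨c₃, l⟩ <;> rw [hx] at this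
    · cases a <;> simp [place, locate] at this
      exact absurd this.2 hww
    · simp only [place, Prod.mk.injEq, GadgetVertex.main.injEq] at this
      exact ⟨l, c₃, rfl, this.2⟩
  have hrec : ∀ i : D, ∃ a, recentre l (localPos A B β c₁ i) = some a := by
    intro i
    apply exists_recentre (o := o) (w := w) (X := X)
    rw [← (hstep i).2.2, ← hw']
    exact hall l hw' i i.2
  choose a ha using hrec
  refine ⟨l, fun i => ((localAction A c₁ i).1, localEntry A c₁ i, a i), hw',
    ⟨c₁, hc₁, ⟨_, _, hl⟩, fun i => ⟨ha i, rfl, rfl⟩⟩, fun i => ?_⟩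
  obtain ⟨h3, h4, h5⟩ := hstep i
  refine ⟨h3, h4, ?_⟩
  rw [h5, hw', locate_recentre (ha i)]

end MacroStep

/-! ### A group of agents that is alone -/

theorem exists_last {p : ℕ → Prop} {a b : ℕ} (h : ∃ t, a ≤ t ∧ t ≤ b ∧ p t) :
    ∃ t, a ≤ t ∧ t ≤ b ∧ p t ∧ ∀ t', t < t' → t' ≤ b → ¬ p t' := by
  classical
  have hne : ((Finset.Icc a b).filter p).Nonempty := by
    obtain ⟨t, h1, h2, h3⟩ := h
    exact ⟨t, Finset.mem_filter.2 ⟨Finset.mem_Icc.2 ⟨h1, h2⟩, h3⟩⟩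
  have hm := Finset.mem_filter.1 (Finset.max'_mem _ hne)
  have hI := Finset.mem_Icc.1 hm.1
  refine ⟨_, hI.1, hI.2, hm.2, fun t' h1 h2 h3 => ?_⟩
  have := Finset.le_max' _ t' (Finset.mem_filter.2
    ⟨Finset.mem_Icc.2 ⟨hI.1.trans h1.le, h2⟩, h3⟩)
  omega

theorem exists_first {p : ℕ → Prop} {a b : ℕ} (h : ∃ t, a ≤ t ∧ t ≤ b ∧ p t) :
    ∃ t, a ≤ t ∧ t ≤ b ∧ p t ∧ ∀ t', a ≤ t' → t' < t → ¬ p t' := by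
  classical
  have hne : ((Finset.Icc a b).filter p).Nonempty := by
    obtain ⟨t, h1, h2, h3⟩ := h
    exact ⟨t, Finset.mem_filter.2 ⟨Finset.mem_Icc.2 ⟨h1, h2⟩, h3⟩⟩
  have hm := Finset.mem_filter.1 (Finset.min'_mem _ hne)
  have hI := Finset.mem_Icc.1 hm.1
  refine ⟨_, hI.1, hI.2, hm.2, fun t' h1 h2 h3 => ?_⟩
  have := Finset.min'_le _ t' (Finset.mem_filter.2
    ⟨Finset.mem_Icc.2 ⟨h1, h2.le.trans hI.2⟩, h3⟩)
  omega

section Company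

variable {k : ℕ} {V W X : Type} {H : CubicGraph W} {o : Direction H} {B : TwoPort V}
  {L : W → Prop} {r : ℕ} {P : Fin k → ℕ → (Bool × GadgetVertex o V) ⊕ X} {cls : W → Bool}
  {lev : W → ℤ} {D : Finset (Fin k)} {i : Fin k} {y T : ℕ}

theorem InStar.eq_of_atMain {u w : W} {z : (Bool × GadgetVertex o V) ⊕ X} (h : InStar u z)
    (h' : AtMain w z) : w = u := by
  obtain ⟨⟨c, a⟩, rfl⟩ := h
  obtain ⟨c', h'⟩ := h'
  rw [Sum.inl.injEq] at h'
  cases a <;> simp [locate] at h'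
  exact h'.2.symm

theorem InStar.eq_edgeAt {w : W} {κ : Bool × DirEdge o} {z : (Bool × GadgetVertex o V) ⊕ X}
    (h : InStar w z) (h' : InCore κ z) : ∃ l, κ.2 = o.edgeAt w l := by
  obtain ⟨⟨c, a⟩, rfl⟩ := h
  obtain ⟨b, hb⟩ := h'
  rw [Sum.inl.injEq] at hb
  cases a <;> simp [locate] at hb
  exact ⟨_, hb.2.1.symm⟩

theorem AtMain.inStar {w : W} {z : (Bool × GadgetVertex o V) ⊕ X} (h : AtMain w z) :
    InStar w z := h.inZone.inStar

theorem sideAt_eq (hcls : ∀ w l, o.out w l = cls w) (w : W) (l : Fin 3) :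
    o.sideAt w l = !cls w := by rw [Direction.sideAt, hcls]

/-- During the period from `y` to `T` the agent `i` of `D` is in `H(B)`, and the agents outside the
set `D` of `r` agents keep away from it with respect to the levels of macro vertices. The distance
of 8 levels is more than enough to keep them away from all gadgets around the macro vertices next to
`i`, whose levels differ by at most 2. -/
structure Company (B : TwoPort V) (L : W → Prop) (r : ℕ)
    (P : Fin k → ℕ → (Bool × GadgetVertex o V) ⊕ X) (cls : W → Bool) (lev : W → ℤ)
    (D : Finset (Fin k)) (i : Fin k) (y T : ℕ) : Prop where
  among : AmongBarriers B L r P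
  cls : ∀ w l, o.out w l = cls w
  lip : ∀ m w, |lev (H.nbr m w) - lev w| ≤ 1
  mem : i ∈ D
  card : D.card = r
  inside : ∀ t, y ≤ t → t ≤ T → ∃ z, P i t = .inl z
  apart : ∀ t, y ≤ t → t ≤ T → ∀ a, a ∉ D → ∀ w w', InStar w (P i t) → InStar w' (P a t) →
    8 < |lev w - lev w'|

/-- At time `τ` the agents of `D` have arrived at the macro vertex `w` along the edge labelled `l`:
one of them is at `w`, all others are in the zone of `w` or still in the copies of `B` that belong
to this edge, and all have been at the same side of the edge before. -/
structure Gathered (B : TwoPort V) (L : W → Prop) (r : ℕ)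
    (P : Fin k → ℕ → (Bool × GadgetVertex o V) ⊕ X) (cls : W → Bool)
    (D : Finset (Fin k)) (i : Fin k) (w : W) (l : Fin 3) (τ : ℕ) : Prop where
  scene : ∃ T₀ ≤ τ, Scene B L r P cls D i (o.edgeAt w l) T₀ τ ∧ ∃ (ν : Bool) (T : Fin k → ℕ), ∀ a ∈ D,
    T₀ ≤ T a ∧ T a ≤ τ ∧ StartSide (o.edgeAt w l) ν (P a (T a))
  around : ∀ a ∈ D, InZone w (P a τ) ∨ InEdge (o.edgeAt w l) (P a τ)
  visit : ∃ b ∈ D, AtMain w (P b τ)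

theorem Gathered.inStar {w : W} {l : Fin 3} {τ : ℕ} (h : Gathered B L r P cls D i w l τ)
    {a : Fin k} (ha : a ∈ D) : InStar w (P a τ) := by
  rcases h.around a ha with h | h
  · exact h.inStar
  · exact inEdge_inStar h

theorem Scene.append {e : DirEdge o} {T₀ T₁ z : ℕ} (h : Scene B L r P cls D i e T₀ T₁)
    (h' : Scene B L r P cls D i e T₁ z) : Scene B L r P cls D i e T₀ z :=
  { h with
    near := fun t h1 h2 => by
      rcases Nat.le_total t T₁ with h3 | h3
      · exact h.near t h1 h3
      · exact h'.near t h3 h2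
    alone := fun t h1 h2 => by
      rcases Nat.le_total t T₁ with h3 | h3
      · exact h.alone t h1 h3
      · exact h'.alone t h3 h2 }

theorem SideVertex.ne_self {v : W} {l : Fin 3}
    (h : SideVertex (o.edgeAt v l) (!o.sideAt v l) v) : False := by
  rcases h with h | ⟨-, h⟩
  · rw [endOf_edgeAt_not] at h; exact H.nbr_ne l v h.symm
  · rw [Bool.not_not, o.endOf_edgeAt] at h; exact h rfl

theorem SideVertex.label_eq (hcls : ∀ w l, o.out w l = cls w) {v : W} {l l' : Fin 3}
    (h : SideVertex (o.edgeAt v l) (!o.sideAt v l) (H.nbr l' v)) : l' = l := by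
  rcases h with h | ⟨⟨m, h⟩, -⟩
  · rw [endOf_edgeAt_not] at h; exact H.nbr_inj v h
  · rw [endOf_edgeAt_not] at h
    have := congrArg cls h
    simp [cls_nbr hcls] at this

/-- Agents that were around `v` have arrived at the next macro vertex together. -/
theorem Scene.arrive {v : W} {l : Fin 3} {T₀ z : ℕ}
    (h : Scene B L r P cls D i (o.edgeAt v l) T₀ (z + 1)) (hz : T₀ ≤ z + 1) (hv : ¬ L v)
    (hn : ∀ l, ¬ L (H.nbr l v)) {ν : Bool} {T : Fin k → ℕ}
    (hT : ∀ a ∈ D, T₀ ≤ T a ∧ T a ≤ z + 1 ∧ StartSide (o.edgeAt v l) ν (P a (T a)))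
    (hstar : ∀ a ∈ D, InStar v (P a z)) {b : Fin k} (hb : b ∈ D)
    (hbz : AtMain (H.nbr l v) (P b (z + 1))) :
    Gathered B L r P cls D i (H.nbr l v) l (z + 1) := by
  have hbs : OnSide (o.edgeAt v l) (!o.sideAt v l) (P b) T₀ (z + 1) := by
    refine ⟨z + 1, hz, le_rfl, .inl (by rw [endOf_edgeAt_not]; exact hbz.inZone), ?_⟩
    rintro t h1 h2 ⟨c, hc⟩
    obtain rfl : t = z + 1 := le_antisymm h2 h1
    exact hc.not_inZone hbz.inZone
  refine ⟨⟨T₀, hz, by rwa [edgeAt_nbr], ν, T, by rwa [edgeAt_nbr]⟩, fun a ha => ?_, b, hb, hbz⟩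
  rw [edgeAt_nbr]
  by_cases hin : InEdge (o.edgeAt v l) (P a (z + 1))
  · exact .inr hin
  left
  have hatt := h.attached_of_onSide ha (h.onSide_of_onSide hT ha hb hbs hin)
  have zone : ∀ l', InZone (H.nbr l' v) (P a (z + 1)) → InZone (H.nbr l v) (P a (z + 1)) := by
    intro l' hl'
    rcases hatt with ⟨w, hw, hU⟩ | ⟨κ, τ, hκ, -⟩
    · rw [hw.unique hl'] at hU
      rwa [← hU.label_eq h.cls]
    · exact absurd hl' hκ.not_inZone
  rcases (h.among.moves a).of_inStar (β := cls v) (h.cls v) (hstar a ha)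
    ((h.among.moves a).inside_of_inStar hv hn (hstar a ha)) with h1 | ⟨l', h1⟩
  · rcases h1.cases with h2 | ⟨l', h2, -⟩ | ⟨l', c, h2⟩
    · rcases hatt with ⟨w, hw, hU⟩ | ⟨κ, τ, hκ, -⟩
      · rw [hw.unique h2] at hU; exact hU.ne_self.elim
      · exact absurd h2 hκ.not_inZone
    · exact zone l' h2
    · rcases hatt with ⟨w, hw, -⟩ | ⟨κ, τ, hκ, hne, hU⟩
      · exact absurd hw h2.not_inZone
      · obtain rfl := hκ.unique h2
        rw [endOf_edgeAt_eq] at hU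
        split at hU
        · exact absurd (by rw [hU.label_eq h.cls]) hne
        · exact hU.ne_self.elim
  · exact zone l' h1.inZone

namespace Company

theorem alone (h : Company B L r P cls lev D i y T) {t : ℕ} (h1 : y ≤ t) (h2 : t ≤ T) {w w' : W}
    (hi : InStar w (P i t)) (hw : |lev w - lev w'| ≤ 8) {a : Fin k} (ha : a ∉ D) :
    ¬ InStar w' (P a t) := fun h' => by
  have := h.apart t h1 h2 a ha w w' hi h'
  omega

/-- While `i` is around `v`, the group is alone at each of the three edges at `v`. -/
theorem scene (h : Company B L r P cls lev D i y T) {v : W} (l : Fin 3) {T₀ z : ℕ} (h0 : y ≤ T₀)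
    (hz : z ≤ T) (hi : ∀ t, T₀ ≤ t → t ≤ z → InStar v (P i t) ∨ ∃ m, AtMain (H.nbr m v) (P i t))
    (hL : ∀ w, L w → 4 < |lev w - lev v|) : Scene B L r P cls D i (o.edgeAt v l) T₀ z := by
  have hnear : ∀ w, NearEdge (o.edgeAt v l) w → |lev w - lev v| ≤ 2 := by
    rintro w ⟨τ, hw⟩
    have h1 : |lev (o.endOf (o.edgeAt v l) τ) - lev v| ≤ 1 := by
      rw [endOf_edgeAt_eq]
      split
      · exact h.lip l v
      · simp
    rcases hw with rfl | ⟨m, rfl⟩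
    · omega
    · have h2 := h.lip m (o.endOf (o.edgeAt v l) τ)
      rw [abs_le] at h1 h2 ⊢
      omega
  refine ⟨h.among, h.cls, h.mem, h.card, ?_, ?_, ?_⟩
  · intro t h1 h2 κ hκ
    rcases hi t h1 h2 with h3 | ⟨m, h3⟩
    · obtain ⟨l', hl'⟩ := h3.eq_edgeAt hκ
      refine ⟨!cls v, ?_⟩
      rw [hl', ← sideAt_eq h.cls v l', o.endOf_edgeAt, sideAt_eq h.cls, ← sideAt_eq h.cls v l,
        o.endOf_edgeAt]
    · exact absurd h3.inZone hκ.not_inZone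
  · intro t h1 h2 a ha κ σ hκ hw
    have h3 := hnear _ hw
    rcases hi t h1 h2 with h4 | ⟨m, h4⟩
    · have := h.apart t (h0.trans h1) (h2.trans hz) a ha _ _ h4 (hκ.inStar σ)
      rw [abs_sub_comm] at this
      omega
    · have := h.apart t (h0.trans h1) (h2.trans hz) a ha _ _ h4.inStar (hκ.inStar σ)
      have h5 := h.lip m v
      rw [abs_le] at h3 h5
      rw [lt_abs] at this
      omega
  · intro w hw hw'
    have h1 := hnear w hw'
    have h2 := hL w hw
    omega

theorem not_L (h : Company B L r P cls lev D i y T) {v : W}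
    (hL : ∀ w, L w → 4 < |lev w - lev v|) : ¬ L v ∧ ∀ l, ¬ L (H.nbr l v) := by
  refine ⟨fun hv => ?_, fun l hl => ?_⟩
  · have := hL v hv; simp at this
  · have := hL _ hl
    have := h.lip l v
    omega

/-- The agents of `D` stay around `w` until one of them visits another macro vertex. -/
theorem stay (h : Company B L r P cls lev D i y T) {w : W} (hL : ∀ w', L w' → 4 < |lev w' - lev w|)
    {τ τ' : ℕ} (h0 : ∀ a ∈ D, InStar w (P a τ))
    (hno : ∀ t, τ < t → t < τ' → ∀ b ∈ D, ∀ w', w' ≠ w → ¬ AtMain w' (P b t))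
    {t : ℕ} (h1 : τ ≤ t) (h2 : t < τ') {a : Fin k} (ha : a ∈ D) : InStar w (P a t) := by
  obtain ⟨hw, hn⟩ := h.not_L hL
  induction t, h1 using Nat.le_induction with
  | base => exact h0 a ha
  | succ t h1 ih =>
    have ih := ih (by omega)
    rcases (h.among.moves a).of_inStar (h.cls w) ih
      ((h.among.moves a).inside_of_inStar hw hn ih) with h3 | ⟨l, h3⟩
    · exact h3
    · exact absurd h3 (hno (t + 1) (by omega) h2 a ha _ (H.nbr_ne l w))

/-- The group gets from one macro vertex to the next one together. -/
theorem next (h : Company B L r P cls lev D i y T) {w w' : W} {l : Fin 3} {τ τ' : ℕ} (hy : y ≤ τ)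
    (hT : τ' ≤ T) (hττ : τ < τ') (hL : ∀ w', L w' → 4 < |lev w' - lev w|)
    (hg : Gathered B L r P cls D i w l τ)
    (hno : ∀ t, τ < t → t < τ' → ∀ b ∈ D, ∀ w', w' ≠ w → ¬ AtMain w' (P b t))
    {b : Fin k} (hb : b ∈ D) (hww : w' ≠ w) (hbw : AtMain w' (P b τ')) :
    ∃ l', w' = H.nbr l' w ∧ Gathered B L r P cls D i w' l' τ' := by
  obtain ⟨hw, hn⟩ := h.not_L hL
  have hstay := fun t h1 h2 a ha => h.stay (t := t) hL (fun a ha => hg.inStar ha) hno h1 h2 (a := a) ha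
  obtain ⟨z, rfl⟩ : ∃ z, τ' = z + 1 := ⟨τ' - 1, by omega⟩
  have hlast : ∀ a ∈ D, InStar w (P a (z + 1)) ∨ ∃ m, AtMain (H.nbr m w) (P a (z + 1)) := by
    intro a ha
    have h1 := hstay z (by omega) (by omega) a ha
    exact (h.among.moves a).of_inStar (h.cls w) h1
      ((h.among.moves a).inside_of_inStar hw hn h1)
  obtain ⟨l', rfl⟩ : ∃ l', w' = H.nbr l' w := by
    rcases hlast b hb with h1 | ⟨m, h1⟩
    · exact absurd (h1.eq_of_atMain hbw) hww
    · exact ⟨m, hbw.inZone.unique h1.inZone⟩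
  refine ⟨l', rfl, ?_⟩
  have hscene : Scene B L r P cls D i (o.edgeAt w l') τ (z + 1) := by
    refine h.scene l' hy hT (fun t h1 h2 => ?_) hL
    rcases Nat.lt_or_ge t (z + 1) with h3 | h3
    · exact .inl (hstay t h1 h3 i h.mem)
    · obtain rfl := le_antisymm h2 h3
      exact hlast i h.mem
  by_cases hl : l' = l
  · subst hl
    obtain ⟨T₀, h0, hs, ν, S, hS⟩ := hg.scene
    exact (hs.append hscene).arrive (by omega) hw hn
      (fun a ha => ⟨(hS a ha).1, (hS a ha).2.1.trans (by omega), (hS a ha).2.2⟩)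
      (hstay z (by omega) (by omega)) hb hbw
  · refine hscene.arrive (ν := o.sideAt w l') (T := fun _ => τ) (by omega) hw hn
      (fun a ha => ⟨le_rfl, by omega, ?_⟩) (hstay z (by omega) (by omega)) hb hbw
    rcases hg.around a ha with h1 | ⟨c, h1⟩
    · left; rwa [o.endOf_edgeAt]
    · refine .inr ⟨_, h1, fun he => hl (edgeAt_injective w he).symm, ?_⟩
      rw [o.endOf_edgeAt, sideAt_eq h.cls, ← sideAt_eq h.cls w l, o.endOf_edgeAt]

end Company

end Company

/-! ### The departure of a group -/

section Departure

variable {k : ℕ} {V W X : Type} {H : CubicGraph W} {o : Direction H} {B : TwoPort V}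
  {L : W → Prop} {r : ℕ} {P : Fin k → ℕ → (Bool × GadgetVertex o V) ⊕ X} {cls : W → Bool}
  {lev : W → ℤ} {D : Finset (Fin k)} {i : Fin k} {y T : ℕ}

namespace Company

theorem of_inStar (h : Company B L r P cls lev D i y T) {w : W} {t : ℕ} (h1 : y ≤ t) (h2 : t < T)
    (hw : InStar w (P i t)) :
    InStar w (P i (t + 1)) ∨ ∃ l, AtMain (H.nbr l w) (P i (t + 1)) :=
  (h.among.moves i).of_inStar (h.cls w) hw (h.inside _ (by omega) (by omega))

/-- The agent stays around `w` while it visits no other macro vertex. -/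
theorem inStar_of_no_main (h : Company B L r P cls lev D i y T) {w : W} {t₀ t : ℕ} (h0 : y ≤ t₀)
    (hw : InStar w (P i t₀)) (h1 : t₀ ≤ t) (h2 : t ≤ T)
    (hno : ∀ s, t₀ < s → s ≤ t → ∀ l, ¬ AtMain (H.nbr l w) (P i s)) : InStar w (P i t) := by
  induction t, h1 using Nat.le_induction with
  | base => exact hw
  | succ t h1 ih =>
    rcases h.of_inStar (by omega) (by omega) (ih (by omega) fun s h3 h4 => hno s h3 (by omega))
      with h3 | ⟨l, h3⟩
    · exact h3
    · exact absurd h3 (hno _ (by omega) le_rfl l)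

/-- Before it arrives at `w`, the agent is around `w` since its last visit of another macro
vertex. -/
theorem inStar_of_no_main_before (h : Company B L r P cls lev D i y T) {w : W} {t₀ t₁ t : ℕ}
    (h0 : y ≤ t₀) (hw : InStar w (P i t₁)) (h1 : t₁ ≤ T)
    (hno : ∀ s, t₀ < s → s < t₁ → ∀ l, ¬ AtMain (H.nbr l w) (P i s)) (h2 : t₀ < t) (h3 : t ≤ t₁) :
    InStar w (P i t) := by
  obtain ⟨n, rfl⟩ : ∃ n, t₁ = t + n := ⟨t₁ - t, by omega⟩
  clear h3
  induction n generalizing t with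
  | zero => exact hw
  | succ n ih =>
    have h4 : InStar w (P i (t + 1)) :=
      ih (t := t + 1) (by omega) (by rwa [show t + 1 + n = t + (n + 1) by omega]) (by omega)
        (fun s h5 h6 => hno s h5 (by omega))
    rcases (h.among.moves i).inStar_pred (h.cls w) h4 (h.inside t (by omega) (by omega))
      with h5 | ⟨l, h5⟩
    · exact h5
    · exact absurd h5 (hno t h2 (by omega) l)

/-- If, for each of the three edges at `v`, an agent is at the side of `v` or in the edge, then it
is around `v`. -/
theorem inStar_of_attached (hcls : ∀ w l, o.out w l = cls w) {v : W}
    {z : (Bool × GadgetVertex o V) ⊕ X}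
    (hz : ∀ m, InEdge (o.edgeAt v m) z ∨ Attached (o.edgeAt v m) (o.sideAt v m) z) :
    InStar v z := by
  by_cases hin : ∃ m, InEdge (o.edgeAt v m) z
  · obtain ⟨m, hm⟩ := hin
    exact inEdge_inStar hm
  have hz : ∀ m, Attached (o.edgeAt v m) (o.sideAt v m) z := fun m =>
    (hz m).resolve_left fun h => hin ⟨m, h⟩
  have hside : ∀ {m w}, SideVertex (o.edgeAt v m) (o.sideAt v m) w →
      w = v ∨ ∃ m', w = H.nbr m' v ∧ m' ≠ m := by
    rintro m w (h | ⟨⟨m', h⟩, hne⟩)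
    · left; rwa [o.endOf_edgeAt] at h
    · rw [o.endOf_edgeAt] at h
      rw [endOf_edgeAt_not] at hne
      exact .inr ⟨m', h, fun he => hne (by rw [h, he])⟩
  rcases hz 0 with ⟨w, hw, hU⟩ | ⟨κ, τ, hκ, -, hU⟩
  · rcases hside hU with rfl | ⟨m, rfl, -⟩
    · exact hw.inStar
    · rcases hz m with ⟨w, hw', hU'⟩ | ⟨κ, τ, hκ, -⟩
      · rw [hw'.unique hw] at hU'
        rcases hside hU' with h | ⟨m', h, hne⟩
        · exact absurd h (H.nbr_ne m v)
        · exact absurd (H.nbr_inj v h).symm hne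
      · exact absurd hw hκ.not_inZone
  · rcases hside hU with h | ⟨m, h, -⟩
    · rw [← h]; exact hκ.inStar τ
    · rcases hz m with ⟨w, hw, -⟩ | ⟨κ', τ', hκ', -, hU'⟩
      · exact absurd hw hκ.not_inZone
      · obtain rfl := hκ.unique hκ'
        rcases hside hU' with h' | ⟨m', h', hne⟩
        · rw [← h']; exact hκ.inStar τ'
        · exfalso
          have h1 := congrArg cls h
          have h2 := congrArg cls h'
          rw [cls_endOf hcls, cls_nbr hcls] at h1 h2
          have hτ : τ = τ' := Bool.not_inj (h1.trans h2.symm)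
          rw [← hτ, h] at h'
          exact hne (H.nbr_inj v h').symm

theorem inEdge_end {v w : W} {l : Fin 3} {z : (Bool × GadgetVertex o V) ⊕ X}
    (h : InEdge (o.edgeAt v l) z) (hw : InStar w z) : w = v ∨ w = H.nbr l v := by
  obtain ⟨c, hc⟩ := h
  obtain ⟨l', hl'⟩ := hw.eq_edgeAt hc
  have h1 := o.endOf_edgeAt w l'
  rw [← hl', endOf_edgeAt_eq] at h1
  split at h1
  · exact .inr h1.symm
  · exact .inl h1.symm

/-- When the agent `i` gets from low to high levels, there is a moment at which the whole group
goes from one macro vertex `v` to the next one. The agent `i` comes to `v` from a vertex `u`,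
through a copy of `B` that all agents of the group must visit, and leaves `v` for a vertex other
than `u`. When it leaves, none of the others can be beyond one of the three edges at `v`. -/
theorem exists_gathered (h : Company B L r P cls lev D i y T) (hyT : y ≤ T) {n₀ : ℤ}
    (hL : ∀ w, L w → 5 < |lev w - n₀|) (hy : ∃ w, InStar w (P i y) ∧ lev w < n₀)
    (hT : ∀ w, InStar w (P i T) → n₀ + 2 < lev w) :
    ∃ v m t₀ τ, y ≤ t₀ ∧ t₀ < τ ∧ τ ≤ T ∧ lev v = n₀ + 1 ∧ AtMain v (P i t₀) ∧
      (∀ t, t₀ ≤ t → t < τ → ∀ a ∈ D, InStar v (P a t)) ∧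
      Gathered B L r P cls D i (H.nbr m v) m τ := by
  -- the last visit of a macro vertex `u` of level at most `n₀`
  obtain ⟨tu, hyu, huT, ⟨u, hu, hun⟩, hulast⟩ : ∃ t, y ≤ t ∧ t ≤ T ∧
      (∃ u, AtMain u (P i t) ∧ lev u ≤ n₀) ∧
      ∀ t', t < t' → t' ≤ T → ¬ ∃ u, AtMain u (P i t') ∧ lev u ≤ n₀ := by
    apply exists_last
    by_contra hno
    push Not at hno
    obtain ⟨w, hw, hwn⟩ := hy
    have := hT w (h.inStar_of_no_main le_rfl hw hyT le_rfl fun s h1 h2 l hl => by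
      have h3 := hno s h1.le h2 _ hl
      have h4 := h.lip l w
      rw [abs_le] at h4
      omega)
    omega
  -- the next visit of a macro vertex `v`
  obtain ⟨tv, huv, hvT, ⟨v, hv⟩, hvfirst⟩ : ∃ t, tu + 1 ≤ t ∧ t ≤ T ∧ (∃ w, AtMain w (P i t)) ∧
      ∀ t', tu + 1 ≤ t' → t' < t → ¬ ∃ w, AtMain w (P i t') := by
    apply exists_first
    by_contra hno
    push Not at hno
    have := hT u (h.inStar_of_no_main hyu hu.inStar huT le_rfl fun s h1 h2 l => hno s h1 h2 _)
    omega
  have hvn : n₀ < lev v := by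
    by_contra hle
    exact hulast tv (by omega) hvT ⟨v, hv, by omega⟩
  have hstarU : ∀ t, tu ≤ t → t < tv → InStar u (P i t) := fun t h1 h2 =>
    h.inStar_of_no_main hyu hu.inStar h1 (by omega) fun s h3 h4 l hl =>
      hvfirst s (by omega) (by omega) ⟨_, hl⟩
  obtain ⟨l₁, rfl⟩ : ∃ l, v = H.nbr l u := by
    obtain ⟨t, rfl⟩ : ∃ t, tv = t + 1 := ⟨tv - 1, by omega⟩
    rcases h.of_inStar (by omega) (by omega) (hstarU t (by omega) (by omega)) with h1 | ⟨l, h1⟩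
    · rw [h1.eq_of_atMain hv] at hvn; omega
    · exact ⟨l, hv.inZone.unique h1.inZone⟩
  obtain ⟨v, hvdef⟩ : ∃ v, v = H.nbr l₁ u := ⟨_, rfl⟩
  have hvu : H.nbr l₁ v = u := by rw [hvdef, H.nbr_nbr]
  rw [← hvdef] at hv hvn
  have hlev : lev v = n₀ + 1 ∧ lev u = n₀ := by
    have := h.lip l₁ u
    rw [← hvdef, abs_le] at this
    omega
  have huv_ne : u ≠ v := fun he => by rw [he] at hlev; omega
  have hLv : ∀ w, L w → 4 < |lev w - lev v| := fun w hw => by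
    have := hL w hw
    rw [lt_abs] at this ⊢
    omega
  have hLu : ¬ L u := fun hu => by
    have := hL u hu
    rw [hlev.2] at this
    simp at this
  -- the next visit of a macro vertex `v'` other than `v`, and the last visit of `v` before
  obtain ⟨t₁, hv1, h1T, ⟨v', hv'v, hv'⟩, h1first⟩ : ∃ t, tv + 1 ≤ t ∧ t ≤ T ∧
      (∃ w, w ≠ v ∧ AtMain w (P i t)) ∧
      ∀ t', tv + 1 ≤ t' → t' < t → ¬ ∃ w, w ≠ v ∧ AtMain w (P i t') := by
    apply exists_first
    by_contra hno
    push Not at hno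
    have := hT v (h.inStar_of_no_main (by omega) hv.inStar hvT le_rfl fun s h1 h2 l =>
      hno s h1 h2 _ (H.nbr_ne l v))
    omega
  have hv'u : v' ≠ u := by
    rintro rfl
    exact hulast t₁ (by omega) h1T ⟨_, hv', hun⟩
  obtain ⟨t₀, hv0, h01, h0v, h0last⟩ : ∃ t, tv ≤ t ∧ t ≤ t₁ ∧ AtMain v (P i t) ∧
      ∀ t', t < t' → t' ≤ t₁ → ¬ AtMain v (P i t') :=
    exists_last ⟨tv, le_rfl, by omega, hv⟩
  have h01 : t₀ < t₁ := by
    rcases Nat.lt_or_ge t₀ t₁ with h1 | h1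
    · exact h1
    · obtain rfl := le_antisymm h01 h1
      exact absurd (hv'.inZone.unique h0v.inZone) hv'v
  have hstarV : ∀ t, tu < t → t < t₁ → InStar v (P i t) := by
    intro t h1 h2
    rcases Nat.le_total t tv with h3 | h3
    · exact h.inStar_of_no_main_before hyu hv.inStar hvT
        (fun s h4 h5 l hl => hvfirst s h4 h5 ⟨_, hl⟩) h1 h3
    · exact h.inStar_of_no_main (by omega) hv.inStar h3 (by omega) fun s h4 h5 l hl =>
        h1first s h4 (by omega) ⟨_, H.nbr_ne l v, hl⟩
  have hstarV' : ∀ t, t₀ < t → t ≤ t₁ → InStar v' (P i t) := by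
    intro t h1 h2
    refine h.inStar_of_no_main_before (by omega) hv'.inStar h1T (fun s h4 h5 l hl => ?_) h1 h2
    by_cases hs : H.nbr l v' = v
    · rw [hs] at hl; exact h0last s h4 h5.le hl
    · exact h1first s (by omega) h5 ⟨_, hs, hl⟩
  have hwin : ∀ t, tu ≤ t → t ≤ t₁ → InStar v (P i t) ∨ ∃ m, AtMain (H.nbr m v) (P i t) := by
    intro t h1 h2
    rcases Nat.lt_or_ge tu t with h3 | h3
    · rcases Nat.lt_or_ge t t₁ with h4 | h4
      · exact .inl (hstarV t h3 h4)
      · obtain rfl : t = t₁ := by omega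
        obtain ⟨t, rfl⟩ : ∃ s, t = s + 1 := ⟨t - 1, by omega⟩
        exact h.of_inStar (by omega) (by omega) (hstarV t (by omega) (by omega))
    · obtain rfl : t = tu := by omega
      exact .inr ⟨l₁, by rwa [hvu]⟩
  have hscene : ∀ m, Scene B L r P cls D i (o.edgeAt v m) tu t₁ := fun m =>
    h.scene m hyu h1T hwin hLv
  -- the agent `i` gets from `u` to `v` through a copy `κ` of `B`
  obtain ⟨κ, σ, s₁, s₂, hs1, hs12, hs2, hin, hp, hq, hκ⟩ : ∃ κ σ s₁ s₂, tu < s₁ ∧ s₁ ≤ s₂ ∧ s₂ < tv ∧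
      (∀ t, s₁ ≤ t → t ≤ s₂ → InCore κ (P i t)) ∧ AtPort B κ σ (P i s₁) ∧
      AtPort B κ (!σ) (P i s₂) ∧ κ.2 = o.edgeAt v l₁ := by
    by_contra hno
    have key := (h.among.moves i).zone_invariant (U := fun w => w = u) (t₀ := tu) (t₁ := tv)
      (fun w hw hU => hLu (hU ▸ hw)) ?_ (.inl ⟨u, hu.inZone, rfl⟩) (by omega) le_rfl
    · rcases key with ⟨w, hw, rfl⟩ | ⟨κ, σ, hκ, -⟩
      · exact huv_ne (hw.unique hv.inZone)
      · exact hκ.not_inZone hv.inZone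
    · intro κ σ s₁ s₂ h1 h2 h3 hin hp hq hU
      refine absurd ⟨κ, σ, s₁, s₂, h1, h2, h3, hin, hp, hq, ?_⟩ hno
      have hc := hin s₁ le_rfl h2
      obtain ⟨m, hm⟩ := (hstarV s₁ h1 (by omega)).eq_edgeAt hc
      have h4 := inEdge_end (l := m) (v := v) ⟨κ.1, by rwa [← hm]⟩
        (hstarU s₁ (by omega) (by omega))
      rcases h4 with h4 | h4
      · exact absurd h4 huv_ne
      · rw [← hvu] at h4
        rw [hm, H.nbr_inj v h4]
  -- and all agents of the group visit this copy
  have hvisit : ∀ a, ∃ t, a ∈ D → tu ≤ t ∧ t ≤ t₀ ∧ InCore κ (P a t) := by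
    intro a
    by_cases ha : a ∈ D
    · obtain ⟨t, h1, h2, h3⟩ := (hscene l₁).visit (τ := σ) hs1.le hs12 (by omega) h.mem
        (by rw [hκ]; exact nearEdge_endOf _ σ) hin hp hq ha
      exact ⟨t, fun _ => ⟨by omega, by omega, h3⟩⟩
    · exact ⟨0, fun h => absurd h ha⟩
  choose S hS using hvisit
  have hstart : ∀ m, m ≠ l₁ → ∀ a ∈ D,
      StartSide (o.edgeAt v m) (o.sideAt v m) (P a (S a)) := by
    intro m hm a ha
    refine .inr ⟨κ, (hS a ha).2.2, ?_, ?_⟩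
    · rw [hκ]; exact fun he => hm (edgeAt_injective v he).symm
    · rw [hκ, o.endOf_edgeAt, sideAt_eq h.cls, ← sideAt_eq h.cls v l₁, o.endOf_edgeAt]
  have hstartI : StartSide (o.edgeAt v l₁) (!o.sideAt v l₁) (P i tu) := by
    left; rw [endOf_edgeAt_not, hvu]; exact hu.inZone
  have h0side : ∀ m, OnSide (o.edgeAt v m) (o.sideAt v m) (P i) tu t₀ := by
    intro m
    refine ⟨t₀, by omega, le_rfl, .inl (by rw [o.endOf_edgeAt]; exact h0v.inZone), ?_⟩
    rintro t h1 h2 ⟨c, hc⟩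
    obtain rfl := le_antisymm h2 h1
    exact hc.not_inZone h0v.inZone
  -- when `i` leaves `v`, all agents of the group are around `v`
  have hall : ∀ a ∈ D, InStar v (P a t₀) := by
    intro a ha
    refine inStar_of_attached h.cls fun m => ?_
    by_cases hm : InEdge (o.edgeAt v m) (P a t₀)
    · exact .inl hm
    right
    have hsc : Scene B L r P cls D i (o.edgeAt v m) tu t₀ := (hscene m).mono le_rfl (by omega)
    obtain ⟨h1, h2, h3⟩ := hS a ha
    by_cases hml : m = l₁
    · subst hml
      obtain ⟨σ', hσ'⟩ := hsc.exists_onSide_of_inEdge h1 h2 ⟨κ.1, by rwa [← hκ]⟩ hm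
      by_cases hσ : σ' = o.sideAt v m
      · rw [← hσ]; exact hsc.attached_of_onSide ha hσ'
      · rw [Bool.eq_not_of_ne hσ] at hσ'
        exact absurd hσ' (hsc.not_onSide h.mem ha le_rfl (by omega) hstartI
          (by rw [Bool.not_not]; exact h0side m))
    · have hs := hstart m hml a ha
      obtain ⟨σ', hσ'⟩ := hsc.exists_onSide h1 h2 hs hm
      by_cases hσ : σ' = o.sideAt v m
      · rw [← hσ]; exact hsc.attached_of_onSide ha hσ'
      · rw [Bool.eq_not_of_ne hσ] at hσ'
        exact absurd (h0side m) (hsc.not_onSide ha h.mem h1 h2 hs hσ')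
  -- the first arrival of an agent of the group at another macro vertex
  obtain ⟨τ, h0τ, hτ1, ⟨b, hb, w, hwv, hbw⟩, hτfirst⟩ : ∃ t, t₀ + 1 ≤ t ∧ t ≤ t₁ ∧
      (∃ b ∈ D, ∃ w, w ≠ v ∧ AtMain w (P b t)) ∧
      ∀ t', t₀ + 1 ≤ t' → t' < t → ¬ ∃ b ∈ D, ∃ w, w ≠ v ∧ AtMain w (P b t') :=
    exists_first ⟨t₁, h01, le_rfl, i, h.mem, v', hv'v, hv'⟩
  have hstay : ∀ t, t₀ ≤ t → t < τ → ∀ a ∈ D, InStar v (P a t) := fun t h1 h2 a ha =>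
    h.stay hLv hall (fun t h1 h2 b hb w hw hbw => hτfirst t h1 h2 ⟨b, hb, w, hw, hbw⟩) h1 h2 ha
  obtain ⟨hnLv, hnLn⟩ := h.not_L hLv
  obtain ⟨z, rfl⟩ : ∃ z, τ = z + 1 := ⟨τ - 1, by omega⟩
  obtain ⟨m, rfl⟩ : ∃ m, w = H.nbr m v := by
    have h1 := hstay z (by omega) (by omega) b hb
    rcases (h.among.moves b).of_inStar (h.cls v) h1
      ((h.among.moves b).inside_of_inStar hnLv hnLn h1) with h2 | ⟨l, h2⟩
    · exact absurd (h2.eq_of_atMain hbw) hwv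
    · exact ⟨l, hbw.inZone.unique h2.inZone⟩
  have hml : m ≠ l₁ := by
    rintro rfl
    have hsc : Scene B L r P cls D i (o.edgeAt v m) tu (z + 1) := (hscene m).mono le_rfl hτ1
    refine hsc.not_onSide h.mem hb le_rfl (by omega) hstartI ?_
      ⟨z + 1, by omega, le_rfl, .inl (by rw [endOf_edgeAt_not]; exact hbw.inZone), ?_⟩
    · rw [Bool.not_not]
      refine ⟨t₀, by omega, by omega, .inl (by rw [o.endOf_edgeAt]; exact h0v.inZone), ?_⟩
      intro t h1 h2 h3
      rcases Nat.lt_or_ge t₀ t with h4 | h4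
      · rcases inEdge_end h3 (hstarV' t h4 (by omega)) with h5 | h5
        · exact hv'v h5
        · rw [hvu] at h5; exact hv'u h5
      · obtain rfl := le_antisymm h4 h1
        obtain ⟨c, hc⟩ := h3
        exact hc.not_inZone h0v.inZone
    · rintro t h1 h2 ⟨c, hc⟩
      obtain rfl := le_antisymm h2 h1
      exact hc.not_inZone hbw.inZone
  refine ⟨v, m, t₀, z + 1, by omega, by omega, by omega, hlev.1, h0v, hstay, ?_⟩
  exact ((hscene m).mono le_rfl hτ1).arrive (by omega) hnLv hnLn
    (fun a ha => ⟨(hS a ha).1, (hS a ha).2.1.trans (by omega), hstart m hml a ha⟩)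
    (hstay z (by omega) (by omega)) hb hbw

end Company

end Departure

/-! ### Groups follow walkers -/

section Passage

variable {k s r : ℕ} {A : Agents k s} {V W X : Type} {H : CubicGraph W} {o : Direction H}
  {B : TwoPort V} {p q : W} {hpq : p ≠ q} {G : CubicGraph X} {g : Slot G} {pos₀ : Fin k → X}
  {cls : W → Bool} {lev : W → ℤ} {D : Finset (Fin k)} {i : Fin k} {y T : ℕ}

/-- The run of all agents on a graph joined to `H(B)`, started outside of `H(B)`. -/
noncomputable abbrev outerRun (A : Agents k s) (B : TwoPort V) (o : Direction H) (p q : W)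
    (hpq : p ≠ q) (G : CubicGraph X) (g : Slot G) (pos₀ : Fin k → X) :
    ℕ → Snapshot k s ((Bool × GadgetVertex o V) ⊕ X) :=
  A.run (join (expandTwoPort B o p q hpq) G g) fun i => .inr (pos₀ i)

theorem exists_hasConfig {σ : Snapshot k s ((Bool × GadgetVertex o V) ⊕ X)} {w : W}
    (h : ∀ a ∈ D, InStar w (σ.pos a)) : ∃ c, HasConfig σ w D c := by
  choose a ha using h
  exact ⟨fun i => (σ.state i, σ.entry i, a i i.2), fun i => ⟨rfl, rfl, ha i i.2⟩⟩

/-- The configuration of a group upon its arrival at a macro vertex is counted by `alpha`. -/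
theorem Company.mem_macroConfigs [Finite W] [Finite X] (hH : H.graph.Connected)
    (hG : G.graph.Connected)
    (h : Company B (fun w => w = p ∨ w = q) r
      (fun a t => (outerRun A B o p q hpq G g pos₀ t).pos a) cls lev D i y T)
    {v w : W} {t τ : ℕ} (hvw : v ≠ w) (hlev : |lev v - lev w| ≤ 8) (hy : y ≤ t) (ht : t < τ)
    (hT : τ ≤ T) (hv : ∃ b ∈ D, AtMain v ((outerRun A B o p q hpq G g pos₀ t).pos b))
    (hstay : ∀ t', t ≤ t' → t' < τ → ∀ a ∈ D,
      InStar v ((outerRun A B o p q hpq G g pos₀ t').pos a))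
    (hw : ∃ b ∈ D, AtMain w ((outerRun A B o p q hpq G g pos₀ τ).pos b)) {c : Config s D V}
    (hc : HasConfig (outerRun A B o p q hpq G g pos₀ τ) w D c) : c ∈ macroConfigs A B D := by
  refine .inr ⟨W, X, ‹_›, ‹_›, H, o, p, q, hpq, G, g, fun i => .inr (pos₀ i), τ, w, hH, hG,
    fun i a e b => by simp, v, t, hvw, ht, hv, fun t' h1 h2 => exists_hasConfig (hstay t' h1 h2), ?_, hw, hc⟩
  intro t' h1 h2
  have alone : ∀ v', InStar v' ((outerRun A B o p q hpq G g pos₀ t').pos i) →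
      |lev v' - lev v| ≤ 8 → |lev v' - lev w| ≤ 8 →
      AloneAt (outerRun A B o p q hpq G g pos₀ t') D v ∧
        AloneAt (outerRun A B o p q hpq G g pos₀ t') D w := fun v' h3 h4 h5 =>
    ⟨fun j hj a ha => h.alone (hy.trans h1) (h2.trans hT) h3 h4 hj ⟨a, ha⟩,
      fun j hj a ha => h.alone (hy.trans h1) (h2.trans hT) h3 h5 hj ⟨a, ha⟩⟩
  rcases Nat.lt_or_ge t' τ with h3 | h3
  · exact alone v (hstay t' h1 h3 i h.mem) (by simp) hlev
  · obtain rfl := le_antisymm h2 h3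
    exact alone w ⟨_, (hc ⟨i, h.mem⟩).2.2⟩ (by rwa [abs_sub_comm]) (by simp)

/-- If the walker of the group `D` remains between the levels `lo` and `hi`, then the agent `i` of
`D` cannot get from a level below `n₀` to a level above `hi`, because from some moment on the group
moves like the walker. -/
theorem Company.exists_lev_le [Finite W] [Finite X] (hH : H.graph.Connected)
    (hG : G.graph.Connected)
    (h : Company B (fun w => w = p ∨ w = q) r
      (fun a t => (outerRun A B o p q hpq G g pos₀ t).pos a) cls lev D i y T) (hyT : y ≤ T)
    {n₀ lo hi : ℤ} (hlo : lo ≤ n₀) (hhi : n₀ + 2 ≤ hi)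
    (hblock : ∀ S w, cls w = (groupWalker A B D).cls S → n₀ ≤ lev w → lev w ≤ n₀ + 2 →
      ∀ n, lo ≤ lev ((groupWalker A B D).walk H w S n) ∧
        lev ((groupWalker A B D).walk H w S n) ≤ hi)
    (hL : ∀ w, w = p ∨ w = q → lev w < lo - 5 ∨ hi + 5 < lev w)
    (hy : ∃ w, InStar w ((outerRun A B o p q hpq G g pos₀ y).pos i) ∧ lev w < n₀) :
    ∃ w, InStar w ((outerRun A B o p q hpq G g pos₀ T).pos i) ∧ lev w ≤ hi := by
  by_contra hT
  push Not at hT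
  have hLw : ∀ w, lo ≤ lev w → lev w ≤ hi → ∀ w', w' = p ∨ w' = q → 4 < |lev w' - lev w| := by
    intro w h1 h2 w' hw'
    have := hL w' hw'
    rw [lt_abs]
    omega
  have loop : ∀ (N : ℕ) (S₀ : {c // c ∈ macroConfigs A B D} × Bool) (w₀ : W),
      (∀ n, lo ≤ lev ((groupWalker A B D).walk H w₀ S₀ n) ∧
        lev ((groupWalker A B D).walk H w₀ S₀ n) ≤ hi) →
      ∀ (n τ : ℕ) (w : W) (l : Fin 3) (c : Config s D V) (hc : c ∈ macroConfigs A B D),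
        T - τ < N → y ≤ τ → τ ≤ T → Gathered B (fun w => w = p ∨ w = q) r
          (fun a t => (outerRun A B o p q hpq G g pos₀ t).pos a) cls D i w l τ →
        HasConfig (outerRun A B o p q hpq G g pos₀ τ) w D c →
        (groupWalker A B D).next^[n] S₀ = (⟨c, hc⟩, cls w) →
        (groupWalker A B D).walk H w₀ S₀ n = w → False := by
    intro N S₀ w₀ hwalk
    induction N with
    | zero => intros; omega
    | succ N ih =>
      intro n τ w l c hc hN hyτ hτT hg hcfg hS hw
      have hlevw := hwalk n
      rw [hw] at hlevw
      have hLw := hLw w hlevw.1 hlevw.2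
      by_cases hex : ∃ t, τ + 1 ≤ t ∧ t ≤ T ∧ ∃ b ∈ D, ∃ w', w' ≠ w ∧
          AtMain w' ((outerRun A B o p q hpq G g pos₀ t).pos b)
      · obtain ⟨τ', h1, h2, ⟨b, hb, w', hww, hbw⟩, hfirst⟩ := exists_first hex
        have hno : ∀ t, τ < t → t < τ' → ∀ b ∈ D, ∀ w', w' ≠ w →
            ¬ AtMain w' ((outerRun A B o p q hpq G g pos₀ t).pos b) :=
          fun t h3 h4 b hb w' hw' hbw => hfirst t h3 h4 ⟨b, hb, w', hw', hbw⟩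
        obtain ⟨l', rfl, hg'⟩ := h.next hyτ h2 h1 hLw hg hno hb hww hbw
        have hstay : ∀ t, τ ≤ t → t < τ' → ∀ a ∈ D,
            InStar w ((outerRun A B o p q hpq G g pos₀ t).pos a) := fun t h3 h4 a ha =>
          h.stay hLw (fun a ha => hg.inStar ha) hno h3 h4 ha
        have hnear := h.lip l' w
        obtain ⟨l₂, c', hl₂, hnext, hcfg'⟩ := macroNext_of_run (β := cls w) (w' := H.nbr l' w) h1
          (h.cls w) (fun w' hw' => ⟨fun he => (h.not_L hLw).1 (he ▸ hw'),
            fun l he => (h.not_L hLw).2 l (he ▸ hw')⟩) hcfg hstay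
          (fun t h3 h4 j hj a ha => h.alone (hyτ.trans h3) (by omega) (hstay t h3 h4 i h.mem)
            (by simp) hj ⟨a, ha⟩) hww ⟨b, hb, hbw⟩
          (fun l'' hl'' a ha => by
            obtain rfl := H.nbr_inj w hl''
            have := hg'.around a ha
            rwa [edgeAt_nbr] at this)
        obtain rfl : l' = l₂ := H.nbr_inj w hl₂
        have hc' : c' ∈ macroConfigs A B D := h.mem_macroConfigs hH hG hww.symm
          (by rw [abs_sub_comm]; omega) hyτ h1 h2 hg.visit hstay ⟨b, hb, hbw⟩ hcfg'
        have hstep := groupWalker_eq (q := (⟨c, hc⟩, cls w)) (c' := ⟨c', hc'⟩) hnext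
        refine ih (n + 1) τ' (H.nbr l' w) l' c' hc' (by omega) (by omega) h2 hg' hcfg' ?_ ?_
        · rw [Function.iterate_succ_apply', hS, hstep.2, cls_nbr h.cls]
        · rw [Walker.walk, hS, hstep.1, hw]
      · have := hT w (h.inStar_of_no_main hyτ (hg.inStar h.mem) hτT le_rfl
          fun t h1 h2 l' hl' => hex ⟨t, h1, h2, i, h.mem, _, H.nbr_ne l' w, hl'⟩)
        omega
  obtain ⟨v, m, t₀, τ, h1, h2, h3, h4, h5, h6, h7⟩ := h.exists_gathered hyT (n₀ := n₀)
    (fun w hw => by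
      have := hL w hw
      rw [lt_abs]
      omega) hy (fun w hw => by
      have := hT w hw
      omega)
  obtain ⟨c, hcfg⟩ := exists_hasConfig (w := H.nbr m v)
    (σ := outerRun A B o p q hpq G g pos₀ τ) fun a ha => h7.inStar ha
  have hlip := h.lip m v
  have hc : c ∈ macroConfigs A B D := h.mem_macroConfigs hH hG (H.nbr_ne m v).symm
    (by rw [abs_sub_comm]; omega) h1 h2 h3 ⟨i, h.mem, h5⟩ h6 h7.visit hcfg
  rw [abs_le] at hlip
  exact loop (T - τ + 1) (⟨c, hc⟩, cls (H.nbr m v)) (H.nbr m v)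
    (hblock _ _ rfl (by omega) (by omega)) 0 τ _ m c hc (by omega) (by omega) h3 h7 hcfg rfl rfl

end Passage

/-! ### The size of `H(B)` -/

section Card

variable {V W : Type} {H : CubicGraph W} {o : Direction H}

/-- The vertices of `H(B)` in one copy, given by macro vertices, labels and vertices of `B`. -/
def GadgetVertex.code : GadgetVertex o V → W × (Unit ⊕ Fin 3 ⊕ (Fin 3 × Fin 3) ⊕ (Fin 3 × V))
  | .main w => (w, .inl ())
  | .hub w l => (w, .inr (.inl l))
  | .rim w l x => (w, .inr (.inr (.inl (l, x))))
  | .core e b => (e.1.1, .inr (.inr (.inr (e.1.2, b))))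

theorem GadgetVertex.code_injective : Function.Injective (GadgetVertex.code (o := o) (V := V)) := by
  intro y y' h
  cases y <;> cases y' <;> simp [code] at h ⊢
  · exact h
  · exact h
  · exact h
  · exact ⟨Subtype.ext (Prod.ext h.1 h.2.1), h.2.2⟩

instance [Finite V] [Finite W] : Finite (GadgetVertex o V) :=
  Finite.of_injective _ GadgetVertex.code_injective

theorem card_gadgetVertex_le [Finite V] [Finite W] [Nonempty V] :
    Nat.card (Bool × GadgetVertex o V) ≤ 32 * (Nat.card W * Nat.card V) := by
  have h := Nat.card_le_card_of_injective _ (GadgetVertex.code_injective (o := o) (V := V))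
  simp only [Nat.card_prod, Nat.card_sum, Nat.card_eq_fintype_card, Fintype.card_prod,
    Fintype.card_fin, Fintype.card_unit, Fintype.card_bool] at h ⊢
  have hV : 1 ≤ Nat.card V := Nat.card_pos
  nlinarith [Nat.zero_le (Nat.card W), Nat.mul_le_mul_left (Nat.card W) hV]

end Card

/-! ### Blocking all groups -/

section Final

variable {k s r : ℕ} {A : Agents k s} {V W X : Type} {H : CubicGraph W} {o : Direction H}
  {B : TwoPort V} {p q : W} {hpq : p ≠ q} {G : CubicGraph X} {g : Slot G} {pos₀ : Fin k → X}

/-- Each copy of `B` remains a barrier inside `H(B)`. -/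
theorem amongBarriers_run [Finite V] [Finite W] [Finite X] (hr : 2 ≤ r)
    (hB : IsBarrier A (r - 1) B) (hH : H.graph.Connected) (hG : G.graph.Connected) :
    AmongBarriers B (fun w => w = p ∨ w = q) r
      fun a t => (outerRun A B o p q hpq G g pos₀ t).pos a := by
  have hports : ∀ i, ∃ w, ((expandTwoPort B o p q hpq).port i).2.zone = some w ∧
      (w = p ∨ w = q) := by
    rintro ⟨a, x⟩
    cases a
    · exact ⟨p, by cases x <;> rfl, .inl rfl⟩
    · exact ⟨q, by cases x <;> rfl, .inr rfl⟩
  have hcore : ∀ κ : Bool × DirEdge o, ∃ (Z : Type) (ρ : ℕ → Snapshot k s (V ⊕ Z)),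
      (∀ a t, Inside ρ a t ↔ InCore κ ((outerRun A B o p q hpq G g pos₀ t).pos a)) ∧
      (∀ σ a t, AtSide B ρ σ a t ↔ AtPort B κ σ ((outerRun A B o p q hpq G g pos₀ t).pos a)) ∧
      NoTraversal B (r - 1) ρ ∧ NoSplit B (r - 1) ρ := by
    intro κ
    obtain ⟨Z, ρ, φ, hφ, hf, hrun, h1, h2⟩ := (isPart_core (B := B) (hpq := hpq) (G := G)
      (g := g) κ).barrier hB (join_expand_connected hB.2.2.1 hH hG)
      (pos₀ := fun i => .inr (pos₀ i)) (fun i b => by simp)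
    have hpos : ∀ a t b, (ρ t).pos a = .inl b ↔
        (outerRun A B o p q hpq G g pos₀ t).pos a = .inl (κ.1, .core κ.2 b) := by
      intro a t b
      rw [outerRun, hrun, ← hf b]
      exact hφ.eq_iff.symm
    exact ⟨Z, ρ, fun a t => exists_congr fun b => hpos a t b,
      fun σ a t => exists_congr fun x => hpos a t _, h1, h2⟩
  refine ⟨fun a => ⟨fun t y hy => ?_, fun t z y hz hy => ?_⟩, ?_, ?_⟩
  · rcases A.run_pos_succ (join (expandTwoPort B o p q hpq) G g) (fun i => .inr (pos₀ i)) t a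
      with h | ⟨m, h⟩
    · exact .inl (h.trans hy)
    · simp only [outerRun] at hy ⊢
      rw [h, hy]
      rcases join_nbr_cases (B := B) (hpq := hpq) (G := G) (g := g) m y with h1 | ⟨⟨x, h1⟩, i, rfl⟩
      · exact .inr (.inl ⟨m, h1⟩)
      · exact .inr (.inr ⟨hports i, x, h1⟩)
  · rcases A.run_pos_succ (join (expandTwoPort B o p q hpq) G g) (fun i => .inr (pos₀ i)) t a
      with h | ⟨m, h⟩
    · simp only [outerRun] at hy hz
      rw [h, hz] at hy
      cases hy
    · simp only [outerRun] at hy hz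
      rw [h, hz] at hy
      have h2 := congrArg ((join (expandTwoPort B o p q hpq) G g).nbr m) hy
      rw [CubicGraph.nbr_nbr] at h2
      rcases join_nbr_cases (B := B) (hpq := hpq) (G := G) (g := g) m y with h1 | ⟨-, i, rfl⟩
      · rw [h1] at h2; cases h2
      · exact hports i
  · intro κ S hS i hi σ t₁ t₂ h12 honly hin hp hq
    obtain ⟨Z, ρ, hI, hP, h1, -⟩ := hcore κ
    exact h1 S (by omega) i hi σ t₁ t₂ h12 (fun t h3 h4 j hj => honly t h3 h4 j ((hI j t).1 hj))
      (fun t h3 h4 => (hI i t).2 (hin t h3 h4)) ((hP σ i t₁).2 hp) ((hP _ i t₂).2 hq)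
  · intro κ S hS i hi j hj σ t₁ t₂ h12 honly hvis hp hi2 hj2 hli hlj
    obtain ⟨Z, ρ, hI, hP, -, h1⟩ := hcore κ
    refine h1 S (by omega) i hi j hj σ t₁ t₂ h12
      (fun t h3 h4 j hj => honly t h3 h4 j ((hI j t).1 hj)) (fun a ha => ?_) ((hP σ i t₁).2 hp)
      (fun h => hi2 ((hI _ _).1 h)) (fun h => hj2 ((hI _ _).1 h))
      (fun t h3 h4 h5 h6 => (hP _ _ _).2 (hli t h3 h4 ((hI _ _).1 h5) fun h => h6 ((hI _ _).2 h)))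
      (fun t h3 h4 h5 h6 => (hP _ _ _).2 (hlj t h3 h4 ((hI _ _).1 h5) fun h => h6 ((hI _ _).2 h)))
    obtain ⟨t, h3, h4, h5⟩ := hvis a ha
    exact ⟨t, h3, h4, (hI a t).2 h5⟩

variable {P : Fin k → ℕ → (Bool × GadgetVertex o V) ⊕ X} {L : W → Prop} {cls : W → Bool}
  {lev : W → ℤ}

/-- No group of `r` agents that is alone gets from the middle levels to a level above `hi`. The middle
levels have a margin of 16 on both sides of `mid`, as two agents that are close to each other may be
at slightly different levels. -/
def NoAscent (B : TwoPort V) (L : W → Prop) (r : ℕ)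
    (P : Fin k → ℕ → (Bool × GadgetVertex o V) ⊕ X) (cls : W → Bool) (lev : W → ℤ)
    (mid hi : ℤ) : Prop :=
  ∀ (D : Finset (Fin k)) (i : Fin k) (y T : ℕ) (n₀ : ℤ), Company B L r P cls lev D i y T → y ≤ T →
    mid - 16 ≤ n₀ → n₀ ≤ mid + 16 → (∃ w, InStar w (P i y) ∧ lev w < n₀) →
    ∃ w, InStar w (P i T) ∧ lev w ≤ hi

theorem Company.neg {D : Finset (Fin k)} {i : Fin k} {y T : ℕ}
    (h : Company B L r P cls lev D i y T) : Company B L r P cls (fun w => -lev w) D i y T :=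
  { h with
    lip := fun m w => by
      have := h.lip m w
      rw [abs_le] at this ⊢
      omega
    apart := fun t h1 h2 a ha w w' hw hw' => by
      have := h.apart t h1 h2 a ha w w' hw hw'
      rwa [show -lev w - -lev w' = -(lev w - lev w') by ring, abs_neg] }

theorem abs_lev_sub_le (hlip : ∀ m w, |lev (H.nbr m w) - lev w| ≤ 1) {w w' : W}
    {z : (Bool × GadgetVertex o V) ⊕ X} (h : InStar w z) (h' : InZone w' z) :
    |lev w' - lev w| ≤ 1 := by
  rcases h.cases with h | ⟨l, h, -⟩ | ⟨l, c, h⟩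
  · rw [h.unique h']; simp
  · rw [h'.unique h]; exact hlip l w
  · exact absurd h' h.not_inZone

/-- An agent that is in `H(B)` at first and outside later has left it in the meantime. -/
theorem exists_exit {x : ℕ → (Bool × GadgetVertex o V) ⊕ X} {t₁ t₂ : ℕ} (h12 : t₁ ≤ t₂)
    (h1 : ∃ z, x t₁ = .inl z) (h2 : ¬ ∃ z, x t₂ = .inl z) :
    ∃ t, t₁ ≤ t ∧ t < t₂ ∧ (∀ t', t₁ ≤ t' → t' ≤ t → ∃ z, x t' = .inl z) ∧
      ¬ ∃ z, x (t + 1) = .inl z := by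
  obtain ⟨t, h3, h4, h5, h6⟩ := exists_first (p := fun t => ¬ ∃ z, x t = .inl z)
    ⟨t₂, h12, le_rfl, h2⟩
  have h7 : t ≠ t₁ := by rintro rfl; exact h5 h1
  obtain ⟨u, rfl⟩ : ∃ u, t = u + 1 := ⟨t - 1, by omega⟩
  exact ⟨u, by omega, by omega, fun t' h8 h9 => not_not.1 (h6 t' h8 (by omega)), h5⟩

/-- If no group of `r` agents ascends or descends from the middle levels, then no `r + 1` agents
split up. Consider the last moment at which two agents leaving at opposite sides were close
to each other: one of them has still to get through the upper or the lower half, together with the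
`r - 1` remaining agents. -/
theorem no_split_of_noAscent {mid lo hi : ℤ} (hA : AmongBarriers B L r P)
    (hcls : ∀ w l, o.out w l = cls w) (hlip : ∀ m w, |lev (H.nbr m w) - lev w| ≤ 1)
    (hup : NoAscent B L r P cls lev mid hi)
    (hdown : NoAscent B L r P cls (fun w => -lev w) (-mid) (-lo)) (hlo : lo ≤ mid - 12)
    (hhi : mid + 12 ≤ hi) {w₀ w₁ : W} (hw₀ : lev w₀ + 1 < lo) (hw₁ : hi + 1 < lev w₁)
    {S : Finset (Fin k)} (hS : S.card = r + 1) {i j : Fin k} (hi' : i ∈ S) (hj : j ∈ S)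
    (hij : i ≠ j) {t₁ t₂ : ℕ} (h12 : t₁ ≤ t₂)
    (honly : ∀ t, t₁ ≤ t → t ≤ t₂ → ∀ a, (∃ z, P a t = .inl z) → a ∈ S)
    (hstart : InZone w₀ (P i t₁)) (hi2 : ¬ ∃ z, P i t₂ = .inl z) (hj2 : ¬ ∃ z, P j t₂ = .inl z)
    (hiexit : ∀ t, t₁ ≤ t → t < t₂ → (∃ z, P i t = .inl z) → (¬ ∃ z, P i (t + 1) = .inl z) →
      InZone w₁ (P i t))
    (hjexit : ∀ t, t₁ ≤ t → t < t₂ → (∃ z, P j t = .inl z) → (¬ ∃ z, P j (t + 1) = .inl z) →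
      InZone w₀ (P j t)) : False := by
  have inl : ∀ {w : W} {z : (Bool × GadgetVertex o V) ⊕ X}, InStar w z → ∃ y, z = .inl y :=
    fun h => ⟨_, h.choose_spec⟩
  -- two agents that are not close to each other give rise to a group that is alone
  have company : ∀ a b, a ∈ S → b ∈ S → a ≠ b → ∀ y T, t₁ ≤ y → T ≤ t₂ →
      (∀ t, y ≤ t → t ≤ T → ∃ z, P a t = .inl z) →
      (∀ t, y ≤ t → t ≤ T → ∀ w w', InStar w (P a t) → InStar w' (P b t) →
        8 < |lev w - lev w'|) → Company B L r P cls lev (S.erase b) a y T := by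
    intro a b ha hb hab y T hy hT hin hfar
    refine ⟨hA, hcls, hlip, Finset.mem_erase.2 ⟨hab, ha⟩, ?_, hin, ?_⟩
    · rw [Finset.card_erase_of_mem hb, hS]; rfl
    · intro t h1 h2 c hc w w' hw hw'
      have hcS := honly t (by omega) (by omega) c (inl hw')
      obtain rfl : c = b := by
        by_contra hcb
        exact hc (Finset.mem_erase.2 ⟨hcb, hcS⟩)
      exact hfar t h1 h2 w w' hw hw'
  have end_up : ∀ T, t₁ ≤ T → T < t₂ → (∃ z, P i T = .inl z) → (¬ ∃ z, P i (T + 1) = .inl z) →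
      ¬ ∃ w, InStar w (P i T) ∧ lev w ≤ hi := by
    rintro T h1 h2 h3 h4 ⟨w, hw, hle⟩
    have := abs_lev_sub_le hlip hw (hiexit T h1 h2 h3 h4)
    rw [abs_le] at this
    omega
  let close : ℕ → Prop := fun t =>
    ∃ w w', InStar w (P i t) ∧ InStar w' (P j t) ∧ |lev w - lev w'| ≤ 8
  by_cases hclose : ∃ t, t₁ ≤ t ∧ t ≤ t₂ ∧ close t
  · obtain ⟨y, h1, h2, ⟨w, w', hw, hw', hww⟩, hlast⟩ := exists_last hclose
    have hfar : ∀ t, y < t → t ≤ t₂ → ∀ w w', InStar w (P i t) → InStar w' (P j t) →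
        8 < |lev w - lev w'| := fun t h3 h4 w w' h5 h6 => by
      by_contra h7
      exact hlast t h3 h4 ⟨w, w', h5, h6, not_lt.1 h7⟩
    -- one step later the level has hardly changed
    have succ : ∀ a v T, InStar v (P a y) → y + 1 ≤ T →
        (∀ t, y ≤ t → t ≤ T → ∃ z, P a t = .inl z) →
        ∃ v', InStar v' (P a (y + 1)) ∧ |lev v' - lev v| ≤ 1 := by
      intro a v T hv hT hin
      rcases (hA.moves a).of_inStar (hcls v) hv (hin _ (by omega) hT) with h3 | ⟨l, h3⟩
      · exact ⟨v, h3, by simp⟩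
      · exact ⟨_, h3.inStar, hlip l v⟩
    rw [abs_le] at hww
    -- at this moment `i` is in the lower half, or else `j` is not far below the upper half
    rcases le_or_gt (lev w) mid with hmid | hmid
    · obtain ⟨T, h3, h4, h5, h6⟩ := exists_exit h2 (inl hw) hi2
      have hend := end_up T (by omega) h4 (h5 T h3 le_rfl) h6
      have hyT : y + 1 ≤ T := by
        rcases Nat.lt_or_ge y T with h | h
        · exact h
        · obtain rfl := le_antisymm h h3
          exact absurd ⟨w, hw, by omega⟩ hend
      obtain ⟨v, hv, hvw⟩ := succ i w T hw hyT h5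
      rw [abs_le] at hvw
      exact hend (hup _ i (y + 1) T (mid + 2)
        (company i j hi' hj hij (y + 1) T (by omega) (by omega)
          (fun t h7 h8 => h5 t (by omega) h8) fun t h7 h8 => hfar t (by omega) (by omega))
        hyT (by omega) (by omega) ⟨v, hv, by omega⟩)
    · obtain ⟨T, h3, h4, h5, h6⟩ := exists_exit h2 (inl hw') hj2
      have hzone := hjexit T (by omega) h4 (h5 T h3 le_rfl) h6
      have hend : ¬ ∃ w, InStar w (P j T) ∧ -lev w ≤ -lo := by
        rintro ⟨v, hv, hle⟩
        have := abs_lev_sub_le hlip hv hzone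
        rw [abs_le] at this
        omega
      have hyT : y + 1 ≤ T := by
        rcases Nat.lt_or_ge y T with h | h
        · exact h
        · obtain rfl := le_antisymm h h3
          exact absurd ⟨w', hw', by omega⟩ hend
      obtain ⟨v, hv, hvw⟩ := succ j w' T hw' hyT h5
      rw [abs_le] at hvw
      exact hend (hdown _ j (y + 1) T (-mid + 10)
        (company j i hj hi' hij.symm (y + 1) T (by omega) (by omega)
          (fun t h7 h8 => h5 t (by omega) h8) fun t h7 h8 w w' h9 h10 => by
            rw [abs_sub_comm]
            exact hfar t (by omega) (by omega) w' w h10 h9).neg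
        hyT (by omega) (by omega) ⟨v, hv, by show -lev v < -mid + 10; omega⟩)
  · obtain ⟨T, h3, h4, h5, h6⟩ := exists_exit h12 (inl hstart.inStar) hi2
    refine end_up T h3 h4 (h5 T h3 le_rfl) h6 (hup _ i t₁ T mid
      (company i j hi' hj hij t₁ T le_rfl (by omega) h5 fun t h7 h8 w w' h9 h10 => ?_) h3
      (by omega) (by omega) ⟨w₀, hstart.inStar, by omega⟩)
    by_contra h11
    exact hclose ⟨t, h7, by omega, w, w', h9, h10, not_lt.1 h11⟩

/-- If no group of `r` agents ascends, no set of at most `r` agents that is alone in `H(B)` gets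
from a low level to a high one. -/
theorem no_traversal_of_noAscent {mid hi : ℤ} (hA : AmongBarriers B L r P)
    (hcls : ∀ w l, o.out w l = cls w) (hlip : ∀ m w, |lev (H.nbr m w) - lev w| ≤ 1)
    (hup : NoAscent B L r P cls lev mid hi) {w₀ w₁ : W} (hw₀ : lev w₀ < mid)
    (hw₁ : hi + 1 < lev w₁) {S : Finset (Fin k)} (hr : r ≤ k) (hS : S.card ≤ r) {i : Fin k}
    (hi' : i ∈ S) {t₁ t₂ : ℕ} (h12 : t₁ ≤ t₂)
    (honly : ∀ t, t₁ ≤ t → t ≤ t₂ → ∀ a, (∃ z, P a t = .inl z) → a ∈ S)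
    (hin : ∀ t, t₁ ≤ t → t ≤ t₂ → ∃ z, P i t = .inl z)
    (h1 : InZone w₀ (P i t₁)) (h2 : InZone w₁ (P i t₂)) : False := by
  obtain ⟨D, hSD, -, hD⟩ := Finset.exists_subsuperset_card_eq (Finset.subset_univ S) hS
    (by simpa using hr)
  obtain ⟨w, hw, hle⟩ := hup D i t₁ t₂ mid
    ⟨hA, hcls, hlip, hSD hi', hD, hin, fun t h3 h4 a ha w w' hw hw' =>
      absurd (hSD (honly t h3 h4 a ⟨_, hw'.choose_spec⟩)) ha⟩ h12 (by omega) (by omega)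
    ⟨w₀, h1.inStar, hw₀⟩
  have := abs_lev_sub_le hlip hw h2
  rw [abs_le] at this
  omega

end Final

/-- The constant is `32 · 3120`: a macro vertex comes with at most 32 vertices for each vertex of
`B`, and the chain of rings that blocks all groups has at most `3120 · binom(k, r) · α ^ 2`
vertices. -/
theorem mainTheorem10 :
    ∃ C : ℕ, ∀ (k s r : ℕ), 2 ≤ r → r ≤ k → ∀ (A : Agents k s) (V : Type) [Finite V]
      (B : TwoPort V), IsBarrier A (r - 1) B →
      ∃ (W : Type) (_ : Finite W) (H : CubicGraph W) (o : Direction H) (p q : W) (hpq : p ≠ q),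
        H.graph.Connected ∧
        IsBarrier A r (expandTwoPort B o p q hpq) ∧
        (∀ (x y : Bool)
          (P : (expandTwoPort B o p q hpq).graph.Walk
            ((expandTwoPort B o p q hpq).port (false, x))
            ((expandTwoPort B o p q hpq).port (true, y))),
          3 ≤ {e | Traverses B P.getVert P.length e}.ncard) ∧
        Nat.card (Bool × GadgetVertex o V) ≤
          C * (k.choose r * Nat.card V * alpha A r B ^ 2) := by
  refine ⟨32 * 3120, fun k s r h2r hrk A V _ B hB => ?_⟩
  have hα : 1 ≤ alpha A r B := one_le_alpha hrk
  let ι : Type := {D // D ∈ Finset.powersetCard r (Finset.univ : Finset (Fin k))}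
  have hι : Fintype.card ι = k.choose r := by
    rw [Fintype.card_coe, Finset.card_powersetCard, Finset.card_univ, Fintype.card_fin]
  have : Nonempty ι := by
    rw [← Fintype.card_pos_iff, hι]
    exact Nat.choose_pos hrk
  obtain ⟨W, hW, H, o, cls, p, q, lev, mid, top, hH, hcls, hlip, hp, hq, hmid, htop, hblock₁,
    hblock₂, hcard⟩ := Chain.exists_blocking (ι := ι) (fun D => groupWalker A B D.1) hα fun D =>
      card_groupWalker_le (Finset.mem_powersetCard.1 D.2).2
  have hpq : p ≠ q := by
    rintro rfl
    omega
  have hne : Nonempty V := hB.2.2.1.nonempty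
  refine ⟨W, hW, H, o, p, q, hpq, hH, ⟨by omega, hrk, expand_connected hB.2.2.1 hH, ?_⟩,
    three_le_ncard_traverses hlip hp (by omega), ?_⟩
  · intro X _ G g hG pos₀
    have hA := amongBarriers_run (o := o) (hpq := hpq) (g := g) (pos₀ := pos₀) h2r hB hH hG
    have hzone : ∀ {side z}, (∃ x, z = Sum.inl ((expandTwoPort B o p q hpq).port (side, x))) →
        InZone (X := X) (if side then q else p) z := by
      rintro side z ⟨x, rfl⟩
      exact ⟨_, rfl, by cases side <;> cases x <;> rfl⟩
    have hup : NoAscent B (fun w => w = p ∨ w = q) r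
        (fun a t => (outerRun A B o p q hpq G g pos₀ t).pos a) cls lev mid (top - 40) := by
      intro D i y T n₀ h hyT h1 h2 hy
      refine h.exists_lev_le (lo := 40) hH hG hyT (by omega) (by omega) (fun S w hS h3 h4 n =>
        ⟨hblock₂ ⟨D, Finset.mem_powersetCard.2 ⟨Finset.subset_univ _, h.card⟩⟩ S w hS (by omega) n,
          hblock₁ ⟨D, Finset.mem_powersetCard.2 ⟨Finset.subset_univ _, h.card⟩⟩ S w hS
            (by omega) n⟩) ?_ hy
      rintro w (rfl | rfl) <;> omega
    have hdown : NoAscent B (fun w => w = p ∨ w = q) r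
        (fun a t => (outerRun A B o p q hpq G g pos₀ t).pos a) cls (fun w => -lev w) (-mid)
        (-40) := by
      intro D i y T n₀ h hyT h1 h2 hy
      refine h.exists_lev_le (lo := 40 - top) hH hG hyT (by omega) (by omega)
        (fun S w hS h3 h4 n => ?_) ?_ hy
      · have h5 : lev ((groupWalker A B D).walk H w S n) ≤ top - 40 := hblock₁ ⟨D, Finset.mem_powersetCard.2 ⟨Finset.subset_univ _, h.card⟩⟩
          S w hS (by omega) n
        have h6 : 40 ≤ lev ((groupWalker A B D).walk H w S n) := hblock₂ ⟨D, Finset.mem_powersetCard.2 ⟨Finset.subset_univ _, h.card⟩⟩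
          S w hS (by omega) n
        constructor <;> omega
      · rintro w (rfl | rfl) <;> omega
    have hlip' : ∀ m w, |-lev (H.nbr m w) - -lev w| ≤ 1 := fun m w => by
      have := hlip m w
      rw [abs_le] at this ⊢
      omega
    have hup' : NoAscent B (fun w => w = p ∨ w = q) r
        (fun a t => (outerRun A B o p q hpq G g pos₀ t).pos a) cls (fun w => - -lev w) (- -mid)
        (-(40 - top)) := by
      simpa using hup
    constructor
    · intro S hS i hi side t₁ t₂ h12 honly hin h1 h2
      have h1 := hzone h1
      have h2 := hzone h2
      cases side
      · exact no_traversal_of_noAscent hA hcls hlip hup (w₀ := p) (w₁ := q) (by omega) (by omega) hrk hS hi h12 honly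
          hin h1 h2
      · exact no_traversal_of_noAscent hA hcls hlip' hdown (w₀ := q) (w₁ := p) (by omega) (by omega) hrk hS hi h12 honly
          hin h1 h2
    · intro S hS i hi j hj side t₁ t₂ h12 honly _ h1 hi2 hj2 hiexit hjexit
      by_cases hij : i = j
      · subst hij
        obtain ⟨x, hx⟩ := h1
        obtain ⟨t, h3, h4, h5, h6⟩ := exists_exit
          (x := fun t => (outerRun A B o p q hpq G g pos₀ t).pos i) h12 ⟨_, hx⟩ hi2
        obtain ⟨x, hx⟩ := hiexit t h3 h4 (h5 t h3 le_rfl) h6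
        obtain ⟨x', hx'⟩ := hjexit t h3 h4 (h5 t h3 le_rfl) h6
        rw [hx, Sum.inl.injEq] at hx'
        have := congrArg Prod.fst ((expandTwoPort B o p q hpq).port_inj hx')
        simp at this
      have h1 := hzone h1
      have hi' := fun t h3 h4 h5 h6 => hzone (hiexit t h3 h4 h5 h6)
      have hj' := fun t h3 h4 h5 h6 => hzone (hjexit t h3 h4 h5 h6)
      cases side
      · exact no_split_of_noAscent hA hcls hlip hup hdown (w₀ := p) (w₁ := q) (by omega) (by omega) (by omega)
          (by omega) hS hi hj hij h12 honly h1 hi2 hj2 hi' hj'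
      · exact no_split_of_noAscent hA hcls hlip' hdown hup' (w₀ := q) (w₁ := p) (by omega) (by omega) (by omega)
          (by omega) hS hi hj hij h12 honly h1 hi2 hj2 hi' hj'
  · rw [hι] at hcard
    calc Nat.card (Bool × GadgetVertex o V) ≤ 32 * (Nat.card W * Nat.card V) :=
        card_gadgetVertex_le
      _ ≤ 32 * (3120 * (k.choose r * alpha A r B ^ 2) * Nat.card V) := by gcongr
      _ = _ := by ring
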